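/- Let $\Omega\subset\mathbb{C}$ be the open unit disc, $m$ Lebesgue measure, $2<p<\infty$ and $\alpha=1-\frac2p$. For functions $f$ on $\Omega$ put $$\mathcal{C}f(z)=\frac1\pi\int_\Omega\frac{f(\xi)}{z-\xi}\,dm(\xi),\qquad \overline{\mathcal{C}}f(z)=\frac1\pi\int_\Omega\frac{f(\xi)}{\bar z-\bar\xi}\,dm(\xi),$$ $$\Pi f(z)=-\frac1\pi\,\mathrm{p.v.}\!\int_\Omega\frac{f(\xi)}{(z-\xi)^2}\,dm(\xi),\qquad \overline{\Pi}f(z)=-\frac1\pi\,\mathrm{p.v.}\!\int_\Omega\frac{f(\xi)}{(\bar z-\bar\xi)^2}\,dm(\xi).$$ Write $\|\cdot\|_p$ and $\|\cdot\|_\infty$ for the norms of $L^p(\Omega)$ and $L^\infty(\Omega)$, and $$\|f\|_\alpha=\sup_{z\in\overline\Omega}|f(z)|+\sup_{z\ne w\in\overline\Omega}\frac{|f(z)-f(w)|}{|z-w|^\alpha}$$ for the norm of $C^\alpha(\overline\Omega)$. For $f\in L^p(\Omega)$ the integrals defining $\mathcal{C}f,\overline{\mathcal{C}}f$ converge at every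 point of $\overline\Omega$, the principal values defining $\Pi f,\overline{\Pi}f$ exist almost everywhere in $\Omega$, and there are finite constants $C_\alpha,B_p$ such that for all $f\in L^p(\Omega)$ $$\|\mathcal{C}f\|_\alpha,\ \|\overline{\mathcal{C}}f\|_\alpha\le C_\alpha\|f\|_p,\qquad \|\Pi f\|_p,\ \|\overline{\Pi}f\|_p\le B_p\|f\|_p. \tag{1}$$ Let $C_\alpha,B_p\ge0$ be any constants satisfying (1). Let $q_1,q_2\in L^p(\Omega)$, $z_0\in\Omega$, $n>1$ real, and $R(z)=(z-z_0)^2+(\bar z-\bar z_0)^2$. Then for every $f\in C^\alpha(\overline\Omega)$ the functions $\mathcal{C}(e^{-inR}\,\overline{\mathcal{C}}(e^{inR}q_1f))$ and $\overline{\mathcal{C}}(e^{-inR}\,\mathcal{C}(e^{inR}q_2f))$ belong to $C^\alpha(\overline\Omega)$ and $$\|\mathcal{C}(e^{-inR}\,\overline{\mathcal{C}}(e^{inR}q_1f))\|_\alpha,\ \|\overline{\mathcal{C}}(e^{-inR}\,\mathcal{C}(e^{inR}q_2f))\|_\alpha\le C\,n^{-\frac{2}{p(2p+1)}}\|f\|_\infty,$$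 where $C=400\,(C_\alpha+11)(C_\alpha+B_p)\max(\|q_1\|_p,\|q_2\|_p)$. Consequently, if moreover $n>\left(\tfrac12C\right)^{\frac{p(2p+1)}2}$, the operators $$f\mapsto-\tfrac14\,\mathcal{C}(e^{-inR}\,\overline{\mathcal{C}}(e^{inR}q_1f)),\qquad f\mapsto-\tfrac14\,\overline{\mathcal{C}}(e^{-inR}\,\mathcal{C}(e^{inR}q_2f))$$ map $C^\alpha(\overline\Omega)$ into itself and are contractions there, with a Lipschitz constant smaller than $\frac12$. -/

import Mathlib

open MeasureTheory Filter Topology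
open scoped ENNReal NNReal ComplexConjugate

noncomputable section

namespace Bukhgeim

/-- The open unit disc `Ω`. -/
def disc : Set ℂ := Metric.ball 0 1

/-- The closed unit disc. -/
def closedDisc : Set ℂ := Metric.closedBall 0 1

/-- Lebesgue measure on the open unit disc. -/
def discMeasure : Measure ℂ := volume.restrict disc

/-- The norm of `L^p(Ω)`, `0 < p < ∞`, with values in `[0, ∞]`. -/
def lpDisc (p : ℝ) (f : ℂ → ℂ) : ℝ≥0∞ := eLpNorm f (ENNReal.ofReal p) discMeasure

/-- The norm of `L^∞(Ω)`, with values in `[0, ∞]`. -/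
def supDisc (f : ℂ → ℂ) : ℝ≥0∞ := eLpNorm f ∞ discMeasure

/-- Membership in `L^p(Ω)`. -/
def MemLpDisc (p : ℝ) (f : ℂ → ℂ) : Prop := MemLp f (ENNReal.ofReal p) discMeasure

/-- The norm of the Hölder space `C^α` of the closed disc, with values in `[0, ∞]`: the supremum
of `|f|` plus the supremum of the difference quotients of order `α`. -/
def holderNorm (α : ℝ) (f : ℂ → ℂ) : ℝ≥0∞ :=
  (⨆ z ∈ closedDisc, ‖f z‖ₑ) +
    ⨆ z ∈ closedDisc, ⨆ w ∈ closedDisc, ⨆ _ : z ≠ w,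
      ‖f z - f w‖ₑ / ENNReal.ofReal (‖z - w‖ ^ α)

/-- Membership in the Hölder space `C^α` of the closed disc. -/
def MemHolderDisc (α : ℝ) (f : ℂ → ℂ) : Prop :=
  ContinuousOn f closedDisc ∧ holderNorm α f < ∞

/-- The Cauchy operator `𝒞`. -/
def cauchy (f : ℂ → ℂ) (z : ℂ) : ℂ :=
  (1 / (Real.pi : ℂ)) * ∫ ξ, f ξ / (z - ξ) ∂discMeasure

/-- The conjugate Cauchy operator. -/
def cauchyBar (f : ℂ → ℂ) (z : ℂ) : ℂ :=
  (1 / (Real.pi : ℂ)) * ∫ ξ, f ξ / (conj z - conj ξ) ∂discMeasure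

/-- The two Cauchy integrals of `f` at `z` converge (absolutely). -/
def CauchyConverges (f : ℂ → ℂ) (z : ℂ) : Prop :=
  Integrable (fun ξ => f ξ / (z - ξ)) discMeasure ∧
    Integrable (fun ξ => f ξ / (conj z - conj ξ)) discMeasure

/-- The Beurling integral over the part of the disc at distance at least `ε` from `z`. -/
def beurlingTrunc (f : ℂ → ℂ) (z : ℂ) (ε : ℝ) : ℂ :=
  -(1 / (Real.pi : ℂ)) * ∫ ξ in disc \ Metric.ball z ε, f ξ / (z - ξ) ^ 2

/-- The conjugate Beurling integral over the part of the disc at distance at least `ε` from `z`. -/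
def beurlingBarTrunc (f : ℂ → ℂ) (z : ℂ) (ε : ℝ) : ℂ :=
  -(1 / (Real.pi : ℂ)) * ∫ ξ in disc \ Metric.ball z ε, f ξ / (conj z - conj ξ) ^ 2

/-- The Beurling operator `Π`, a principal value integral. -/
def beurling (f : ℂ → ℂ) (z : ℂ) : ℂ := limUnder (𝓝[>] (0 : ℝ)) (beurlingTrunc f z)

/-- The conjugate Beurling operator, a principal value integral. -/
def beurlingBar (f : ℂ → ℂ) (z : ℂ) : ℂ := limUnder (𝓝[>] (0 : ℝ)) (beurlingBarTrunc f z)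

/-- The two principal values of `f` at `z` exist. -/
def BeurlingConverges (f : ℂ → ℂ) (z : ℂ) : Prop :=
  (∃ l : ℂ, Tendsto (beurlingTrunc f z) (𝓝[>] (0 : ℝ)) (𝓝 l)) ∧
    ∃ l : ℂ, Tendsto (beurlingBarTrunc f z) (𝓝[>] (0 : ℝ)) (𝓝 l)

/-- `A` is an admissible constant `C_α`, `α = 1 - 2/p`: it bounds the norms of the two Cauchy
operators from `L^p(Ω)` to `C^α`. -/
def IsCauchyConst (p : ℝ) (A : ℝ≥0) : Prop :=
  ∀ f : ℂ → ℂ, MemLpDisc p f →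
    holderNorm (1 - 2 / p) (cauchy f) ≤ A * lpDisc p f ∧
      holderNorm (1 - 2 / p) (cauchyBar f) ≤ A * lpDisc p f

/-- `B` is an admissible constant `B_p`: it bounds the norms of the two Beurling operators in
`L^p(Ω)`. -/
def IsBeurlingConst (p : ℝ) (B : ℝ≥0) : Prop :=
  ∀ f : ℂ → ℂ, MemLpDisc p f →
    lpDisc p (beurling f) ≤ B * lpDisc p f ∧ lpDisc p (beurlingBar f) ≤ B * lpDisc p f

/-- The (real-valued) phase `R = (z - z₀)² + (z̄ - z̄₀)²`. -/
def phase (z₀ z : ℂ) : ℂ := (z - z₀) ^ 2 + (conj z - conj z₀) ^ 2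

/-- The oscillating factor `e^{inR}`. -/
def osc (n : ℝ) (z₀ z : ℂ) : ℂ := Complex.exp (Complex.I * n * phase z₀ z)

/-- The operator `f ↦ 𝒞(e^{-inR} 𝒞̄(e^{inR} q f))`. -/
def opT (n : ℝ) (z₀ : ℂ) (q f : ℂ → ℂ) : ℂ → ℂ :=
  cauchy fun z => osc (-n) z₀ z * cauchyBar (fun w => osc n z₀ w * q w * f w) z

/-- The operator `f ↦ 𝒞̄(e^{-inR} 𝒞(e^{inR} q f))`. -/
def opTBar (n : ℝ) (z₀ : ℂ) (q f : ℂ → ℂ) : ℂ → ℂ :=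
  cauchyBar fun z => osc (-n) z₀ z * cauchy (fun w => osc n z₀ w * q w * f w) z

/-- The operator `S = -(1/4) 𝒞(e^{-inR} 𝒞̄(e^{inR} q ·))` of the fixed-point equation
`f = 1 + S f`. -/
def opS (n : ℝ) (z₀ : ℂ) (q f : ℂ → ℂ) : ℂ → ℂ := fun z => -(1 / 4) * opT n z₀ q f z

/-- The operator `S̄ = -(1/4) 𝒞̄(e^{-inR} 𝒞(e^{inR} q ·))` of the conjugate fixed-point equation. -/
def opSBar (n : ℝ) (z₀ : ℂ) (q f : ℂ → ℂ) : ℂ → ℂ := fun z => -(1 / 4) * opTBar n z₀ q f z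

/-- The constant `C = 400 (C_α + 11) (C_α + B_p) max(‖q₁‖_p, ‖q₂‖_p)`. -/
def boundConst (p : ℝ) (Ca Bp : ℝ≥0) (q₁ q₂ : ℂ → ℂ) : ℝ≥0∞ :=
  400 * (Ca + 11) * (Ca + Bp) * max (lpDisc p q₁) (lpDisc p q₂)

/-- `T` maps `C^α` of the closed disc into itself and is a contraction there, with a constant
smaller than `1/2`. -/
def IsHalfContraction (α : ℝ) (T : (ℂ → ℂ) → ℂ → ℂ) : Prop :=
  (∀ f, MemHolderDisc α f → MemHolderDisc α (T f)) ∧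
    ∃ κ : ℝ≥0, κ < 1 / 2 ∧ ∀ f g, MemHolderDisc α f → MemHolderDisc α g →
      holderNorm α (T f - T g) ≤ κ * holderNorm α (f - g)

end Bukhgeim

end

/-!
Write `∂` and `∂̄` for the Wirtinger derivatives, and encode a Fréchet derivative of a function of a
complex variable as `wirt a b`, the map `w ↦ a w + b w̄` with `a = ∂u`, `b = ∂̄u`.

**Cauchy operators.** Hölder's inequality, with the integrability of `|w|^{-q}` for `q < 2`, gives
the convergence of the integrals and the bound in `C^{1 - 2/p}` (`exists_isCauchyConst`).

**Beurling operators.** Integration by parts against the Lipschitz kernel which is `w̄ / ε²` on the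
disc of radius `ε` and `1 / w` outside shows that, for a test function `g`, the Beurling integral of
`∂̄g` truncated at `ε` is the mean of `∂g` over the disc of radius `ε` around the point; moreover
`‖∂g‖₂ = ‖∂̄g‖₂`. Since the functions `∂̄g` are dense, every `f ∈ L²` has an `F` with `‖F‖₂ ≤ ‖f‖₂`
whose means over discs are the truncated integrals of `f` (`exists_isBeurlingPair`), and Lebesgue's
differentiation theorem gives the principal value almost everywhere. For `p > 2` the `L^p` bound
follows from a good-`λ` inequality between the maximal functions of `|F|²` and `|f|²`
(`exists_lintegral_rpow_beurling_le`), in which the part of `f` far away from a disc contributes the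
same mean to all smaller concentric discs.

**Decay.** Let `h = e^{inR} q f` and `g = 𝒞̄h`. The kernel of `g` is regularized at a scale `δ`,
replacing `1 / w̄` by `w / (|w|² + δ²)`; the resulting `g_δ` differs from `g` by `O(δ)` in `L^p`
(Young's inequality), is bounded by `C_α ‖h‖_p`, and its derivatives are bounded by
`C_α ‖h‖_p / (2δ)`. Both bounds follow by applying the definition of `C_α` to a function of modulus
at most `|h|` which aligns the phases of the integrand (`integral_norm_mul_kernel_le`). Dividing
`g_δ` by the derivative `∂̄R = 2 (z̄ - z̄₀)`, again regularized, cutting off at the boundary of the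
disc and multiplying by `e^{-inR}` gives a function `u` vanishing outside the disc such that
`e^{-inR} g` is a multiple of `n⁻¹ ∂̄u` up to a term small in `L^p` (`osc_mul_regCauchy_eq`,
`lpDisc_remainder_le`). By the Cauchy–Pompeiu formula `𝒞(∂̄u) = u` (`cauchy_oscCorrectorDbar`), and
`n⁻¹ u` is small in `C^α` by interpolation between its supremum and its Lipschitz constant. With
`δ = n^{-2/(2p+1)}` all terms are `O(n^{-2/(p(2p+1))})`. The constant obtained involves `C_α` only,
and is smaller than the stated one. The second operator reduces to the first by complex conjugation
(`opTBar_eq`), and the contraction property follows from additivity (`isHalfContraction_of_le`).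
-/

noncomputable section

/-! ### Wirtinger derivatives and integration by parts -/

namespace Bukhgeim

/-- The real-linear map `w ↦ a w + b w̄`. A function with this Fréchet derivative has Wirtinger
derivatives `∂ = a` and `∂̄ = b`. -/
def wirt (a b : ℂ) : ℂ →L[ℝ] ℂ :=
  a • ContinuousLinearMap.id ℝ ℂ + b • (Complex.conjCLE : ℂ →L[ℝ] ℂ)

@[simp] lemma wirt_apply (a b w : ℂ) : wirt a b w = a * w + b * conj w := by
  simp [wirt]

lemma norm_wirt_le (a b : ℂ) : ‖wirt a b‖ ≤ ‖a‖ + ‖b‖ := by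
  refine ContinuousLinearMap.opNorm_le_bound _ (by positivity) fun w => ?_
  rw [wirt_apply]
  calc ‖a * w + b * conj w‖ ≤ ‖a * w‖ + ‖b * conj w‖ := norm_add_le _ _
    _ = (‖a‖ + ‖b‖) * ‖w‖ := by simp; ring

lemma wirt_eq (L : ℂ →L[ℝ] ℂ) :
    L = wirt ((L 1 - Complex.I * L Complex.I) / 2) ((L 1 + Complex.I * L Complex.I) / 2) := by
  ext w
  have hw : w = w.re • (1 : ℂ) + w.im • Complex.I := by
    simp
  rw [wirt_apply]
  conv_lhs => rw [hw, map_add, map_smul, map_smul]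
  have h1 : w = w.re + w.im * Complex.I := (Complex.re_add_im w).symm
  have h2 : conj w = w.re - w.im * Complex.I := by
    apply Complex.ext <;> simp
  rw [h2]
  conv_rhs => rw [h1]
  simp only [Complex.real_smul]
  have := Complex.I_sq
  simp only [Complex.add_re, Complex.add_im, Complex.ofReal_re, Complex.ofReal_im, Complex.mul_re,
    Complex.mul_im, Complex.I_re, Complex.I_im]
  push_cast
  ring_nf
  rw [this]; ring

lemma wirt_injective {a b a' b' : ℂ} (h : wirt a b = wirt a' b') : a = a' ∧ b = b' := by
  have h1 := congrArg (fun L => L 1) h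
  have h2 := congrArg (fun L => L Complex.I) h
  simp only [wirt_apply, Complex.conj_I, map_one, mul_one] at h1 h2
  have h3 : a - b = a' - b' := by
    have := Complex.I_ne_zero
    apply mul_right_cancel₀ this
    linear_combination h2
  constructor
  · linear_combination (h1 + h3) / 2
  · linear_combination (h1 - h3) / 2

lemma hasFDerivAt_wirt_mul {u v : ℂ → ℂ} {a b a' b' z : ℂ} (hu : HasFDerivAt u (wirt a b) z)
    (hv : HasFDerivAt v (wirt a' b') z) :
    HasFDerivAt (fun w => u w * v w) (wirt (u z * a' + v z * a) (u z * b' + v z * b)) z := by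
  refine (hu.mul hv).congr_fderiv ?_
  ext w
  simp
  ring

lemma hasFDerivAt_wirt_id (z : ℂ) : HasFDerivAt (fun w : ℂ => w) (wirt 1 0) z := by
  refine (hasFDerivAt_id z).congr_fderiv ?_
  ext w; simp

lemma hasFDerivAt_wirt_conj (z : ℂ) : HasFDerivAt (fun w : ℂ => conj w) (wirt 0 1) z := by
  refine ((Complex.conjCLE : ℂ →L[ℝ] ℂ).hasFDerivAt (x := z)).congr_fderiv ?_
  ext w; simp

lemma hasFDerivAt_wirt_const (c z : ℂ) : HasFDerivAt (fun _ : ℂ => c) (wirt 0 0) z := by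
  refine (hasFDerivAt_const c z).congr_fderiv ?_
  ext w; simp

lemma hasFDerivAt_wirt_add {u v : ℂ → ℂ} {a b a' b' z : ℂ} (hu : HasFDerivAt u (wirt a b) z)
    (hv : HasFDerivAt v (wirt a' b') z) :
    HasFDerivAt (fun w => u w + v w) (wirt (a + a') (b + b')) z := by
  refine (hu.add hv).congr_fderiv ?_
  ext w
  simp
  ring

lemma hasFDerivAt_wirt_sub {u v : ℂ → ℂ} {a b a' b' z : ℂ} (hu : HasFDerivAt u (wirt a b) z)
    (hv : HasFDerivAt v (wirt a' b') z) :
    HasFDerivAt (fun w => u w - v w) (wirt (a - a') (b - b')) z := by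
  refine (hu.sub hv).congr_fderiv ?_
  ext w
  simp
  ring

/-- Chain rule for a holomorphic outer function. -/
lemma hasFDerivAt_wirt_comp {φ u : ℂ → ℂ} {a b c z : ℂ} (hφ : HasDerivAt φ c (u z))
    (hu : HasFDerivAt u (wirt a b) z) :
    HasFDerivAt (fun w => φ (u w)) (wirt (c * a) (c * b)) z := by
  refine ((hφ.hasFDerivAt.restrictScalars ℝ).comp z hu).congr_fderiv ?_
  ext w
  simp
  ring

/-- Integration by parts for complex Lipschitz functions, along a direction `v`. -/
lemma integral_lineDeriv_mul_eq_neg {k u : ℂ → ℂ} {C D : ℝ≥0} (hk : LipschitzWith C k)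
    (hu : LipschitzWith D u) (hc : HasCompactSupport u) {k' u' : ℂ → ℂ →L[ℝ] ℂ}
    (hk' : ∀ᵐ z, HasFDerivAt k (k' z) z) (hu' : ∀ᵐ z, HasFDerivAt u (u' z) z) (v : ℂ) :
    Integrable (fun z => k' z v * u z) ∧ Integrable (fun z => k z * u' z v) ∧
    ∫ z, k' z v * u z = - ∫ z, k z * u' z v := by
  have reL : LipschitzWith 1 Complex.re :=
    LipschitzWith.of_dist_le_mul fun x y => by
      simpa [dist_eq_norm] using Complex.abs_re_le_norm (x - y)
  have imL : LipschitzWith 1 Complex.im :=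
    LipschitzWith.of_dist_le_mul fun x y => by
      simpa [dist_eq_norm] using Complex.abs_im_le_norm (x - y)
  have kr := reL.comp hk
  have ki := imL.comp hk
  have ur := reL.comp hu
  have ui := imL.comp hu
  have cr : HasCompactSupport (Complex.re ∘ u) := hc.comp_left (by simp)
  have ci : HasCompactSupport (Complex.im ∘ u) := hc.comp_left (by simp)
  -- identification of the line derivatives of real and imaginary parts
  have ldr : ∀ (g : ℂ → ℂ) (g' : ℂ →L[ℝ] ℂ) (z : ℂ), HasFDerivAt g g' z →
      lineDeriv ℝ (Complex.re ∘ g) z v = (g' v).re := by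
    intro g g' z h
    have := (Complex.reCLM.hasFDerivAt.comp z h)
    exact (this.hasLineDerivAt v).lineDeriv
  have ldi : ∀ (g : ℂ → ℂ) (g' : ℂ →L[ℝ] ℂ) (z : ℂ), HasFDerivAt g g' z →
      lineDeriv ℝ (Complex.im ∘ g) z v = (g' v).im := by
    intro g g' z h
    have := (Complex.imCLM.hasFDerivAt.comp z h)
    exact (this.hasLineDerivAt v).lineDeriv
  -- integrability of the products
  have I1 : ∀ (f g : ℂ → ℝ) (C D : ℝ≥0), LipschitzWith C f → LipschitzWith D g →
      HasCompactSupport g → Integrable (fun z => lineDeriv ℝ f z v * g z) := by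
    intro f g C D hf hg hcg
    have := (hf.locallyIntegrable_lineDeriv v (μ := (volume : Measure ℂ)))
    have := this.integrable_smul_right_of_hasCompactSupport hg.continuous hcg
    simpa using this
  have I2 : ∀ (f g : ℂ → ℝ) (C D : ℝ≥0), LipschitzWith C f → LipschitzWith D g →
      HasCompactSupport g → Integrable (fun z => f z * lineDeriv ℝ g z v) := by
    intro f g C D hf hg hcg
    have h1 : LocallyIntegrable (fun z => lineDeriv ℝ g z v) (volume : Measure ℂ) :=
      hg.locallyIntegrable_lineDeriv v
    have hs : ∀ z, z ∉ tsupport g → lineDeriv ℝ g z v = 0 := by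
      intro z hz
      have : g =ᶠ[𝓝 z] fun _ => (0 : ℝ) := notMem_tsupport_iff_eventuallyEq.1 hz
      rw [this.lineDeriv_eq]
      simp [lineDeriv]
    have h3 := (h1.locallyIntegrableOn (tsupport g)).continuousOn_mul hf.continuous.continuousOn
        (isClosed_tsupport g).isLocallyClosed
    have h4 := h3.integrableOn_isCompact hcg
    refine (integrableOn_iff_integrable_of_support_subset ?_).1 h4
    intro z hz
    by_contra hzs
    exact hz (by simp [hs z hzs])
  have J : ∀ (f g : ℂ → ℝ) (C D : ℝ≥0), LipschitzWith C f → LipschitzWith D g →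
      HasCompactSupport g → ∫ z, lineDeriv ℝ f z v * g z = - ∫ z, f z * lineDeriv ℝ g z v := by
    intro f g C D hf hg hcg
    rw [hf.integral_lineDeriv_mul_eq hg hcg v, ← integral_neg]
    congr 1
    ext z
    rw [lineDeriv_neg]; ring
  have E1 : (fun z => k' z v * u z) =ᵐ[volume] fun z =>
      (((lineDeriv ℝ (Complex.re ∘ k) z v * (Complex.re ∘ u) z
        - lineDeriv ℝ (Complex.im ∘ k) z v * (Complex.im ∘ u) z : ℝ)) : ℂ)
      + ((lineDeriv ℝ (Complex.re ∘ k) z v * (Complex.im ∘ u) z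
        + lineDeriv ℝ (Complex.im ∘ k) z v * (Complex.re ∘ u) z : ℝ) : ℂ) * Complex.I := by
    filter_upwards [hk'] with z hz
    rw [ldr k _ z hz, ldi k _ z hz]
    apply Complex.ext <;> simp
  have E2 : (fun z => k z * u' z v) =ᵐ[volume] fun z =>
      ((((Complex.re ∘ k) z * lineDeriv ℝ (Complex.re ∘ u) z v
        - (Complex.im ∘ k) z * lineDeriv ℝ (Complex.im ∘ u) z v : ℝ)) : ℂ)
      + (((Complex.re ∘ k) z * lineDeriv ℝ (Complex.im ∘ u) z v
        + (Complex.im ∘ k) z * lineDeriv ℝ (Complex.re ∘ u) z v : ℝ) : ℂ) * Complex.I := by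
    filter_upwards [hu'] with z hz
    rw [ldr u _ z hz, ldi u _ z hz]
    apply Complex.ext <;> simp
  have a1 := I1 _ _ _ _ kr ur cr
  have a2 := I1 _ _ _ _ ki ui ci
  have a3 := I1 _ _ _ _ kr ui ci
  have a4 := I1 _ _ _ _ ki ur cr
  have b1 := I2 _ _ _ _ kr ur cr
  have b2 := I2 _ _ _ _ ki ui ci
  have b3 := I2 _ _ _ _ kr ui ci
  have b4 := I2 _ _ _ _ ki ur cr
  refine ⟨?_, ?_, ?_⟩
  · rw [integrable_congr E1]
    exact (a1.sub a2).ofReal.add ((a3.add a4).ofReal.mul_const _)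
  · rw [integrable_congr E2]
    exact (b1.sub b2).ofReal.add ((b3.add b4).ofReal.mul_const _)
  · rw [integral_congr_ae E1, integral_congr_ae E2]
    rw [integral_add (a1.sub a2).ofReal ((a3.add a4).ofReal.mul_const _),
      integral_add (b1.sub b2).ofReal ((b3.add b4).ofReal.mul_const _),
      integral_mul_const, integral_mul_const]
    simp only [integral_complex_ofReal]
    rw [integral_sub a1 a2, integral_add a3 a4, integral_sub b1 b2, integral_add b3 b4,
      J _ _ _ _ kr ur cr, J _ _ _ _ ki ui ci, J _ _ _ _ kr ui ci, J _ _ _ _ ki ur cr]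
    push_cast
    ring

/-- Integration by parts for the two Wirtinger derivatives of complex Lipschitz functions. -/
lemma integral_wirt_mul_eq_neg {k u : ℂ → ℂ} {C D : ℝ≥0} (hk : LipschitzWith C k)
    (hu : LipschitzWith D u) (hc : HasCompactSupport u) {k₁ k₂ a b : ℂ → ℂ}
    (hk' : ∀ᵐ z, HasFDerivAt k (wirt (k₁ z) (k₂ z)) z)
    (hu' : ∀ᵐ z, HasFDerivAt u (wirt (a z) (b z)) z) :
    ∫ z, k₁ z * u z = - ∫ z, k z * a z ∧ ∫ z, k₂ z * u z = - ∫ z, k z * b z := by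
  obtain ⟨p1, p2, p3⟩ := integral_lineDeriv_mul_eq_neg hk hu hc hk' hu' 1
  obtain ⟨q1, q2, q3⟩ := integral_lineDeriv_mul_eq_neg hk hu hc hk' hu' Complex.I
  simp only [wirt_apply, Complex.conj_I, map_one, mul_one] at p1 p2 p3 q1 q2 q3
  have hI : Complex.I * Complex.I = -1 := Complex.I_mul_I
  constructor
  · have e1 : (fun z => k₁ z * u z) = fun z => (1 / 2 : ℂ) * ((k₁ z + k₂ z) * u z) -
        (Complex.I / 2) * ((k₁ z * Complex.I + k₂ z * -Complex.I) * u z) := by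
      ext z; linear_combination (k₁ z * u z / 2 - k₂ z * u z / 2) * hI
    have e2 : (fun z => k z * a z) = fun z => (1 / 2 : ℂ) * (k z * (a z + b z)) -
        (Complex.I / 2) * (k z * (a z * Complex.I + b z * -Complex.I)) := by
      ext z; linear_combination (k z * a z / 2 - k z * b z / 2) * hI
    rw [e1, e2, integral_sub (p1.const_mul _) (q1.const_mul _),
      integral_sub (p2.const_mul _) (q2.const_mul _)]
    simp only [integral_const_mul]
    rw [p3, q3]; ring
  · have e1 : (fun z => k₂ z * u z) = fun z => (1 / 2 : ℂ) * ((k₁ z + k₂ z) * u z) +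
        (Complex.I / 2) * ((k₁ z * Complex.I + k₂ z * -Complex.I) * u z) := by
      ext z; linear_combination ((k₁ z * u z) / 2 - k₂ z * u z / 2) * -hI
    have e2 : (fun z => k z * b z) = fun z => (1 / 2 : ℂ) * (k z * (a z + b z)) +
        (Complex.I / 2) * (k z * (a z * Complex.I + b z * -Complex.I)) := by
      ext z; linear_combination ((k z * a z) / 2 - k z * b z / 2) * -hI
    rw [e1, e2, integral_add (p1.const_mul _) (q1.const_mul _),
      integral_add (p2.const_mul _) (q2.const_mul _)]
    simp only [integral_const_mul]
    rw [p3, q3]; ring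

end Bukhgeim

/-! ### The truncated Cauchy kernel -/

namespace Bukhgeim

/-- A function of `‖w - z‖` behaving like a power `> -2` is integrable on balls. -/
lemma integrableOn_ball_rpow_norm {s : ℝ} (hs : s < 2) (R : ℝ) :
    IntegrableOn (fun w : ℂ => ‖w‖ ^ (-s)) (Metric.ball 0 R) := by
  rw [integrableOn_fun_norm_addHaar (μ := (volume : Measure ℂ)) (f := fun y => y ^ (-s))]
  simp only [Complex.finrank_real_complex, smul_eq_mul]
  rcases le_or_gt R 0 with hR | hR
  · simp [Set.Ioo_eq_empty (not_lt.2 hR)]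
  have h := intervalIntegral.intervalIntegrable_rpow' (a := 0) (b := R) (r := 1 - s) (by linarith)
  rw [intervalIntegrable_iff_integrableOn_Ioo_of_le hR.le] at h
  refine h.congr_fun (fun y hy => ?_) measurableSet_Ioo
  have hy0 : (0 : ℝ) < y := hy.1
  simp only [Nat.add_one_sub_one, pow_one]
  rw [sub_eq_add_neg, Real.rpow_add hy0, Real.rpow_one]

lemma locallyIntegrable_inv : LocallyIntegrable (fun w : ℂ => w⁻¹) := by
  intro z
  refine ⟨Metric.ball 0 (‖z‖ + 1), Metric.isOpen_ball.mem_nhds (by simp), ?_⟩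
  refine (integrable_norm_iff (by fun_prop)).1 ?_
  refine (integrableOn_ball_rpow_norm (s := 1) (by norm_num) _).congr (ae_of_all _ fun w => ?_)
  simp [Real.rpow_neg_one]

lemma locallyIntegrable_inv_sub (z : ℂ) : LocallyIntegrable (fun w : ℂ => (w - z)⁻¹) := by
  intro y
  refine ⟨Metric.ball z (‖y - z‖ + 1), Metric.isOpen_ball.mem_nhds (by
    simp [dist_eq_norm]), ?_⟩
  have h : IntegrableOn (fun w : ℂ => w⁻¹) (Metric.ball 0 (‖y - z‖ + 1)) :=
    (locallyIntegrable_inv.integrableOn_isCompact (isCompact_closedBall _ _)).mono_set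
      Metric.ball_subset_closedBall
  have e : MeasurableEmbedding (fun w : ℂ => w - z) := (MeasurableEquiv.subRight z).measurableEmbedding
  have h2 := (measurePreserving_sub_right (volume : Measure ℂ) z).integrableOn_comp_preimage e
    (f := fun w : ℂ => w⁻¹) (s := Metric.ball 0 (‖y - z‖ + 1))
  have h3 : (fun w : ℂ => w - z) ⁻¹' Metric.ball 0 (‖y - z‖ + 1) = Metric.ball z (‖y - z‖ + 1) := by
    ext w; simp [dist_eq_norm]
  rw [h3] at h2
  exact h2.2 h

/-- The average of the Cauchy kernel `1 / w` over discs of radius `ε`: it is `1 / w` for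
`‖w‖ > ε` and `w̄ / ε²` for `‖w‖ ≤ ε`. -/
def truncKernel (ε : ℝ) (w : ℂ) : ℂ := if ‖w‖ ≤ ε then conj w / (ε : ℂ) ^ 2 else w⁻¹

lemma norm_truncKernel_le {ε : ℝ} (hε : 0 < ε) (w : ℂ) : ‖truncKernel ε w‖ ≤ ‖w⁻¹‖ := by
  unfold truncKernel
  split_ifs with h
  · rcases eq_or_ne w 0 with rfl | hw
    · simp
    have hw' : 0 < ‖w‖ := norm_pos_iff.2 hw
    simp only [norm_div, norm_pow, Complex.norm_real, norm_inv, RCLike.norm_conj, Real.norm_eq_abs,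
      sq_abs]
    rw [div_le_iff₀ (by positivity), inv_mul_eq_div, le_div_iff₀ hw']
    nlinarith
  · exact le_rfl

lemma lipschitzWith_truncKernel {ε : ℝ} (hε : 0 < ε) :
    LipschitzWith (Real.toNNReal (3 / ε ^ 2)) (truncKernel ε) := by
  -- the two pieces of the kernel agree on the circle `‖w‖ = ε`, where `w⁻¹ = w̄ / ε²`
  have key : ∀ v w : ℂ, ‖v‖ ≤ ε → ε < ‖w‖ →
      ‖conj v / (ε : ℂ) ^ 2 - w⁻¹‖ ≤ 3 / ε ^ 2 * ‖v - w‖ := by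
    intro v w hv hw
    have hw0 : 0 < ‖w‖ := hε.trans hw
    have hwne : w ≠ 0 := norm_pos_iff.1 hw0
    have hεc : (ε : ℂ) ≠ 0 := by exact_mod_cast hε.ne'
    have e1 : w⁻¹ = conj w / (‖w‖ : ℂ) ^ 2 := by
      rw [Complex.inv_def, ← Complex.ofReal_pow, Complex.normSq_eq_norm_sq, div_eq_mul_inv]
      push_cast; rfl
    have e2 : conj v / (ε : ℂ) ^ 2 - w⁻¹ = conj (v - w) / (ε : ℂ) ^ 2 +
        conj w * ((1 / ε ^ 2 - 1 / ‖w‖ ^ 2 : ℝ) : ℂ) := by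
      rw [e1]; push_cast; rw [map_sub]; ring
    rw [e2]
    have h1 : 0 ≤ 1 / ε ^ 2 - 1 / ‖w‖ ^ 2 :=
      sub_nonneg.2 (one_div_le_one_div_of_le (by positivity) (by gcongr))
    have h2 : ‖w‖ - ε ≤ ‖v - w‖ := by
      have := norm_sub_norm_le w v
      rw [norm_sub_rev] at this
      linarith
    have h3 : ‖w‖ * (1 / ε ^ 2 - 1 / ‖w‖ ^ 2) ≤ 2 / ε ^ 2 * (‖w‖ - ε) := by
      have : ‖w‖ * (1 / ε ^ 2 - 1 / ‖w‖ ^ 2) = (‖w‖ - ε) * (‖w‖ + ε) / (ε ^ 2 * ‖w‖) := by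
        field_simp; ring
      rw [this, div_le_iff₀ (by positivity)]
      have : 2 / ε ^ 2 * (‖w‖ - ε) * (ε ^ 2 * ‖w‖) = (‖w‖ - ε) * (2 * ‖w‖) := by
        field_simp
      rw [this]
      exact mul_le_mul_of_nonneg_left (by linarith) (by linarith)
    calc _ ≤ ‖conj (v - w) / (ε : ℂ) ^ 2‖ + ‖conj w * ((1 / ε ^ 2 - 1 / ‖w‖ ^ 2 : ℝ) : ℂ)‖ :=
          norm_add_le _ _
      _ = ‖v - w‖ / ε ^ 2 + ‖w‖ * (1 / ε ^ 2 - 1 / ‖w‖ ^ 2) := by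
          rw [norm_mul, norm_div, RCLike.norm_conj, RCLike.norm_conj, Complex.norm_real,
            Real.norm_of_nonneg h1]
          simp
      _ ≤ ‖v - w‖ / ε ^ 2 + 2 / ε ^ 2 * ‖v - w‖ := by
          have h4 : 2 / ε ^ 2 * (‖w‖ - ε) ≤ 2 / ε ^ 2 * ‖v - w‖ := by gcongr
          linarith [h3.trans h4]
      _ = 3 / ε ^ 2 * ‖v - w‖ := by ring
  refine LipschitzWith.of_dist_le_mul fun v w => ?_
  rw [dist_eq_norm, dist_eq_norm, Real.coe_toNNReal _ (by positivity)]
  unfold truncKernel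
  split_ifs with hv hw hw
  · rw [← sub_div, ← map_sub, norm_div, RCLike.norm_conj]
    simp only [norm_pow, Complex.norm_real, Real.norm_eq_abs, sq_abs]
    rw [div_eq_mul_one_div, mul_comm]
    gcongr
    norm_num
  · exact key v w hv (not_le.1 hw)
  · rw [norm_sub_rev, norm_sub_rev v w]
    exact key w v hw (not_le.1 hv)
  · push Not at hv hw
    have hv0 : v ≠ 0 := norm_pos_iff.1 (hε.trans hv)
    have hw0 : w ≠ 0 := norm_pos_iff.1 (hε.trans hw)
    rw [inv_sub_inv hv0 hw0, norm_div, norm_mul, norm_sub_rev, div_eq_mul_one_div, mul_comm]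
    gcongr
    · norm_num
    · nlinarith

lemma hasFDerivAt_truncKernel_of_lt {ε : ℝ} {w : ℂ} (h : ‖w‖ < ε) :
    HasFDerivAt (truncKernel ε) (wirt 0 (1 / (ε : ℂ) ^ 2)) w := by
  have h1 := hasFDerivAt_wirt_mul (hasFDerivAt_wirt_conj w)
    (hasFDerivAt_wirt_const (1 / (ε : ℂ) ^ 2) w)
  simp only [mul_zero, mul_one, zero_add] at h1
  refine h1.congr_of_eventuallyEq ?_
  have : ∀ᶠ v : ℂ in 𝓝 w, ‖v‖ < ε := continuous_norm.continuousAt.eventually_lt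
    continuousAt_const h
  filter_upwards [this] with v hv
  simp only [truncKernel, hv.le, if_true]
  ring

lemma hasFDerivAt_truncKernel_of_gt {ε : ℝ} (hε : 0 < ε) {w : ℂ} (h : ε < ‖w‖) :
    HasFDerivAt (truncKernel ε) (wirt (-1 / w ^ 2) 0) w := by
  have hw : w ≠ 0 := norm_pos_iff.1 (hε.trans h)
  have h1 := hasFDerivAt_wirt_comp (hasDerivAt_inv hw) (hasFDerivAt_wirt_id w)
  simp only [mul_zero, mul_one] at h1
  have e : -(w ^ 2)⁻¹ = -1 / w ^ 2 := by ring
  rw [e] at h1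
  refine h1.congr_of_eventuallyEq ?_
  have : ∀ᶠ v : ℂ in 𝓝 w, ε < ‖v‖ := continuousAt_const.eventually_lt
    continuous_norm.continuousAt h
  filter_upwards [this] with v hv
  simp only [truncKernel, not_le.2 hv, if_false]

lemma hasFDerivAt_comp_sub_const {f : ℂ → ℂ} {L : ℂ →L[ℝ] ℂ} {w z : ℂ}
    (h : HasFDerivAt f L (w - z)) : HasFDerivAt (fun v => f (v - z)) L w := by
  have := h.comp w ((hasFDerivAt_id w).sub_const z)
  exact this

/-- The Wirtinger derivative `∂` of the translated kernel `truncKernel ε (w - z)`. -/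
def truncKernelD (ε : ℝ) (z w : ℂ) : ℂ := (Metric.ball z ε)ᶜ.indicator (fun w => -1 / (w - z) ^ 2) w

/-- The Wirtinger derivative `∂̄` of the translated kernel `truncKernel ε (w - z)`. -/
def truncKernelDbar (ε : ℝ) (z w : ℂ) : ℂ := (Metric.ball z ε).indicator (fun _ => 1 / (ε : ℂ) ^ 2) w

lemma ae_hasFDerivAt_truncKernel {ε : ℝ} (hε : 0 < ε) (z : ℂ) :
    ∀ᵐ w : ℂ, HasFDerivAt (fun w => truncKernel ε (w - z))
      (wirt (truncKernelD ε z w) (truncKernelDbar ε z w)) w := by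
  have hs : volume (Metric.sphere z ε) = 0 := Measure.addHaar_sphere _ _ _
  have : ∀ᵐ w : ℂ, w ∉ Metric.sphere z ε := measure_eq_zero_iff_ae_notMem.1 hs
  filter_upwards [this] with w hw
  simp only [mem_sphere_iff_norm] at hw
  rcases lt_or_gt_of_ne hw with h | h
  · have h1 : w ∈ Metric.ball z ε := by simpa [dist_eq_norm] using h
    simp only [truncKernelD, truncKernelDbar, Set.indicator_of_mem h1]
    rw [Set.indicator_of_notMem (by simpa using h1)]
    exact hasFDerivAt_comp_sub_const (hasFDerivAt_truncKernel_of_lt h)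
  · have h1 : w ∉ Metric.ball z ε := by simpa [dist_eq_norm] using h.le
    simp only [truncKernelD, truncKernelDbar, Set.indicator_of_notMem h1]
    rw [Set.indicator_of_mem (by simpa using h1)]
    exact hasFDerivAt_comp_sub_const (hasFDerivAt_truncKernel_of_gt hε h)

lemma lipschitzWith_truncKernel_sub {ε : ℝ} (hε : 0 < ε) (z : ℂ) :
    LipschitzWith (Real.toNNReal (3 / ε ^ 2)) (fun w => truncKernel ε (w - z)) :=
  LipschitzWith.of_dist_le_mul fun v w => by
    simpa using (lipschitzWith_truncKernel hε).dist_le_mul (v - z) (w - z)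

/-! ### The Cauchy–Pompeiu formula -/

lemma wirt_eq_fderiv {u : ℂ → ℂ} {a b z : ℂ} (h : HasFDerivAt u (wirt a b) z) :
    a = (fderiv ℝ u z 1 - Complex.I * fderiv ℝ u z Complex.I) / 2 ∧
    b = (fderiv ℝ u z 1 + Complex.I * fderiv ℝ u z Complex.I) / 2 := by
  have := h.fderiv
  exact wirt_injective (this.symm.trans (wirt_eq _))

lemma measurable_wirt {u : ℂ → ℂ} {a b : ℂ → ℂ} (h : ∀ z, HasFDerivAt u (wirt (a z) (b z)) z) :
    Measurable a ∧ Measurable b := by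
  have m1 : Measurable fun z => fderiv ℝ u z 1 := measurable_fderiv_apply_const ℝ u 1
  have m2 : Measurable fun z => fderiv ℝ u z Complex.I := measurable_fderiv_apply_const ℝ u _
  have ha : a = fun z => (fderiv ℝ u z 1 - Complex.I * fderiv ℝ u z Complex.I) / 2 :=
    funext fun z => (wirt_eq_fderiv (h z)).1
  have hb : b = fun z => (fderiv ℝ u z 1 + Complex.I * fderiv ℝ u z Complex.I) / 2 :=
    funext fun z => (wirt_eq_fderiv (h z)).2
  constructor
  · rw [ha]; fun_prop
  · rw [hb]; fun_prop

lemma norm_wirt_le_of_lipschitz {u : ℂ → ℂ} {D : ℝ≥0} (hu : LipschitzWith D u) {a b z : ℂ}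
    (h : HasFDerivAt u (wirt a b) z) : ‖a‖ ≤ D ∧ ‖b‖ ≤ D := by
  have h0 : ‖fderiv ℝ u z‖ ≤ D := norm_fderiv_le_of_lipschitz ℝ hu
  have h1 : ‖fderiv ℝ u z 1‖ ≤ D := by
    simpa using (fderiv ℝ u z).le_of_opNorm_le h0 1
  have h2 : ‖fderiv ℝ u z Complex.I‖ ≤ D := by
    simpa using (fderiv ℝ u z).le_of_opNorm_le h0 Complex.I
  obtain ⟨ea, eb⟩ := wirt_eq_fderiv h
  rw [ea, eb]
  constructor
  · rw [norm_div]
    have := norm_sub_le (fderiv ℝ u z 1) (Complex.I * fderiv ℝ u z Complex.I)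
    simp only [norm_mul, Complex.norm_I, one_mul] at this
    simp only [Complex.norm_ofNat]
    linarith
  · rw [norm_div]
    have := norm_add_le (fderiv ℝ u z 1) (Complex.I * fderiv ℝ u z Complex.I)
    simp only [norm_mul, Complex.norm_I, one_mul] at this
    simp only [Complex.norm_ofNat]
    linarith

lemma wirt_eq_zero_of_notMem_tsupport {u : ℂ → ℂ} {a b z : ℂ} (h : HasFDerivAt u (wirt a b) z)
    (hz : z ∉ tsupport u) : a = 0 ∧ b = 0 := by
  have h0 : u =ᶠ[𝓝 z] fun _ => (0 : ℂ) := notMem_tsupport_iff_eventuallyEq.1 hz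
  have h1 : fderiv ℝ u z = 0 := by rw [h0.fderiv_eq]; simp
  obtain ⟨ea, eb⟩ := wirt_eq_fderiv h
  rw [ea, eb, h1]; simp

/-- A locally integrable function times a bounded measurable function with compact support. -/
lemma integrable_mul_of_bounded_of_tsupport {k b : ℂ → ℂ} {K : Set ℂ} (hk : LocallyIntegrable k)
    (hb : Measurable b) {M : ℝ} (hM : ∀ z, ‖b z‖ ≤ M) (hK : IsCompact K) (h0 : ∀ z, z ∉ K → b z = 0) :
    Integrable fun z => k z * b z := by
  have h1 : IntegrableOn (fun z => k z * b z) K := by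
    have := (hk.integrableOn_isCompact hK).bdd_mul (c := M) hb.aestronglyMeasurable
      (ae_of_all _ hM)
    exact this.congr (ae_of_all _ fun z => mul_comm _ _)
  refine (integrableOn_iff_integrable_of_support_subset ?_).1 h1
  intro z hz
  by_contra hzs
  exact hz (by simp [h0 z hzs])

/-- The **Cauchy–Pompeiu formula** for Lipschitz functions with compact support. -/
lemma integral_dbar_div_sub {u : ℂ → ℂ} {D : ℝ≥0} (hu : LipschitzWith D u)
    (hc : HasCompactSupport u) {a b : ℂ → ℂ} (h : ∀ z, HasFDerivAt u (wirt (a z) (b z)) z) (z : ℂ) :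
    Integrable (fun w => b w / (z - w)) ∧ ∫ w, b w / (z - w) = Real.pi * u z := by
  have hb := (measurable_wirt h).2
  have hbD : ∀ w, ‖b w‖ ≤ D := fun w => (norm_wirt_le_of_lipschitz hu (h w)).2
  have hb0 : ∀ w, w ∉ tsupport u → b w = 0 := fun w hw => (wirt_eq_zero_of_notMem_tsupport (h w) hw).2
  have I0 : Integrable (fun w => (w - z)⁻¹ * b w) :=
    integrable_mul_of_bounded_of_tsupport (locallyIntegrable_inv_sub z) hb hbD hc hb0
  have eq0 : (fun w => b w / (z - w)) = fun w => -((w - z)⁻¹ * b w) := by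
    ext w
    rw [← neg_sub w z, div_neg, div_eq_mul_inv, mul_comm]
  rw [eq0]
  refine ⟨I0.neg, ?_⟩
  rw [integral_neg]
  -- the identity for the averaged kernel
  have step : ∀ ε : ℝ, 0 < ε →
      ∫ w in Metric.ball z ε, (1 / (ε : ℂ) ^ 2) * u w = -∫ w, truncKernel ε (w - z) * b w := by
    intro ε hε
    have := (integral_wirt_mul_eq_neg (lipschitzWith_truncKernel_sub hε z) hu hc
      (ae_hasFDerivAt_truncKernel hε z) (ae_of_all _ h)).2
    rw [← this, ← integral_indicator Metric.isOpen_ball.measurableSet]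
    congr 1
    ext w
    by_cases hw : w ∈ Metric.ball z ε <;> simp only [truncKernelDbar, Set.indicator_of_mem,
      Set.indicator_of_notMem, hw, not_false_eq_true, zero_mul]
  -- as `ε → 0` the left side tends to `π u z`, the right side to the Cauchy integral
  have lim1 : Tendsto (fun ε : ℝ => ∫ w, truncKernel ε (w - z) * b w) (𝓝[>] 0)
      (𝓝 (∫ w, (w - z)⁻¹ * b w)) := by
    refine tendsto_integral_filter_of_dominated_convergence (fun w => ‖(w - z)⁻¹ * b w‖) ?_ ?_
      I0.norm ?_
    · filter_upwards [self_mem_nhdsWithin] with ε hε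
      exact (lipschitzWith_truncKernel_sub hε z).continuous.measurable.mul hb |>.aestronglyMeasurable
    · filter_upwards [self_mem_nhdsWithin] with ε hε
      refine ae_of_all _ fun w => ?_
      rw [norm_mul, norm_mul]
      gcongr
      exact norm_truncKernel_le hε _
    · have : ∀ᵐ w : ℂ, w ≠ z := by simp [ae_iff, measure_singleton]
      filter_upwards [this] with w hw
      refine tendsto_const_nhds.congr' ?_
      have hpos : 0 < ‖w - z‖ := norm_pos_iff.2 (sub_ne_zero.2 hw)
      filter_upwards [Ioo_mem_nhdsGT hpos] with ε hε
      simp [truncKernel, not_le.2 hε.2]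
  have lim2 : Tendsto (fun ε : ℝ => ∫ w in Metric.ball z ε, (1 / (ε : ℂ) ^ 2) * u w) (𝓝[>] 0)
      (𝓝 (Real.pi * u z)) := by
    rw [tendsto_iff_norm_sub_tendsto_zero]
    refine squeeze_zero' (g := fun ε : ℝ => D * ε * Real.pi)
      (Eventually.of_forall fun _ => norm_nonneg _) ?_ ?_
    · filter_upwards [self_mem_nhdsWithin] with ε (hε : 0 < ε)
      have hεc : (ε : ℂ) ≠ 0 := by exact_mod_cast hε.ne'
      have hv : (volume : Measure ℂ).real (Metric.ball z ε) = Real.pi * ε ^ 2 := by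
        simp [Measure.real, Complex.volume_ball, ENNReal.toReal_ofReal hε.le, mul_comm]
      have hfin : volume (Metric.ball z ε) < ∞ := measure_ball_lt_top
      have e : ∫ w in Metric.ball z ε, (1 / (ε : ℂ) ^ 2) * u w - (1 / (ε : ℂ) ^ 2) * u z =
          (∫ w in Metric.ball z ε, (1 / (ε : ℂ) ^ 2) * u w) - Real.pi * u z := by
        rw [integral_sub, setIntegral_const, hv]
        · congr 1
          rw [Complex.real_smul]; push_cast; field_simp
        · exact (((continuous_const.mul hu.continuous).continuousOn).integrableOn_compact
            (isCompact_closedBall z ε)).mono_set Metric.ball_subset_closedBall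
        · exact integrableOn_const hfin.ne
      rw [← e]
      have := norm_setIntegral_le_of_norm_le_const (μ := volume) (s := Metric.ball z ε)
        (f := fun w => (1 / (ε : ℂ) ^ 2) * u w - (1 / (ε : ℂ) ^ 2) * u z) (C := D / ε) hfin ?_
      · rw [hv] at this
        refine this.trans_eq ?_
        field_simp
      · intro w hw
        rw [← mul_sub, norm_mul]
        have h1 := hu.dist_le_mul w z
        rw [dist_eq_norm, dist_eq_norm] at h1
        have h2 : ‖w - z‖ ≤ ε := by
          rw [← dist_eq_norm]; exact (Metric.mem_ball.1 hw).le
        simp only [norm_div, norm_one, norm_pow, Complex.norm_real, Real.norm_eq_abs, sq_abs]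
        calc 1 / ε ^ 2 * ‖u w - u z‖ ≤ 1 / ε ^ 2 * (D * ε) := by
              gcongr; exact h1.trans (by gcongr)
          _ = D / ε := by field_simp
    · have : Tendsto (fun ε : ℝ => D * ε * Real.pi) (𝓝 0) (𝓝 (D * 0 * Real.pi)) := by
        exact (Continuous.tendsto (by fun_prop) 0)
      simpa using this.mono_left nhdsWithin_le_nhds
  have lim3 := lim1.neg.congr' (by
    filter_upwards [self_mem_nhdsWithin] with ε hε using (step ε hε).symm)
  exact tendsto_nhds_unique lim3 lim2

end Bukhgeim

/-! ### Wirtinger derivatives of test functions -/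

namespace Bukhgeim

/-- The Wirtinger derivative `∂`. -/
def dz (g : ℂ → ℂ) (z : ℂ) : ℂ := (fderiv ℝ g z 1 - Complex.I * fderiv ℝ g z Complex.I) / 2

/-- The Wirtinger derivative `∂̄`. -/
def dzb (g : ℂ → ℂ) (z : ℂ) : ℂ := (fderiv ℝ g z 1 + Complex.I * fderiv ℝ g z Complex.I) / 2

lemma hasFDerivAt_dz_dzb {g : ℂ → ℂ} {z : ℂ} (h : DifferentiableAt ℝ g z) :
    HasFDerivAt g (wirt (dz g z) (dzb g z)) z :=
  h.hasFDerivAt.congr_fderiv (wirt_eq _)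

lemma dz_eq {g : ℂ → ℂ} {a b z : ℂ} (h : HasFDerivAt g (wirt a b) z) : dz g z = a :=
  (wirt_eq_fderiv h).1.symm

lemma dzb_eq {g : ℂ → ℂ} {a b z : ℂ} (h : HasFDerivAt g (wirt a b) z) : dzb g z = b :=
  (wirt_eq_fderiv h).2.symm

/-- Smooth functions with compact support. -/
def IsTest (g : ℂ → ℂ) : Prop := HasCompactSupport g ∧ ContDiff ℝ (⊤ : ℕ∞) g

namespace IsTest

variable {g h : ℂ → ℂ}

lemma differentiable (hg : IsTest g) : Differentiable ℝ g :=
  hg.2.differentiable (by simp)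

lemma contDiff_fderiv_apply (hg : IsTest g) (v : ℂ) : ContDiff ℝ (⊤ : ℕ∞) fun z => fderiv ℝ g z v :=
  (hg.2.fderiv_right (m := ((⊤ : ℕ∞) : WithTop ℕ∞)) (by simp)).clm_apply contDiff_const

lemma fderiv_apply (hg : IsTest g) (v : ℂ) : IsTest fun z => fderiv ℝ g z v :=
  ⟨hg.1.fderiv_apply ℝ v, hg.contDiff_fderiv_apply v⟩

lemma const_mul (hg : IsTest g) (c : ℂ) : IsTest fun z => c * g z :=
  ⟨hg.1.mul_left, contDiff_const.mul hg.2⟩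

lemma add (hg : IsTest g) (hh : IsTest h) : IsTest fun z => g z + h z :=
  ⟨hg.1.add hh.1, hg.2.add hh.2⟩

lemma sub (hg : IsTest g) (hh : IsTest h) : IsTest fun z => g z - h z := by
  simpa [sub_eq_add_neg] using hg.add (hh.const_mul (-1))

lemma conjugate (hg : IsTest g) : IsTest fun z => conj (g z) :=
  ⟨hg.1.comp_left (g := fun z : ℂ => (starRingEnd ℂ) z) (by simp),
    (Complex.conjCLE : ℂ →L[ℝ] ℂ).contDiff.comp hg.2⟩

lemma dz (hg : IsTest g) : IsTest (dz g) := by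
  have := ((hg.fderiv_apply 1).sub ((hg.fderiv_apply Complex.I).const_mul Complex.I)).const_mul (1/2)
  convert this using 2
  simp only [Bukhgeim.dz]; ring

lemma dzb (hg : IsTest g) : IsTest (dzb g) := by
  have := ((hg.fderiv_apply 1).add ((hg.fderiv_apply Complex.I).const_mul Complex.I)).const_mul (1/2)
  convert this using 2
  simp only [Bukhgeim.dzb]; ring

lemma exists_lipschitzWith (hg : IsTest g) : ∃ C, LipschitzWith C g :=
  ContDiff.lipschitzWith_of_hasCompactSupport hg.1 hg.2 (by simp)

lemma integrable (hg : IsTest g) : Integrable g :=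
  hg.2.continuous.integrable_of_hasCompactSupport hg.1

lemma memLp (hg : IsTest g) (p : ℝ≥0∞) : MemLp g p := hg.2.continuous.memLp_of_hasCompactSupport hg.1

lemma hasFDerivAt (hg : IsTest g) (z : ℂ) :
    HasFDerivAt g (wirt (Bukhgeim.dz g z) (Bukhgeim.dzb g z)) z :=
  hasFDerivAt_dz_dzb (hg.differentiable z)

lemma dz_dzb_comm (hg : IsTest g) (z : ℂ) :
    Bukhgeim.dz (Bukhgeim.dzb g) z = Bukhgeim.dzb (Bukhgeim.dz g) z := by
  have sym : ∀ v w, fderiv ℝ (fun y => fderiv ℝ g y v) z w = fderiv ℝ (fun y => fderiv ℝ g y w) z v := by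
    intro v w
    have hd : DifferentiableAt ℝ (fderiv ℝ g) z :=
      (hg.2.fderiv_right (m := ((⊤ : ℕ∞) : WithTop ℕ∞)) (by simp)).differentiable (by simp) z
    have e : ∀ v w, fderiv ℝ (fun y => fderiv ℝ g y v) z w = fderiv ℝ (fderiv ℝ g) z w v := by
      intro v w
      rw [fderiv_clm_apply hd (differentiableAt_const v)]
      simp
    rw [e, e]
    exact (hg.2.contDiffAt.isSymmSndFDerivAt (by
      simp only [minSmoothness_of_isRCLikeNormedField]
      exact WithTop.coe_le_coe.2 (le_top : (2 : ℕ∞) ≤ ⊤))).eq w v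
  have dv : ∀ v, DifferentiableAt ℝ (fun y => fderiv ℝ g y v) z := fun v =>
    (hg.fderiv_apply v).differentiable z
  have e1 : ∀ v, fderiv ℝ (Bukhgeim.dzb g) z v = (fderiv ℝ (fun y => fderiv ℝ g y 1) z v +
      Complex.I * fderiv ℝ (fun y => fderiv ℝ g y Complex.I) z v) / 2 := by
    intro v
    have h : HasFDerivAt (Bukhgeim.dzb g) ((2 : ℂ)⁻¹ • (fderiv ℝ (fun y => fderiv ℝ g y 1) z +
      Complex.I • fderiv ℝ (fun y => fderiv ℝ g y Complex.I) z)) z := by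
      have := ((dv 1).hasFDerivAt.add ((dv Complex.I).hasFDerivAt.const_mul Complex.I)).const_mul
        (2 : ℂ)⁻¹
      refine this.congr_of_eventuallyEq (Eventually.of_forall fun y => ?_)
      simp [Bukhgeim.dzb]; ring
    rw [h.fderiv]; simp; ring
  have e2 : ∀ v, fderiv ℝ (Bukhgeim.dz g) z v = (fderiv ℝ (fun y => fderiv ℝ g y 1) z v -
      Complex.I * fderiv ℝ (fun y => fderiv ℝ g y Complex.I) z v) / 2 := by
    intro v
    have h : HasFDerivAt (Bukhgeim.dz g) ((2 : ℂ)⁻¹ • (fderiv ℝ (fun y => fderiv ℝ g y 1) z -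
      Complex.I • fderiv ℝ (fun y => fderiv ℝ g y Complex.I) z)) z := by
      have := ((dv 1).hasFDerivAt.sub ((dv Complex.I).hasFDerivAt.const_mul Complex.I)).const_mul
        (2 : ℂ)⁻¹
      refine this.congr_of_eventuallyEq (Eventually.of_forall fun y => ?_)
      simp [Bukhgeim.dz]; ring
    rw [h.fderiv]; simp; ring
  simp only [Bukhgeim.dz, Bukhgeim.dzb] at e1 e2 ⊢
  rw [e1, e1, e2, e2, sym 1 Complex.I]
  ring

end IsTest

lemma dz_sub {g h : ℂ → ℂ} (hg : IsTest g) (hh : IsTest h) :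
    dz (fun z => g z - h z) = fun z => dz g z - dz h z :=
  funext fun z => dz_eq (hasFDerivAt_wirt_sub (hg.hasFDerivAt z) (hh.hasFDerivAt z))

lemma dzb_sub {g h : ℂ → ℂ} (hg : IsTest g) (hh : IsTest h) :
    dzb (fun z => g z - h z) = fun z => dzb g z - dzb h z :=
  funext fun z => dzb_eq (hasFDerivAt_wirt_sub (hg.hasFDerivAt z) (hh.hasFDerivAt z))

lemma hasFDerivAt_wirt_conj_comp {g : ℂ → ℂ} {a b z : ℂ} (h : HasFDerivAt g (wirt a b) z) :
    HasFDerivAt (fun w => conj (g w)) (wirt (conj b) (conj a)) z := by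
  refine (((Complex.conjCLE : ℂ →L[ℝ] ℂ).hasFDerivAt (x := g z)).comp z h).congr_fderiv ?_
  ext w
  simp
  ring

/-- Integration of `∂g` over a disc, in terms of `∂̄g` outside the disc. -/
lemma integral_ball_dz {g : ℂ → ℂ} (hg : IsTest g) (z : ℂ) {ε : ℝ} (hε : 0 < ε) :
    ∫ w in Metric.ball z ε, dz g w =
      -(ε : ℂ) ^ 2 * ∫ w in (Metric.ball z ε)ᶜ, dzb g w / (w - z) ^ 2 := by
  obtain ⟨C1, h1⟩ := hg.dz.exists_lipschitzWith
  obtain ⟨C2, h2⟩ := hg.dzb.exists_lipschitzWith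
  -- both sides equal minus the integral of the kernel against `∂∂̄g`, by moving `∂̄` or `∂`
  have e1 := (integral_wirt_mul_eq_neg (lipschitzWith_truncKernel_sub hε z) h1 hg.dz.1
    (ae_hasFDerivAt_truncKernel hε z) (ae_of_all _ hg.dz.hasFDerivAt)).2
  have e2 := (integral_wirt_mul_eq_neg (lipschitzWith_truncKernel_sub hε z) h2 hg.dzb.1
    (ae_hasFDerivAt_truncKernel hε z) (ae_of_all _ hg.dzb.hasFDerivAt)).1
  simp only [hg.dz_dzb_comm] at e2
  have e3 := e1.trans e2.symm
  have l1 : ∫ w, truncKernelDbar ε z w * dz g w =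
      1 / (ε : ℂ) ^ 2 * ∫ w in Metric.ball z ε, dz g w := by
    rw [← integral_const_mul, ← integral_indicator Metric.isOpen_ball.measurableSet]
    congr 1; ext w
    by_cases hw : w ∈ Metric.ball z ε <;> simp only [truncKernelDbar, Set.indicator_of_mem,
      Set.indicator_of_notMem, hw, not_false_eq_true, zero_mul]
  have l2 : ∫ w, truncKernelD ε z w * dzb g w =
      - ∫ w in (Metric.ball z ε)ᶜ, dzb g w / (w - z) ^ 2 := by
    rw [← integral_neg, ← integral_indicator Metric.isOpen_ball.measurableSet.compl]
    congr 1; ext w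
    by_cases hw : w ∈ (Metric.ball z ε)ᶜ
    · simp only [truncKernelD, Set.indicator_of_mem hw]; ring
    · simp only [truncKernelD, Set.indicator_of_notMem hw, zero_mul]
  rw [l1, l2] at e3
  have hεc : (ε : ℂ) ≠ 0 := by exact_mod_cast hε.ne'
  field_simp at e3
  rw [e3]; ring

/-- `∂` and `∂̄` of a test function have the same norm in `L²`. -/
lemma eLpNorm_dz_eq {g : ℂ → ℂ} (hg : IsTest g) :
    eLpNorm (dz g) 2 volume = eLpNorm (dzb g) 2 volume := by
  have hgc := hg.conjugate
  have c1 : dzb (fun z => conj (g z)) = fun z => conj (dz g z) :=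
    funext fun z => dzb_eq (hasFDerivAt_wirt_conj_comp (hg.hasFDerivAt z))
  have c2 : dz (fun z => conj (g z)) = fun z => conj (dzb g z) :=
    funext fun z => dz_eq (hasFDerivAt_wirt_conj_comp (hg.hasFDerivAt z))
  obtain ⟨C0, h0⟩ := hg.exists_lipschitzWith
  obtain ⟨C1, h1⟩ := hgc.dz.exists_lipschitzWith
  obtain ⟨C2, h2⟩ := hgc.dzb.exists_lipschitzWith
  -- both norms squared are minus the integral of `g ∂∂̄ḡ`
  have e1 := (integral_wirt_mul_eq_neg h0 h2 hgc.dzb.1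
    (ae_of_all _ hg.hasFDerivAt) (ae_of_all _ hgc.dzb.hasFDerivAt)).1
  have e2 := (integral_wirt_mul_eq_neg h0 h1 hgc.dz.1
    (ae_of_all _ hg.hasFDerivAt) (ae_of_all _ hgc.dz.hasFDerivAt)).2
  simp only [hgc.dz_dzb_comm] at e1
  have e3 := e1.trans e2.symm
  rw [c1, c2] at e3
  have e4 : ∫ z, ‖dz g z‖ ^ 2 = ∫ z, ‖dzb g z‖ ^ 2 := by
    have : ∀ f : ℂ → ℂ, ∫ z, f z * conj (f z) = ((∫ z, ‖f z‖ ^ 2 : ℝ) : ℂ) := by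
      intro f
      rw [← integral_complex_ofReal]
      congr 1; ext z
      rw [Complex.mul_conj, Complex.normSq_eq_norm_sq]
    rw [this, this] at e3
    exact_mod_cast e3
  have e5 : ∀ f : ℂ → ℂ, IsTest f →
      eLpNorm f 2 volume = ENNReal.ofReal ((∫ z, ‖f z‖ ^ 2) ^ (2 : ℝ)⁻¹) := by
    intro f hf
    have := (hf.memLp 2).eLpNorm_eq_integral_rpow_norm (by simp) (by simp)
    simpa using this
  rw [e5 _ hg.dz, e5 _ hg.dzb, e4]

/-! ### The Beurling transform on `L²` of the plane -/

/-- The Cauchy transform of a test function. -/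
def cauchyTest (f : ℂ → ℂ) : ℂ → ℂ :=
  convolution f (fun w => (Real.pi : ℂ)⁻¹ * w⁻¹) (ContinuousLinearMap.mul ℝ ℂ) volume

lemma cauchyTest_apply (f : ℂ → ℂ) (z : ℂ) :
    cauchyTest f z = ∫ w, f w * ((Real.pi : ℂ)⁻¹ * (z - w)⁻¹) := rfl

lemma locallyIntegrable_cauchyKernel : LocallyIntegrable (fun w : ℂ => (Real.pi : ℂ)⁻¹ * w⁻¹) :=
  locallyIntegrable_inv.smul (Real.pi : ℂ)⁻¹

lemma contDiff_cauchyTest {f : ℂ → ℂ} (hf : IsTest f) : ContDiff ℝ (⊤ : ℕ∞) (cauchyTest f) :=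
  hf.1.contDiff_convolution_left _ hf.2 locallyIntegrable_cauchyKernel

lemma dzb_cauchyTest {f : ℂ → ℂ} (hf : IsTest f) (z : ℂ) : dzb (cauchyTest f) z = f z := by
  have h := hf.1.hasFDerivAt_convolution_left (ContinuousLinearMap.mul ℝ ℂ)
    (hf.2.of_le (by simp)) locallyIntegrable_cauchyKernel z
  have hint : ∀ v, Integrable fun w => fderiv ℝ f w v * ((Real.pi : ℂ)⁻¹ * (z - w)⁻¹) := by
    intro v
    have := (hf.fderiv_apply v).1.convolutionExists_left (ContinuousLinearMap.mul ℝ ℂ)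
      (hf.fderiv_apply v).2.continuous locallyIntegrable_cauchyKernel z
    exact this
  have happ : ∀ v, fderiv ℝ (cauchyTest f) z v =
      ∫ w, fderiv ℝ f w v * ((Real.pi : ℂ)⁻¹ * (z - w)⁻¹) := by
    intro v
    unfold cauchyTest
    rw [h.fderiv, convolution, ContinuousLinearMap.integral_apply]
    · rfl
    · exact hf.1.fderiv ℝ |>.convolutionExists_left _ (hf.2.continuous_fderiv (by simp))
        locallyIntegrable_cauchyKernel z
  obtain ⟨C, hC⟩ := hf.exists_lipschitzWith
  have P := (integral_dbar_div_sub hC hf.1 hf.hasFDerivAt z).2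
  unfold dzb
  rw [happ, happ, ← integral_const_mul, ← integral_add (hint 1) ((hint Complex.I).const_mul _),
    ← integral_div]
  have : (fun w => (fderiv ℝ f w 1 * ((Real.pi : ℂ)⁻¹ * (z - w)⁻¹) +
      Complex.I * (fderiv ℝ f w Complex.I * ((Real.pi : ℂ)⁻¹ * (z - w)⁻¹))) / 2) =
      fun w => (Real.pi : ℂ)⁻¹ * (dzb f w / (z - w)) := by
    ext w; simp only [dzb]; ring
  rw [this, integral_const_mul, P]
  have : (Real.pi : ℂ) ≠ 0 := by exact_mod_cast Real.pi_ne_zero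
  field_simp

lemma exists_norm_cauchyTest_le {f : ℂ → ℂ} (hf : IsTest f) :
    ∃ M ρ : ℝ, 0 ≤ M ∧ 0 < ρ ∧ (∀ z, f z ≠ 0 → ‖z‖ < ρ) ∧
      ∀ z, 2 * ρ ≤ ‖z‖ → ‖cauchyTest f z‖ ≤ M / ‖z‖ := by
  obtain ⟨ρ, hρ0, hρ⟩ := hf.1.isCompact.isBounded.subset_ball_lt 0 0
  have hs : ∀ z, f z ≠ 0 → ‖z‖ < ρ := fun z hz => by
    simpa using hρ (subset_tsupport _ hz)
  refine ⟨2 * ∫ w, ‖f w‖, ρ, by positivity, hρ0, hs, fun z hz => ?_⟩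
  have hz0 : 0 < ‖z‖ := by linarith
  rw [cauchyTest_apply]
  have hle : ∀ w, ‖f w * ((Real.pi : ℂ)⁻¹ * (z - w)⁻¹)‖ ≤ ‖f w‖ * (2 / ‖z‖) := by
    intro w
    by_cases hw : f w = 0
    · simp [hw]
    rw [norm_mul]
    gcongr
    have h1 := hs w hw
    have h2 : ‖z‖ / 2 ≤ ‖z - w‖ := by
      have := norm_sub_norm_le z w
      linarith
    rw [norm_mul, norm_inv, norm_inv, Complex.norm_real, Real.norm_of_nonneg Real.pi_pos.le]
    have h3 : Real.pi⁻¹ ≤ 1 := inv_le_one_of_one_le₀ (by linarith [Real.pi_gt_three])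
    have h4 : ‖z - w‖⁻¹ ≤ (‖z‖ / 2)⁻¹ := inv_anti₀ (by positivity) h2
    calc Real.pi⁻¹ * ‖z - w‖⁻¹ ≤ 1 * (‖z‖ / 2)⁻¹ := by gcongr
      _ = 2 / ‖z‖ := by rw [one_mul, inv_div]
  calc _ ≤ ∫ w, ‖f w‖ * (2 / ‖z‖) :=
        norm_integral_le_of_norm_le (hf.integrable.norm.mul_const _) (ae_of_all _ hle)
    _ = _ := by rw [integral_mul_const]; ring

/-- Functions `∂̄g`, `g` a test function, approximate test functions in `L²`: cut off the Cauchy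
transform, whose decay at infinity makes the error term small. -/
lemma exists_dzb_approx_of_isTest {f : ℂ → ℂ} (hf : IsTest f) {η : ℝ} (hη : 0 < η) :
    ∃ g, IsTest g ∧ eLpNorm (f - dzb g) 2 volume ≤ ENNReal.ofReal η := by
  obtain ⟨M, ρ, hM, hρ, hs, hu⟩ := exists_norm_cauchyTest_le hf
  let χ : ContDiffBump (0 : ℂ) := ⟨1, 2, by norm_num, by norm_num⟩
  have hχt : IsTest (fun z => ((χ z : ℝ) : ℂ)) :=
    ⟨χ.hasCompactSupport.comp_left (g := fun x : ℝ => (x : ℂ)) (by simp),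
      Complex.ofRealCLM.contDiff.comp χ.contDiff⟩
  obtain ⟨D, hD⟩ := hχt.exists_lipschitzWith
  obtain ⟨R, hR⟩ := exists_gt (max (2 * ρ) (2 * Real.pi * M * D / η))
  have hR1 : 2 * ρ < R := (le_max_left _ _).trans_lt hR
  have hR2 : 2 * Real.pi * M * D / η < R := (le_max_right _ _).trans_lt hR
  have hR0 : 0 < R := by linarith
  have hRc : (R : ℂ) ≠ 0 := by exact_mod_cast hR0.ne'
  -- `∂̄(X u) - f = u ∂̄X` lives on `R ≤ ‖z‖ ≤ 2R` and is `O(R⁻²)`, hence `O(R⁻¹)` in `L²`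
  set X : ℂ → ℂ := fun z => ((χ (R⁻¹ • z) : ℝ) : ℂ) with hX
  have hXt : IsTest X := by
    refine ⟨?_, hχt.2.comp (contDiff_const_smul _)⟩
    have := hχt.1.comp_smul (c := R⁻¹) (by positivity)
    exact this
  have hXlip : LipschitzWith (D * Real.toNNReal R⁻¹) X := by
    refine LipschitzWith.of_dist_le_mul fun v w => ?_
    have := hD.dist_le_mul (R⁻¹ • v) (R⁻¹ • w)
    rw [dist_smul₀, Real.norm_of_nonneg (by positivity)] at this
    rw [NNReal.coe_mul, Real.coe_toNNReal _ (by positivity), mul_assoc]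
    exact this
  have hX1 : ∀ z, ‖z‖ < R → X =ᶠ[𝓝 z] fun _ => 1 := by
    intro z hz
    have : ∀ᶠ w : ℂ in 𝓝 z, ‖w‖ < R := continuous_norm.continuousAt.eventually_lt
      continuousAt_const hz
    filter_upwards [this] with w hw
    have : χ (R⁻¹ • w) = 1 := by
      apply χ.one_of_mem_closedBall
      rw [mem_closedBall_zero_iff, norm_smul, Real.norm_of_nonneg (by positivity)]
      change R⁻¹ * ‖w‖ ≤ 1
      rw [inv_mul_le_iff₀ hR0]; linarith
    simp only [hX, this, Complex.ofReal_one]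
  have hX0 : ∀ z, 2 * R < ‖z‖ → X =ᶠ[𝓝 z] fun _ => 0 := by
    intro z hz
    have : ∀ᶠ w : ℂ in 𝓝 z, 2 * R < ‖w‖ := continuousAt_const.eventually_lt
      continuous_norm.continuousAt hz
    filter_upwards [this] with w hw
    have : χ (R⁻¹ • w) = 0 := by
      apply χ.zero_of_le_dist
      rw [dist_zero_right, norm_smul, Real.norm_of_nonneg (by positivity)]
      change 2 ≤ R⁻¹ * ‖w‖
      rw [le_inv_mul_iff₀ hR0]; linarith
    simp only [hX, this, Complex.ofReal_zero]
  have dX0 : ∀ z c, X =ᶠ[𝓝 z] (fun _ => c) → dzb X z = 0 := by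
    intro z c h
    simp [dzb, h.fderiv_eq]
  set u := cauchyTest f
  have hut : ContDiff ℝ (⊤ : ℕ∞) u := contDiff_cauchyTest hf
  refine ⟨fun z => X z * u z, ⟨hXt.1.mul_right, hXt.2.mul hut⟩, ?_⟩
  have hd : ∀ z, dzb (fun z => X z * u z) z = X z * f z + u z * dzb X z := by
    intro z
    have := dzb_eq (hasFDerivAt_wirt_mul (hXt.hasFDerivAt z)
      (hasFDerivAt_dz_dzb (hut.differentiable (by simp) z)))
    rw [this, dzb_cauchyTest hf]
  have hb : ∀ z, ‖(f - dzb (fun z => X z * u z)) z‖ ≤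
      ‖(Metric.closedBall (0 : ℂ) (2 * R)).indicator (fun _ => M * D / R ^ 2) z‖ := by
    intro z
    have h1 : f z - X z * f z = 0 := by
      by_cases hz : f z = 0
      · simp [hz]
      · have := (hX1 z (by linarith [hs z hz])).self_of_nhds
        rw [this]; ring
    have h2 : (f - dzb (fun z => X z * u z)) z = -(u z * dzb X z) := by
      rw [Pi.sub_apply, hd]; linear_combination h1
    rw [h2, norm_neg, norm_mul]
    rcases lt_or_ge ‖z‖ R with h | h
    · rw [dX0 z 1 (hX1 z h)]; simp
    rcases lt_or_ge (2 * R) ‖z‖ with h' | h'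
    · rw [dX0 z 0 (hX0 z h')]; simp
    rw [Set.indicator_of_mem (by simpa using h'), Real.norm_of_nonneg (by positivity)]
    have b1 : ‖u z‖ ≤ M / R := (hu z (by linarith)).trans (by gcongr)
    have b2 : ‖dzb X z‖ ≤ D / R := by
      have := (norm_wirt_le_of_lipschitz hXlip (hXt.hasFDerivAt z)).2
      rwa [NNReal.coe_mul, Real.coe_toNNReal _ (by positivity), ← div_eq_mul_inv] at this
    calc ‖u z‖ * ‖dzb X z‖ ≤ (M / R) * (D / R) := by gcongr
      _ = M * D / R ^ 2 := by ring
  refine (eLpNorm_mono hb).trans ?_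
  rw [eLpNorm_indicator_const measurableSet_closedBall (by simp) (by simp)]
  rw [Complex.volume_closedBall]
  have e1 : (ENNReal.ofReal (2 * R) ^ 2 * (NNReal.pi : ℝ≥0∞)) ^ (1 / (2 : ℝ≥0∞).toReal) ≤
      ENNReal.ofReal (2 * R * Real.pi) := by
    have : (ENNReal.ofReal (2 * R) ^ 2 * (NNReal.pi : ℝ≥0∞)) ≤
        (ENNReal.ofReal (2 * R * Real.pi)) ^ (2 : ℝ) := by
      have hpi : (NNReal.pi : ℝ≥0∞) = ENNReal.ofReal Real.pi := by
        rw [ENNReal.ofReal, ← NNReal.coe_real_pi, Real.toNNReal_coe]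
      rw [ENNReal.rpow_two, hpi, ← ENNReal.ofReal_pow (by positivity),
        ← ENNReal.ofReal_pow (by positivity), ← ENNReal.ofReal_mul (by positivity)]
      apply ENNReal.ofReal_le_ofReal
      rw [mul_pow (2 * R)]
      gcongr
      nlinarith [Real.pi_gt_three]
    calc _ ≤ ((ENNReal.ofReal (2 * R * Real.pi)) ^ (2 : ℝ)) ^ (1 / (2 : ℝ≥0∞).toReal) := by gcongr
      _ = _ := by rw [← ENNReal.rpow_mul]; simp
  calc _ ≤ ENNReal.ofReal (M * D / R ^ 2) * ENNReal.ofReal (2 * R * Real.pi) := by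
        gcongr
        rw [Real.enorm_of_nonneg (by positivity)]
    _ ≤ ENNReal.ofReal η := by
        rw [← ENNReal.ofReal_mul (by positivity)]
        apply ENNReal.ofReal_le_ofReal
        rw [div_lt_iff₀ hη] at hR2
        have : M * D / R ^ 2 * (2 * R * Real.pi) = (2 * Real.pi * M * D) / R := by field_simp
        rw [this, div_le_iff₀ hR0]
        linarith

lemma exists_dzb_approx {f : ℂ → ℂ} (hf : MemLp f 2) {η : ℝ} (hη : 0 < η) :
    ∃ g, IsTest g ∧ eLpNorm (f - dzb g) 2 volume ≤ ENNReal.ofReal η := by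
  obtain ⟨φ, h1, h2, h3⟩ := hf.exist_eLpNorm_sub_le (by simp) (by simp) (half_pos hη)
  have hφ : IsTest φ := ⟨h1, h2⟩
  obtain ⟨g, hg, h4⟩ := exists_dzb_approx_of_isTest hφ (half_pos hη)
  refine ⟨g, hg, ?_⟩
  have : f - dzb g = (f - φ) + (φ - dzb g) := by simp
  rw [this]
  calc _ ≤ eLpNorm (f - φ) 2 volume + eLpNorm (φ - dzb g) 2 volume :=
        eLpNorm_add_le (hf.aestronglyMeasurable.sub (hφ.memLp 2).aestronglyMeasurable)
          ((hφ.memLp 2).aestronglyMeasurable.sub (hg.dzb.memLp 2).aestronglyMeasurable) (by simp)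
    _ ≤ ENNReal.ofReal (η / 2) + ENNReal.ofReal (η / 2) := add_le_add h3 h4
    _ = ENNReal.ofReal η := by rw [← ENNReal.ofReal_add (by positivity) (by positivity), add_halves]

end Bukhgeim

namespace Bukhgeim

lemma integrable_mul_of_memLp_two {φ F : ℂ → ℂ} (hφ : MemLp φ 2) (hF : MemLp F 2) :
    Integrable (fun w => φ w * F w) := by
  have : MemLp (fun w => φ w * F w) 1 volume := hF.mul hφ
  exact memLp_one_iff_integrable.1 this

/-- Pairing with a fixed `L²` function is continuous for `L²` convergence. -/
lemma tendsto_integral_mul_of_L2 {φ F : ℂ → ℂ} {G : ℕ → ℂ → ℂ} (hφ : MemLp φ 2) (hF : MemLp F 2)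
    (hG : ∀ k, MemLp (G k) 2)
    (h : Tendsto (fun k => eLpNorm (G k - F) 2 volume) atTop (𝓝 0)) :
    Tendsto (fun k => ∫ w, φ w * G k w) atTop (𝓝 (∫ w, φ w * F w)) := by
  refine tendsto_integral_of_L1' _ (integrable_mul_of_memLp_two hφ hF).aestronglyMeasurable
    (Eventually.of_forall fun k => integrable_mul_of_memLp_two hφ (hG k)) ?_
  have hb : ∀ k, eLpNorm ((fun w => φ w * G k w) - fun w => φ w * F w) 1 volume ≤
      eLpNorm φ 2 volume * eLpNorm (G k - F) 2 volume := by
    intro k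
    have e : ((fun w => φ w * G k w) - fun w => φ w * F w) = φ • (G k - F) := by
      ext w; simp [mul_sub]
    rw [e]
    exact eLpNorm_smul_le_mul_eLpNorm ((hG k).sub hF).aestronglyMeasurable hφ.aestronglyMeasurable
  refine tendsto_of_tendsto_of_tendsto_of_le_of_le tendsto_const_nhds ?_ (fun _ => zero_le) hb
  have := ENNReal.Tendsto.const_mul h (Or.inr hφ.eLpNorm_ne_top)
  simpa using this

/-- `F` is the Beurling transform of `f`, expressed without principal values: the mean value of
`F` over each disc `B(z, ε)` is the Beurling integral of `f` truncated at distance `ε` from `z`. -/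
def IsBeurlingPair (f F : ℂ → ℂ) : Prop :=
  ∀ z : ℂ, ∀ ε : ℝ, 0 < ε → ∫ w in Metric.ball z ε, F w =
    -(ε : ℂ) ^ 2 * ∫ w in (Metric.ball z ε)ᶜ, f w / (w - z) ^ 2

lemma memLp_indicator_ball (z : ℂ) (ε : ℝ) :
    MemLp ((Metric.ball z ε).indicator fun _ => (1 : ℂ)) 2 :=
  memLp_indicator_const 2 measurableSet_ball 1 (Or.inr measure_ball_lt_top.ne)

/-- The kernel of the truncated Beurling integral is square integrable. -/
lemma memLp_beurlingKernel (z : ℂ) {ε : ℝ} (hε : 0 < ε) :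
    MemLp ((Metric.ball z ε)ᶜ.indicator fun w : ℂ => 1 / (w - z) ^ 2) 2 := by
  have hm : AEStronglyMeasurable ((Metric.ball z ε)ᶜ.indicator fun w : ℂ => 1 / (w - z) ^ 2)
      (volume : Measure ℂ) :=
    Measurable.aestronglyMeasurable (by
      refine Measurable.indicator ?_ measurableSet_ball.compl
      fun_prop)
  rw [memLp_two_iff_integrable_sq_norm hm]
  have h1 : Integrable (fun w : ℂ => (1 + ‖w - z‖) ^ (-4 : ℝ)) :=
    (integrable_one_add_norm (E := ℂ) (r := 4) (by simp; norm_num)).comp_sub_right z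
  refine (h1.const_mul ((1 + 1 / ε) ^ 4)).mono' (hm.norm.pow 2) (ae_of_all _ fun w => ?_)
  by_cases hw : w ∈ (Metric.ball z ε)ᶜ
  · rw [Set.indicator_of_mem hw]
    have hw' : ε ≤ ‖w - z‖ := by simpa [dist_eq_norm] using hw
    have h0 : 0 < ‖w - z‖ := hε.trans_le hw'
    have h2 : 1 + ‖w - z‖ ≤ (1 + 1 / ε) * ‖w - z‖ := by
      have : 1 ≤ 1 / ε * ‖w - z‖ := by
        rw [one_div, le_inv_mul_iff₀ hε]; simpa using hw'
      linarith
    simp only [norm_pow, norm_norm, norm_div, norm_one]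
    rw [Real.rpow_neg (by positivity)]
    have e4 : (1 + ‖w - z‖) ^ (4 : ℝ) = (1 + ‖w - z‖) ^ 4 := by
      exact_mod_cast Real.rpow_natCast (1 + ‖w - z‖) 4
    rw [e4, ← div_eq_mul_inv, le_div_iff₀ (by positivity)]
    calc (1 / ‖w - z‖ ^ 2) ^ 2 * (1 + ‖w - z‖) ^ 4
        ≤ (1 / ‖w - z‖ ^ 2) ^ 2 * ((1 + 1 / ε) * ‖w - z‖) ^ 4 := by gcongr
      _ = (1 + 1 / ε) ^ 4 := by field_simp
  · rw [Set.indicator_of_notMem hw]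
    simp
    positivity

lemma integral_ball_eq (F : ℂ → ℂ) (z : ℂ) (ε : ℝ) :
    ∫ w in Metric.ball z ε, F w = ∫ w, (Metric.ball z ε).indicator (fun _ => (1 : ℂ)) w * F w := by
  rw [← integral_indicator measurableSet_ball]
  congr 1; ext w
  by_cases hw : w ∈ Metric.ball z ε
  · simp only [Set.indicator_of_mem hw, one_mul]
  · simp only [Set.indicator_of_notMem hw, zero_mul]

lemma integral_compl_ball_eq (f : ℂ → ℂ) (z : ℂ) (ε : ℝ) :
    ∫ w in (Metric.ball z ε)ᶜ, f w / (w - z) ^ 2 =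
      ∫ w, (Metric.ball z ε)ᶜ.indicator (fun w => 1 / (w - z) ^ 2) w * f w := by
  rw [← integral_indicator measurableSet_ball.compl]
  congr 1; ext w
  by_cases hw : w ∈ (Metric.ball z ε)ᶜ
  · simp only [Set.indicator_of_mem hw]; ring
  · simp only [Set.indicator_of_notMem hw, zero_mul]

/-- The Beurling transform exists on `L²` of the plane and does not increase the norm. -/
theorem exists_isBeurlingPair {f : ℂ → ℂ} (hf : MemLp f 2) :
    ∃ F, MemLp F 2 ∧ eLpNorm F 2 volume ≤ eLpNorm f 2 volume ∧ IsBeurlingPair f F := by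
  have hη : ∀ k : ℕ, (0 : ℝ) < 1 / ((k : ℝ) + 1) := fun k => by positivity
  choose g hg hgf using fun k : ℕ => exists_dzb_approx hf (hη k)
  have h0 : Tendsto (fun k : ℕ => ENNReal.ofReal (1 / ((k : ℝ) + 1))) atTop (𝓝 0) := by
    have := ENNReal.tendsto_ofReal tendsto_one_div_add_atTop_nhds_zero_nat
    simpa using this
  have lim_dzb : Tendsto (fun k => eLpNorm (dzb (g k) - f) 2 volume) atTop (𝓝 0) := by
    refine tendsto_of_tendsto_of_tendsto_of_le_of_le tendsto_const_nhds h0 (fun _ => zero_le)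
      fun k => ?_
    rw [eLpNorm_sub_comm]; exact hgf k
  have hm : ∀ k, MemLp (dz (g k)) 2 := fun k => (hg k).dz.memLp 2
  have hmb : ∀ k, MemLp (dzb (g k)) 2 := fun k => (hg k).dzb.memLp 2
  -- `∂̄gₖ → f` in `L²`; as `∂` and `∂̄` have the same norm, `∂gₖ` is a Cauchy sequence
  let G : ℕ → Lp ℂ 2 (volume : Measure ℂ) := fun k => (hm k).toLp
  have hedist : ∀ j k, edist (G j) (G k) = eLpNorm (dzb (g j) - dzb (g k)) 2 volume := by
    intro j k
    rw [Lp.edist_toLp_toLp]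
    have e1 : dz (g j) - dz (g k) = dz (fun z => g j z - g k z) := (dz_sub (hg j) (hg k)).symm
    have e2 : dzb (g j) - dzb (g k) = dzb (fun z => g j z - g k z) := (dzb_sub (hg j) (hg k)).symm
    rw [e1, e2, eLpNorm_dz_eq ((hg j).sub (hg k))]
  have hc : CauchySeq G := by
    rw [EMetric.cauchySeq_iff]
    intro η hη
    have h2 : 0 < η / 2 := ENNReal.half_pos hη.ne'
    obtain ⟨N, hN⟩ := eventually_atTop.1 (lim_dzb.eventually (gt_mem_nhds h2))
    refine ⟨N, fun j hj k hk => ?_⟩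
    rw [hedist]
    have e : dzb (g j) - dzb (g k) = (dzb (g j) - f) - (dzb (g k) - f) := by simp
    rw [e]
    refine (eLpNorm_sub_le ((hmb j).sub hf).aestronglyMeasurable
      ((hmb k).sub hf).aestronglyMeasurable (by simp)).trans_lt ?_
    calc _ < η / 2 + η / 2 := ENNReal.add_lt_add (hN j hj) (hN k hk)
      _ = η := ENNReal.add_halves η
  obtain ⟨F', hF⟩ := cauchySeq_tendsto_of_complete hc
  obtain ⟨F, hFF⟩ : ∃ F : ℂ → ℂ, F = F' := ⟨_, rfl⟩
  have limF : Tendsto (fun k => eLpNorm (dz (g k) - F) 2 volume) atTop (𝓝 0) := by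
    have := (Lp.tendsto_Lp_iff_tendsto_eLpNorm' G F').1 hF
    rw [← hFF] at this
    refine this.congr fun k => ?_
    apply eLpNorm_congr_ae
    filter_upwards [(hm k).coeFn_toLp] with w hw
    simp only [Pi.sub_apply, G, hw]
  have hFm : MemLp F 2 volume := hFF ▸ Lp.memLp F'
  refine ⟨F, hFm, ?_, ?_⟩
  · have h1 : ∀ k, eLpNorm F 2 volume ≤ eLpNorm (dz (g k) - F) 2 volume +
        (eLpNorm (dzb (g k) - f) 2 volume + eLpNorm f 2 volume) := by
      intro k
      have e1 : F = dz (g k) - (dz (g k) - F) := by simp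
      have e2 : dzb (g k) = (dzb (g k) - f) + f := by simp
      calc eLpNorm F 2 volume = eLpNorm (dz (g k) - (dz (g k) - F)) 2 volume := by rw [← e1]
        _ ≤ eLpNorm (dz (g k)) 2 volume + eLpNorm (dz (g k) - F) 2 volume :=
          eLpNorm_sub_le (hm k).aestronglyMeasurable ((hm k).sub hFm).aestronglyMeasurable (by simp)
        _ = eLpNorm (dz (g k) - F) 2 volume + eLpNorm ((dzb (g k) - f) + f) 2 volume := by
          rw [← e2, eLpNorm_dz_eq (hg k), add_comm]
        _ ≤ _ := by
          gcongr
          exact eLpNorm_add_le ((hmb k).sub hf).aestronglyMeasurable hf.aestronglyMeasurable (by simp)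
    have h2 : Tendsto (fun k => eLpNorm (dz (g k) - F) 2 volume +
        (eLpNorm (dzb (g k) - f) 2 volume + eLpNorm f 2 volume)) atTop
        (𝓝 (0 + (0 + eLpNorm f 2 volume))) := limF.add (lim_dzb.add tendsto_const_nhds)
    rw [zero_add, zero_add] at h2
    exact ge_of_tendsto' h2 h1
  -- both sides are continuous in `L²`, and the identity holds for `∂gₖ`, `∂̄gₖ`
  · intro z ε hε
    have t1 := tendsto_integral_mul_of_L2 (memLp_indicator_ball z ε) hFm hm limF
    have t2 := (tendsto_integral_mul_of_L2 (memLp_beurlingKernel z hε) hf hmb lim_dzb).const_mul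
      (-(ε : ℂ) ^ 2)
    simp only [← integral_ball_eq, ← integral_compl_ball_eq] at t1 t2
    refine tendsto_nhds_unique t1 (t2.congr fun k => ?_)
    rw [integral_ball_dz (hg k) z hε]

lemma locallyIntegrable_of_memLp_two {F : ℂ → ℂ} (hF : MemLp F 2) : LocallyIntegrable F :=
  hF.locallyIntegrable (by simp)

lemma volume_real_ball (z : ℂ) {ε : ℝ} (hε : 0 ≤ ε) :
    (volume : Measure ℂ).real (Metric.ball z ε) = Real.pi * ε ^ 2 := by
  simp [Measure.real, Complex.volume_ball, ENNReal.toReal_ofReal hε, mul_comm]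

lemma closedBall_ae_eq_ball (z : ℂ) (ε : ℝ) :
    Metric.closedBall z ε =ᵐ[volume] Metric.ball z ε := by
  have hs : ∀ᵐ w : ℂ, w ∉ Metric.sphere z ε :=
    measure_eq_zero_iff_ae_notMem.1 (Measure.addHaar_sphere _ _ _)
  filter_upwards [hs] with w hw
  have hw' : dist w z ≠ ε := hw
  exact propext ⟨fun h => lt_of_le_of_ne h hw', fun h => le_of_lt h⟩

/-- The truncated Beurling integral on the whole plane. -/
def truncInt (f : ℂ → ℂ) (z : ℂ) (ε : ℝ) : ℂ :=
  -(1 / (Real.pi : ℂ)) * ∫ w in (Metric.ball z ε)ᶜ, f w / (w - z) ^ 2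

lemma IsBeurlingPair.average_eq {f F : ℂ → ℂ} (h : IsBeurlingPair f F) (z : ℂ) {ε : ℝ}
    (hε : 0 < ε) : ⨍ w in Metric.ball z ε, F w = truncInt f z ε := by
  rw [setAverage_eq, h z ε hε, volume_real_ball z hε.le, truncInt, Complex.real_smul]
  have : (ε : ℂ) ≠ 0 := by exact_mod_cast hε.ne'
  have : (Real.pi : ℂ) ≠ 0 := by exact_mod_cast Real.pi_ne_zero
  push_cast
  field_simp

/-- The truncated Beurling integrals converge almost everywhere, by Lebesgue's differentiation
theorem: they are mean values of the Beurling transform. -/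
theorem IsBeurlingPair.ae_tendsto {f F : ℂ → ℂ} (hF : LocallyIntegrable F) (h : IsBeurlingPair f F) :
    ∀ᵐ z, Tendsto (truncInt f z) (𝓝[>] 0) (𝓝 (F z)) := by
  filter_upwards [IsUnifLocDoublingMeasure.ae_tendsto_average volume hF 1] with z hz
  have := hz (l := 𝓝[>] (0 : ℝ)) (fun _ => z) (fun ε => ε) tendsto_id (by
    filter_upwards [self_mem_nhdsWithin] with ε (hε : 0 < ε)
    simpa using hε.le)
  refine this.congr' ?_
  filter_upwards [self_mem_nhdsWithin] with ε (hε : 0 < ε)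
  rw [← h.average_eq z hε]
  exact setAverage_congr (closedBall_ae_eq_ball z ε)

end Bukhgeim

/-! ### Weak-type estimate for the maximal function -/

namespace Bukhgeim

/-- The superlevel set `{M h > t}` of the uncentred Hardy–Littlewood maximal function of `h`: the
union of the discs on which the mean value of `h` exceeds `t`. -/
def maxSet (h : ℂ → ℝ≥0∞) (t : ℝ≥0∞) : Set ℂ :=
  {x | ∃ c : ℂ, ∃ r : ℝ, 0 < r ∧ x ∈ Metric.ball c r ∧
    t * volume (Metric.ball c r) < ∫⁻ w in Metric.ball c r, h w}

lemma isOpen_maxSet (h : ℂ → ℝ≥0∞) (t : ℝ≥0∞) : IsOpen (maxSet h t) := by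
  rw [isOpen_iff_mem_nhds]
  rintro x ⟨c, r, hr, hx, hlt⟩
  filter_upwards [Metric.isOpen_ball.mem_nhds hx] with y hy using ⟨c, r, hr, hy, hlt⟩

lemma maxSet_anti (h : ℂ → ℝ≥0∞) : Antitone (maxSet h) := by
  rintro s t hst x ⟨c, r, hr, hx, hlt⟩
  exact ⟨c, r, hr, hx, lt_of_le_of_lt (by gcongr) hlt⟩

lemma lintegral_ball_le_of_notMem {h : ℂ → ℝ≥0∞} {t : ℝ≥0∞} {x : ℂ} (hx : x ∉ maxSet h t) {c : ℂ}
    {r : ℝ} (hxc : x ∈ Metric.ball c r) :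
    ∫⁻ w in Metric.ball c r, h w ≤ t * volume (Metric.ball c r) := by
  by_contra hlt
  exact hx ⟨c, r, dist_nonneg.trans_lt hxc, hxc, not_le.1 hlt⟩

lemma volume_ball_mul (c c' : ℂ) {k : ℝ} (hk : 0 ≤ k) (r : ℝ) :
    volume (Metric.ball c (k * r)) = ENNReal.ofReal (k ^ 2) * volume (Metric.ball c' r) := by
  rw [Complex.volume_ball, Complex.volume_ball, ENNReal.ofReal_mul hk, mul_pow,
    ENNReal.ofReal_pow hk, mul_assoc]

lemma volume_closedBall_mul (c c' : ℂ) {k : ℝ} (hk : 0 ≤ k) (r : ℝ) :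
    volume (Metric.closedBall c (k * r)) = ENNReal.ofReal (k ^ 2) * volume (Metric.ball c' r) := by
  rw [measure_congr (closedBall_ae_eq_ball c _), volume_ball_mul c c' hk]

lemma volume_ball_pos {c : ℂ} {r : ℝ} (hr : 0 < r) : volume (Metric.ball c r) ≠ 0 :=
  (Metric.measure_ball_pos volume c hr).ne'

/-- The weak-type `(1, 1)` estimate, from Vitali's covering theorem. -/
lemma mul_volume_maxSet_le (h : ℂ → ℝ≥0∞) (t : ℝ≥0∞) :
    t * volume (maxSet h t) ≤ 25 * ∫⁻ w, h w := by
  rcases eq_or_ne (∫⁻ w, h w) ∞ with hI | hI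
  · rw [hI, ENNReal.mul_top (by norm_num)]; exact le_top
  rcases eq_or_ne t 0 with rfl | ht0
  · simp
  rcases eq_or_ne t ∞ with rfl | htop
  · have : maxSet h ∞ = ∅ := by
      ext x
      simp only [Set.mem_empty_iff_false, iff_false]
      rintro ⟨c, r, hr, hx, hlt⟩
      rw [ENNReal.top_mul (volume_ball_pos hr)] at hlt
      exact not_top_lt hlt
    rw [this]; simp
  let T : Set (ℂ × ℝ) := {q | 0 < q.2 ∧
    t * volume (Metric.ball q.1 q.2) < ∫⁻ w in Metric.ball q.1 q.2, h w}
  set M := ((∫⁻ w, h w) / t).toReal with hM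
  have hTR : ∀ q ∈ T, q.2 ≤ M + 1 := by
    rintro ⟨c, r⟩ ⟨hr, hlt⟩
    have h1 : volume (Metric.ball c r) ≤ (∫⁻ w, h w) / t := by
      rw [ENNReal.le_div_iff_mul_le (Or.inl ht0) (Or.inl htop), mul_comm]
      exact hlt.le.trans (setLIntegral_le_lintegral _ _)
    have h2 := ENNReal.toReal_mono (ENNReal.div_ne_top hI ht0) h1
    have hr' : 0 < r := hr
    have h3 : (volume : Measure ℂ).real (Metric.ball c r) ≤ M := h2
    rw [volume_real_ball c hr'.le] at h3
    change r ≤ M + 1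
    have h4 : r ^ 2 ≤ Real.pi * r ^ 2 := by nlinarith [Real.pi_gt_three, sq_nonneg r]
    nlinarith [sq_nonneg (r - 1)]
  obtain ⟨u, huT, hud, hucov⟩ := Vitali.exists_disjoint_subfamily_covering_enlargement_closedBall
    T (fun q => q.1) (fun q => q.2) (M + 1) hTR 5 (by norm_num)
  have hcount : u.Countable := hud.countable_of_nonempty_interior fun q hq =>
    ⟨q.1, Metric.ball_subset_interior_closedBall (Metric.mem_ball_self (huT hq).1)⟩
  have hcov : maxSet h t ⊆ ⋃ q ∈ u, Metric.closedBall q.1 (5 * q.2) := by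
    rintro x ⟨c, r, hr, hx, hlt⟩
    obtain ⟨q, hq, hsub⟩ := hucov (c, r) ⟨hr, hlt⟩
    exact Set.mem_biUnion hq (hsub (Metric.ball_subset_closedBall hx))
  have hd2 : u.PairwiseDisjoint fun q => Metric.ball q.1 q.2 :=
    hud.mono fun q => Metric.ball_subset_closedBall
  calc t * volume (maxSet h t) ≤ t * volume (⋃ q ∈ u, Metric.closedBall q.1 (5 * q.2)) := by gcongr
    _ ≤ t * ∑' q : u, volume (Metric.closedBall q.1.1 (5 * q.1.2)) := by
        gcongr; exact measure_biUnion_le _ hcount _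
    _ = 25 * ∑' q : u, t * volume (Metric.ball q.1.1 q.1.2) := by
        have hq : ∀ q : u, volume (Metric.closedBall q.1.1 (5 * q.1.2)) =
            25 * volume (Metric.ball q.1.1 q.1.2) := fun q => by
          rw [volume_closedBall_mul q.1.1 q.1.1 (by norm_num)]
          norm_num
        simp_rw [hq, ENNReal.tsum_mul_left]
        ring
    _ ≤ 25 * ∑' q : u, ∫⁻ w in Metric.ball q.1.1 q.1.2, h w := by
        gcongr with q
        exact (huT q.2).2.le
    _ = 25 * ∫⁻ w in ⋃ q ∈ u, Metric.ball q.1 q.2, h w := by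
        rw [lintegral_biUnion hcount (fun q _ => measurableSet_ball) hd2]
    _ ≤ 25 * ∫⁻ w, h w := by gcongr; exact Measure.restrict_le_self

/-- In the weak-type estimate only the part of `h` above half the level matters. -/
lemma mul_volume_maxSet_two_mul_le {h : ℂ → ℝ≥0∞} (hm : AEMeasurable h) {t : ℝ≥0∞} :
    t * volume (maxSet h (2 * t)) ≤ 25 * ∫⁻ w in {w | t < h w}, h w := by
  have hns : NullMeasurableSet {w | t < h w} := nullMeasurableSet_lt aemeasurable_const hm
  have hsub : maxSet h (2 * t) ⊆ maxSet ({w | t < h w}.indicator h) t := by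
    rintro x ⟨c, r, hr, hx, hlt⟩
    refine ⟨c, r, hr, hx, ?_⟩
    have hle : ∫⁻ w in Metric.ball c r, h w ≤ t * volume (Metric.ball c r) +
        ∫⁻ w in Metric.ball c r, {w | t < h w}.indicator h w := by
      calc _ ≤ ∫⁻ w in Metric.ball c r, (t + {w | t < h w}.indicator h w) := by
            refine lintegral_mono fun w => ?_
            by_cases hw : w ∈ {w | t < h w}
            · rw [Set.indicator_of_mem hw]; exact le_add_self
            · rw [Set.indicator_of_notMem hw, add_zero]; exact not_lt.1 hw
        _ = _ := by rw [lintegral_add_left measurable_const, setLIntegral_const]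
    have hlt2 := hlt.trans_le hle
    rw [mul_assoc, two_mul] at hlt2
    exact lt_of_add_lt_add_left hlt2
  calc _ ≤ t * volume (maxSet ({w | t < h w}.indicator h) t) := by gcongr
    _ ≤ 25 * ∫⁻ w, {w | t < h w}.indicator h w := mul_volume_maxSet_le _ _
    _ = _ := by rw [lintegral_indicator₀ hns]

/-- By Lebesgue's differentiation theorem `h ≤ M h` almost everywhere. -/
lemma ae_mem_maxSet {h : ℂ → ℝ≥0∞} (hm : AEMeasurable h) (hI : ∫⁻ w, h w ≠ ∞) :
    ∀ᵐ x, ∀ t, t < h x → x ∈ maxSet h t := by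
  filter_upwards [(IsUnifLocDoublingMeasure.vitaliFamily (volume : Measure ℂ) 1).ae_tendsto_lintegral_div
    hm hI] with x hx t ht
  have h1 : Tendsto (fun r : ℝ => Metric.closedBall x r) (𝓝[>] 0)
      ((IsUnifLocDoublingMeasure.vitaliFamily (volume : Measure ℂ) 1).filterAt x) :=
    IsUnifLocDoublingMeasure.tendsto_closedBall_filterAt _ (l := 𝓝[>] (0 : ℝ))
      (fun _ => x) (fun r => r) tendsto_id (by
      filter_upwards [self_mem_nhdsWithin] with r (hr : 0 < r)
      simpa using hr.le)
  have h2 := (hx.comp h1).eventually (lt_mem_nhds ht)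
  obtain ⟨r, hr, hr0⟩ := (h2.and self_mem_nhdsWithin).exists
  have hr0 : 0 < r := hr0
  refine ⟨x, r, hr0, Metric.mem_ball_self hr0, ?_⟩
  simp only [Function.comp] at hr
  rw [setLIntegral_congr (closedBall_ae_eq_ball x r), measure_congr (closedBall_ae_eq_ball x r),
    ENNReal.lt_div_iff_mul_lt (Or.inl (volume_ball_pos hr0)) (Or.inl measure_ball_lt_top.ne)] at hr
  exact hr

/-! ### The good-`λ` inequality for the Beurling transform -/

lemma enorm_add_sq_le (a b : ℂ) : ‖a + b‖ₑ ^ 2 ≤ 2 * ‖a‖ₑ ^ 2 + 2 * ‖b‖ₑ ^ 2 := by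
  simp only [enorm_eq_nnnorm]
  norm_cast
  have h := nnnorm_add_le a b
  have h' : (‖a + b‖₊ : ℝ) ≤ ‖a‖₊ + ‖b‖₊ := by exact_mod_cast h
  rw [← NNReal.coe_le_coe]
  push_cast at h' ⊢
  nlinarith [sq_nonneg (‖a‖ - ‖b‖), norm_nonneg (a + b), norm_nonneg a, norm_nonneg b]

lemma lintegral_sq_eq (f : ℂ → ℂ) (μ : Measure ℂ) : ∫⁻ w, ‖f w‖ₑ ^ 2 ∂μ = eLpNorm f 2 μ ^ 2 := by
  have := eLpNorm_nnreal_pow_eq_lintegral (f := f) (μ := μ) (p := 2) (by norm_num)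
  simp only [NNReal.coe_ofNat, ENNReal.rpow_ofNat] at this
  exact this.symm

/-- Cauchy–Schwarz for the mean value over a disc. -/
lemma enorm_average_sq_le {F : ℂ → ℂ} (hF : MemLp F 2) (x : ℂ) {d : ℝ} (hd : 0 < d) :
    ‖⨍ w in Metric.ball x d, F w‖ₑ ^ 2 * volume (Metric.ball x d) ≤
      ∫⁻ w in Metric.ball x d, ‖F w‖ₑ ^ 2 := by
  set B := Metric.ball x d
  set v := volume B
  have hv0 : v ≠ 0 := volume_ball_pos hd
  have hvt : v ≠ ∞ := measure_ball_lt_top.ne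
  have h1 : ‖⨍ w in B, F w‖ₑ ≤ v⁻¹ * ∫⁻ w in B, ‖F w‖ₑ := by
    rw [setAverage_eq, enorm_smul]
    have : ‖((volume : Measure ℂ).real B)⁻¹‖ₑ = v⁻¹ := by
      have hp : 0 < (volume : Measure ℂ).real B := ENNReal.toReal_pos hv0 hvt
      rw [Real.enorm_of_nonneg (by positivity), ENNReal.ofReal_inv_of_pos hp, Measure.real,
        ENNReal.ofReal_toReal hvt]
    rw [this]
    gcongr
    exact enorm_integral_le_lintegral_enorm _
  have h2 : (∫⁻ w in B, ‖F w‖ₑ) ^ 2 ≤ v * ∫⁻ w in B, ‖F w‖ₑ ^ 2 := by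
    have h := eLpNorm_le_eLpNorm_mul_rpow_measure_univ (μ := volume.restrict B) (p := 1) (q := 2)
      (f := F) (by norm_num) hF.aestronglyMeasurable.restrict
    rw [eLpNorm_one_eq_lintegral_enorm, Measure.restrict_apply_univ] at h
    rw [lintegral_sq_eq]
    calc _ ≤ (eLpNorm F 2 (volume.restrict B) * v ^ (1 / (1 : ℝ≥0∞).toReal - 1 / (2 : ℝ≥0∞).toReal)) ^ 2 := by
          gcongr
      _ = v * eLpNorm F 2 (volume.restrict B) ^ 2 := by
          rw [mul_pow, mul_comm]
          congr 1
          rw [← ENNReal.rpow_two, ← ENNReal.rpow_mul]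
          norm_num
  calc _ ≤ (v⁻¹ * ∫⁻ w in B, ‖F w‖ₑ) ^ 2 * v := by gcongr
    _ = v⁻¹ * v * v⁻¹ * (∫⁻ w in B, ‖F w‖ₑ) ^ 2 := by ring
    _ = v⁻¹ * (∫⁻ w in B, ‖F w‖ₑ) ^ 2 := by rw [ENNReal.inv_mul_cancel hv0 hvt, one_mul]
    _ ≤ v⁻¹ * (v * ∫⁻ w in B, ‖F w‖ₑ ^ 2) := by gcongr
    _ = _ := by rw [← mul_assoc, ENNReal.inv_mul_cancel hv0 hvt, one_mul]

lemma IsBeurlingPair.sub {f F g G : ℂ → ℂ} (hf : MemLp f 2) (hF : MemLp F 2) (hg : MemLp g 2)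
    (hG : MemLp G 2) (h : IsBeurlingPair f F) (h' : IsBeurlingPair g G) :
    IsBeurlingPair (fun w => f w - g w) (fun w => F w - G w) := by
  intro z ε hε
  have e1 := h z ε hε
  have e2 := h' z ε hε
  rw [integral_ball_eq, integral_compl_ball_eq] at e1 e2 ⊢
  simp only [mul_sub]
  rw [integral_sub (integrable_mul_of_memLp_two (memLp_indicator_ball z ε) hF)
    (integrable_mul_of_memLp_two (memLp_indicator_ball z ε) hG),
    integral_sub (integrable_mul_of_memLp_two (memLp_beurlingKernel z hε) hf)
    (integrable_mul_of_memLp_two (memLp_beurlingKernel z hε) hg), e1, e2]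
  ring

/-- Away from the support of `f` the Beurling transform is holomorphic; all that is needed is its
mean value property. -/
lemma IsBeurlingPair.ae_eq_average {f F : ℂ → ℂ} (hF : MemLp F 2) (h : IsBeurlingPair f F)
    {x₀ : ℂ} {d : ℝ} (hd : 0 < d) (h0 : ∀ w ∈ Metric.ball x₀ (2 * d), f w = 0) :
    ∀ᵐ x, x ∈ Metric.ball x₀ d → F x = ⨍ w in Metric.ball x d, F w := by
  filter_upwards [h.ae_tendsto (locallyIntegrable_of_memLp_two hF)] with x hx hxd
  -- `f` vanishes on `B(x, d)`, so truncating at `ε < d` or at `d` is the same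
  have hconst : ∀ ε ∈ Set.Ioo 0 d, truncInt f x ε = truncInt f x d := by
    intro ε hε
    unfold truncInt
    congr 1
    rw [← integral_indicator measurableSet_ball.compl, ← integral_indicator measurableSet_ball.compl]
    congr 1; ext w
    by_cases hw : w ∈ Metric.ball x d
    · have hw2 : f w = 0 := by
        apply h0
        have h1 := Metric.mem_ball.1 hw
        have h2 := Metric.mem_ball.1 hxd
        rw [Metric.mem_ball]
        linarith [dist_triangle w x x₀]
      simp only [Set.indicator, hw2, zero_div, ite_self]
    · have hw' : w ∉ Metric.ball x ε := fun hh => hw (Metric.ball_subset_ball hε.2.le hh)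
      rw [Set.indicator_of_mem (by exact hw'), Set.indicator_of_mem (by exact hw)]
  rw [h.average_eq x hd]
  refine tendsto_nhds_unique hx (tendsto_const_nhds.congr' ?_)
  filter_upwards [Ioo_mem_nhdsGT hd] with ε hε using (hconst ε hε).symm

/-- The local form of the good-`λ` inequality, on a disc `B(x₀, d/2)` that is close both to a point
where the maximal function of `|F|²` is at most `t` and to a point where that of `|f|²` is at
most `γ t`. -/
lemma volume_maxSet_inter_closedBall_le {f F : ℂ → ℂ} (hf : MemLp f 2) (hF : MemLp F 2)
    (h : IsBeurlingPair f F) {t γ : ℝ≥0∞} (ht0 : t ≠ 0) (ht : t ≠ ∞) (hγ : γ ≤ 1)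
    {x₀ y₀ z₁ : ℂ} {d : ℝ} (hd : 0 < d)
    (hz : dist z₁ x₀ ≤ 2 * d) (hz₁ : z₁ ∉ maxSet (fun w => ‖F w‖ₑ ^ 2) t)
    (hy : dist y₀ x₀ ≤ d / 2) (hy₀ : y₀ ∉ maxSet (fun w => ‖f w‖ₑ ^ 2) (γ * t)) :
    volume (Metric.closedBall x₀ (d / 2) ∩ maxSet (fun w => ‖F w‖ₑ ^ 2) (400 * t)) ≤
      400 * γ * volume (Metric.closedBall x₀ (d / 10)) := by
  set v := volume (Metric.ball x₀ d) with hv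
  have hv0 : v ≠ 0 := volume_ball_pos hd
  have hvt : v ≠ ∞ := measure_ball_lt_top.ne
  set f₁ := (Metric.ball x₀ (4 * d)).indicator f with hf₁
  have hf₁m : MemLp f₁ 2 := hf.indicator measurableSet_ball
  obtain ⟨F₁, hF₁m, hF₁le, hF₁⟩ := exists_isBeurlingPair hf₁m
  have hpair := h.sub hf hF hf₁m hF₁m hF₁
  have hF₂m : MemLp (fun w => F w - F₁ w) 2 := hF.sub hF₁m
  -- size of `f` near the disc, and of the near part `F₁`
  have hfint : ∫⁻ w in Metric.ball x₀ (4 * d), ‖f w‖ₑ ^ 2 ≤ 16 * γ * t * v := by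
    have h1 := lintegral_ball_le_of_notMem hy₀ (c := x₀) (r := 4 * d)
      (by rw [Metric.mem_ball]; linarith)
    rw [volume_ball_mul x₀ x₀ (by norm_num)] at h1
    refine h1.trans_eq ?_
    rw [hv]; norm_num; ring
  have hF₁int : ∫⁻ w, ‖F₁ w‖ₑ ^ 2 ≤ 16 * γ * t * v := by
    refine le_trans ?_ hfint
    rw [lintegral_sq_eq, lintegral_sq_eq, ← eLpNorm_indicator_eq_eLpNorm_restrict measurableSet_ball]
    gcongr
  have hFint : ∫⁻ w in Metric.ball x₀ (2 * d), ‖F w‖ₑ ^ 2 ≤ 9 * t * v := by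
    calc _ ≤ ∫⁻ w in Metric.ball x₀ (3 * d), ‖F w‖ₑ ^ 2 :=
          lintegral_mono_set (Metric.ball_subset_ball (by linarith))
      _ ≤ t * volume (Metric.ball x₀ (3 * d)) :=
          lintegral_ball_le_of_notMem hz₁ (by rw [Metric.mem_ball]; linarith)
      _ = 9 * t * v := by
          rw [volume_ball_mul x₀ x₀ (by norm_num), hv]; norm_num; ring
  -- the far part is bounded on the disc
  have hF₂ : ∀ᵐ x, x ∈ Metric.ball x₀ d → ‖F x - F₁ x‖ₑ ^ 2 ≤ 50 * t := by
    have hzero : ∀ w ∈ Metric.ball x₀ (2 * d), f w - f₁ w = 0 := by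
      intro w hw
      rw [hf₁, Set.indicator_of_mem (Metric.ball_subset_ball (by linarith) hw), sub_self]
    filter_upwards [hpair.ae_eq_average hF₂m hd hzero] with x hx hxd
    have h1 := enorm_average_sq_le hF₂m x hd
    rw [← hx hxd] at h1
    have hvx : volume (Metric.ball x d) = v := by
      rw [hv, Complex.volume_ball, Complex.volume_ball]
    rw [hvx] at h1
    have h2 : ∫⁻ w in Metric.ball x d, ‖F w - F₁ w‖ₑ ^ 2 ≤ 50 * t * v := by
      calc _ ≤ ∫⁻ w in Metric.ball x₀ (2 * d), ‖F w - F₁ w‖ₑ ^ 2 := by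
            refine lintegral_mono_set fun w hw => ?_
            rw [Metric.mem_ball] at hw hxd ⊢
            linarith [dist_triangle w x x₀]
        _ ≤ ∫⁻ w in Metric.ball x₀ (2 * d), (2 * ‖F w‖ₑ ^ 2 + 2 * ‖F₁ w‖ₑ ^ 2) := by
            refine lintegral_mono fun w => ?_
            have := enorm_add_sq_le (F w) (-F₁ w)
            simpa [sub_eq_add_neg] using this
        _ = 2 * (∫⁻ w in Metric.ball x₀ (2 * d), ‖F w‖ₑ ^ 2) +
            2 * (∫⁻ w in Metric.ball x₀ (2 * d), ‖F₁ w‖ₑ ^ 2) := by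
            rw [lintegral_add_left' ((hF.aestronglyMeasurable.restrict.enorm.pow_const 2).const_mul 2),
              lintegral_const_mul' _ _ (by simp), lintegral_const_mul' _ _ (by simp)]
        _ ≤ 2 * (9 * t * v) + 2 * (16 * 1 * t * v) := by
            gcongr
            exact (setLIntegral_le_lintegral _ _).trans (hF₁int.trans (by gcongr))
        _ = 50 * t * v := by ring
    exact (ENNReal.mul_le_mul_iff_left hv0 hvt).1 (h1.trans h2)
  -- only small discs matter, and on them the near part is large
  have hsub : Metric.closedBall x₀ (d / 2) ∩ maxSet (fun w => ‖F w‖ₑ ^ 2) (400 * t) ⊆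
      maxSet (fun w => ‖F₁ w‖ₑ ^ 2) (100 * t) := by
    rintro y ⟨hyb, c, r, hr, hyc, hlt⟩
    rw [Metric.mem_closedBall] at hyb
    rw [Metric.mem_ball] at hyc
    set b := volume (Metric.ball c r) with hb
    have hb0 : b ≠ 0 := volume_ball_pos hr
    have hbt : b ≠ ∞ := measure_ball_lt_top.ne
    have hrd : r < d / 4 := by
      by_contra hrd
      push Not at hrd
      have h1 := lintegral_ball_le_of_notMem hz₁ (c := c) (r := 11 * r) (by
        rw [Metric.mem_ball]
        have h1 := dist_triangle z₁ x₀ c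
        have h2 := dist_triangle x₀ y c
        rw [dist_comm x₀ y] at h2
        linarith)
      rw [volume_ball_mul c c (by norm_num), ← hb] at h1
      have h2 : ∫⁻ w in Metric.ball c r, ‖F w‖ₑ ^ 2 ≤ ∫⁻ w in Metric.ball c (11 * r), ‖F w‖ₑ ^ 2 :=
        lintegral_mono_set (Metric.ball_subset_ball (by linarith))
      have h3 : 400 * t * b < 400 * t * b := by
        calc _ < _ := hlt
          _ ≤ _ := h2.trans h1
          _ = 121 * t * b := by norm_num; ring
          _ ≤ 400 * t * b := by gcongr; norm_num
      exact lt_irrefl _ h3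
    refine ⟨c, r, hr, hyc, ?_⟩
    have hbsub : Metric.ball c r ⊆ Metric.ball x₀ d := by
      intro w hw
      rw [Metric.mem_ball] at hw ⊢
      have h1 := dist_triangle w c x₀
      have h2 := dist_triangle c y x₀
      rw [dist_comm c y] at h2
      linarith
    have hle : ∫⁻ w in Metric.ball c r, ‖F w‖ₑ ^ 2 ≤
        2 * (∫⁻ w in Metric.ball c r, ‖F₁ w‖ₑ ^ 2) + 100 * t * b := by
      calc _ ≤ ∫⁻ w in Metric.ball c r, (2 * ‖F₁ w‖ₑ ^ 2 + 100 * t) := by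
            refine setLIntegral_mono_ae' measurableSet_ball ?_
            filter_upwards [hF₂] with w hw hwc
            have h1 := enorm_add_sq_le (F₁ w) (F w - F₁ w)
            rw [add_sub_cancel] at h1
            refine h1.trans ?_
            calc _ ≤ 2 * ‖F₁ w‖ₑ ^ 2 + 2 * (50 * t) := by gcongr; exact hw (hbsub hwc)
              _ = _ := by ring
        _ = _ := by
            rw [lintegral_add_right _ measurable_const, setLIntegral_const, lintegral_const_mul']
            simp
    rw [← hb]
    by_contra hcon
    push Not at hcon
    have : 400 * t * b < 400 * t * b := by
      calc _ < _ := hlt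
        _ ≤ _ := hle
        _ ≤ 2 * (100 * t * b) + 100 * t * b := by gcongr
        _ = 300 * t * b := by ring
        _ ≤ 400 * t * b := by gcongr; norm_num
    exact lt_irrefl _ this
  have hweak := mul_volume_maxSet_le (fun w => ‖F₁ w‖ₑ ^ 2) (100 * t)
  have hv10 : volume (Metric.closedBall x₀ (d / 10)) = ENNReal.ofReal ((1 / 10) ^ 2) * v := by
    have := volume_closedBall_mul x₀ x₀ (k := 1 / 10) (by norm_num) d
    rw [one_div_mul_eq_div] at this
    exact this
  have h10 : 100 * ENNReal.ofReal ((1 / 10) ^ 2) = 1 := by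
    rw [show (100 : ℝ≥0∞) = ENNReal.ofReal 100 by simp, ← ENNReal.ofReal_mul (by norm_num)]
    norm_num
  have ht100 : 100 * t ≠ 0 := mul_ne_zero (by norm_num) ht0
  have ht100' : 100 * t ≠ ∞ := ENNReal.mul_ne_top (by norm_num) ht
  refine (measure_mono hsub).trans ?_
  rw [← ENNReal.mul_le_mul_iff_right ht100 ht100']
  calc _ ≤ _ := hweak
    _ ≤ 25 * (16 * γ * t * v) := by gcongr
    _ = 400 * γ * t * v * 1 := by ring
    _ = 400 * γ * t * v * (100 * ENNReal.ofReal ((1 / 10) ^ 2)) := by rw [h10]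
    _ = _ := by rw [hv10]; ring

end Bukhgeim

namespace Bukhgeim

/-- The good-`λ` inequality: where the maximal function of `|F|²` is large, that of `|f|²` is rarely
small. The discs of `volume_maxSet_inter_closedBall_le` form a Whitney-type covering. -/
lemma volume_maxSet_diff_le {f F : ℂ → ℂ} (hf : MemLp f 2) (hF : MemLp F 2)
    (h : IsBeurlingPair f F) {t γ : ℝ≥0∞} (ht0 : t ≠ 0) (ht : t ≠ ∞) (hγ : γ ≤ 1) :
    volume (maxSet (fun w => ‖F w‖ₑ ^ 2) (400 * t) \ maxSet (fun w => ‖f w‖ₑ ^ 2) (γ * t)) ≤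
      400 * γ * volume (maxSet (fun w => ‖F w‖ₑ ^ 2) t) := by
  set V := maxSet (fun w => ‖F w‖ₑ ^ 2) t with hV
  set W := maxSet (fun w => ‖f w‖ₑ ^ 2) (γ * t) with hW
  have hVo : IsOpen V := isOpen_maxSet _ _
  have hVfin : volume V ≠ ∞ := by
    intro hc
    have h1 := mul_volume_maxSet_le (fun w => ‖F w‖ₑ ^ 2) t
    rw [← hV, hc, ENNReal.mul_top ht0, lintegral_sq_eq, top_le_iff] at h1
    exact ENNReal.mul_ne_top (by norm_num) (ENNReal.pow_ne_top hF.eLpNorm_ne_top) h1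
  have hVc : (Vᶜ).Nonempty := by
    rw [Set.nonempty_compl]
    rintro hc
    rw [hc] at hVfin
    exact hVfin (measure_univ_of_isAddLeftInvariant volume)
  -- disjoint discs of radius a tenth of the distance to the complement; the discs of five times
  -- that radius cover `V` and are still close to its complement
  let d : ℂ → ℝ := fun x => Metric.infDist x Vᶜ
  have hdpos : ∀ x ∈ V, 0 < d x := fun x hx =>
    (hVo.isClosed_compl.notMem_iff_infDist_pos hVc).1 (by simpa using hx)
  have hball : ∀ x, Metric.ball x (d x) ⊆ V := by
    intro x
    have := Metric.ball_infDist_subset_compl (s := Vᶜ) (x := x)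
    rwa [compl_compl] at this
  have hdbound : ∀ x ∈ V, d x / 10 ≤ (volume V).toReal + 1 := by
    intro x hx
    have h1 := ENNReal.toReal_mono hVfin (measure_mono (hball x))
    have h2 := volume_real_ball x (hdpos x hx).le
    rw [Measure.real] at h2
    rw [h2] at h1
    have h3 := hdpos x hx
    have h4 : (d x) ^ 2 ≤ Real.pi * (d x) ^ 2 := by nlinarith [Real.pi_gt_three, sq_nonneg (d x)]
    nlinarith [sq_nonneg (d x - 1)]
  obtain ⟨u, huV, hud, hucov⟩ := Vitali.exists_disjoint_subfamily_covering_enlargement_closedBall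
    V (fun x => x) (fun x => d x / 10) _ hdbound 5 (by norm_num)
  have hcount : u.Countable := hud.countable_of_nonempty_interior fun q hq =>
    ⟨q, Metric.ball_subset_interior_closedBall (Metric.mem_ball_self (by
      have := hdpos q (huV hq); positivity))⟩
  have hsub : maxSet (fun w => ‖F w‖ₑ ^ 2) (400 * t) \ W ⊆
      ⋃ q ∈ u, (Metric.closedBall q (d q / 2) ∩ maxSet (fun w => ‖F w‖ₑ ^ 2) (400 * t)) \ W := by
    rintro x ⟨hx, hxW⟩
    have hxV : x ∈ V := maxSet_anti _ (le_mul_of_one_le_left (zero_le) (by norm_num)) hx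
    obtain ⟨q, hq, hs⟩ := hucov x hxV
    have hxq := hs (Metric.mem_closedBall_self (by have := hdpos x hxV; positivity))
    refine Set.mem_biUnion hq ⟨⟨?_, hx⟩, hxW⟩
    convert hxq using 2
    ring
  have hloc : ∀ q ∈ u, volume ((Metric.closedBall q (d q / 2) ∩
      maxSet (fun w => ‖F w‖ₑ ^ 2) (400 * t)) \ W) ≤
        400 * γ * volume (Metric.closedBall q (d q / 10)) := by
    intro q hq
    have hdq := hdpos q (huV hq)
    rcases Set.eq_empty_or_nonempty ((Metric.closedBall q (d q / 2) ∩
      maxSet (fun w => ‖F w‖ₑ ^ 2) (400 * t)) \ W) with he | ⟨y, ⟨hy1, _⟩, hy2⟩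
    · rw [he]; simp
    · obtain ⟨z, hz, hzd⟩ := (Metric.infDist_lt_iff (r := 2 * d q) hVc).1 (by
        change d q < 2 * d q; linarith)
      refine (measure_mono Set.sdiff_subset).trans ?_
      exact volume_maxSet_inter_closedBall_le hf hF h ht0 ht hγ hdq
        (by rw [dist_comm]; exact hzd.le) hz (Metric.mem_closedBall.1 hy1) hy2
  calc _ ≤ volume (⋃ q ∈ u, (Metric.closedBall q (d q / 2) ∩
        maxSet (fun w => ‖F w‖ₑ ^ 2) (400 * t)) \ W) := measure_mono hsub
    _ ≤ ∑' q : u, volume ((Metric.closedBall q.1 (d q.1 / 2) ∩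
        maxSet (fun w => ‖F w‖ₑ ^ 2) (400 * t)) \ W) := measure_biUnion_le _ hcount _
    _ ≤ ∑' q : u, 400 * γ * volume (Metric.closedBall q.1 (d q.1 / 10)) := by
        gcongr with q
        exact hloc q.1 q.2
    _ = 400 * γ * volume (⋃ q ∈ u, Metric.closedBall q (d q / 10)) := by
        rw [ENNReal.tsum_mul_left, measure_biUnion hcount hud fun q _ => measurableSet_closedBall]
    _ ≤ 400 * γ * volume V := by
        gcongr
        refine Set.iUnion₂_subset fun q hq => ?_
        have hdq := hdpos q (huV hq)
        exact (Metric.closedBall_subset_ball (by linarith)).trans (hball q)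

/-! ### `L^p` bounds from distribution functions -/

lemma setLIntegral_image_mul {c : ℝ} (hc : 0 < c) {S : Set ℝ} (hS : MeasurableSet S) (g : ℝ → ℝ≥0∞) :
    ∫⁻ t in (fun t => c * t) '' S, g t = ENNReal.ofReal c * ∫⁻ t in S, g (c * t) := by
  rw [lintegral_image_eq_lintegral_abs_deriv_mul hS (f' := fun _ => c)
    (fun x _ => by simpa using ((hasDerivAt_id x).const_mul c).hasDerivWithinAt)
    (fun x _ y _ hxy => mul_left_cancel₀ hc.ne' hxy)]
  rw [abs_of_pos hc, lintegral_const_mul' _ _ ENNReal.ofReal_ne_top]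

lemma setLIntegral_rpow_image_mul {c s : ℝ} (hc : 0 < c) {S : Set ℝ} (hS : MeasurableSet S)
    (hS0 : S ⊆ Set.Ioi 0) (a : ℝ → ℝ≥0∞) :
    ∫⁻ t in (fun t => c * t) '' S, ENNReal.ofReal (t ^ (s - 1)) * a t =
      ENNReal.ofReal (c ^ s) * ∫⁻ t in S, ENNReal.ofReal (t ^ (s - 1)) * a (c * t) := by
  rw [setLIntegral_image_mul hc hS, ← lintegral_const_mul' _ _ ENNReal.ofReal_ne_top,
    ← lintegral_const_mul' _ _ ENNReal.ofReal_ne_top]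
  refine setLIntegral_congr_fun hS fun t ht => ?_
  have ht0 : 0 < t := hS0 ht
  rw [← mul_assoc, ← mul_assoc, ← ENNReal.ofReal_mul hc.le, ← ENNReal.ofReal_mul (by positivity),
    Real.mul_rpow hc.le ht0.le]
  congr 2
  rw [← mul_assoc, Real.rpow_sub_one hc.ne']
  field_simp

/-- A good-`λ` inequality between distribution functions gives an inequality between moments. -/
lemma lintegral_le_of_goodLambda {a w : ℝ → ℝ≥0∞} {K γ s : ℝ} {η A : ℝ≥0∞} (hK : 1 < K)
    (hγ : 0 < γ) (hs : 1 < s) (ha : Measurable a)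
    (hη : ENNReal.ofReal (K ^ s) * η ≤ 1 / 2) (hA : A ≠ ∞)
    (haA : ∀ t : ℝ, 0 < t → ENNReal.ofReal t * a t ≤ A)
    (hgood : ∀ t : ℝ, 0 < t → a (K * t) ≤ η * a t + w (γ * t)) :
    ∫⁻ t in Set.Ioi (0 : ℝ), ENNReal.ofReal (t ^ (s - 1)) * a t ≤
      2 * (ENNReal.ofReal (K ^ s) * ENNReal.ofReal ((γ⁻¹) ^ s) *
        ∫⁻ t in Set.Ioi (0 : ℝ), ENNReal.ofReal (t ^ (s - 1)) * w t) := by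
  have hK0 : 0 < K := by linarith
  set X := ENNReal.ofReal (K ^ s) * ENNReal.ofReal ((γ⁻¹) ^ s) *
        ∫⁻ t in Set.Ioi (0 : ℝ), ENNReal.ofReal (t ^ (s - 1)) * w t with hX
  have hwscale : ∫⁻ t in Set.Ioi (0 : ℝ), ENNReal.ofReal (t ^ (s - 1)) * w (γ * t) =
      ENNReal.ofReal ((γ⁻¹) ^ s) * ∫⁻ t in Set.Ioi (0 : ℝ), ENNReal.ofReal (t ^ (s - 1)) * w t := by
    have h1 := setLIntegral_rpow_image_mul (s := s) hγ (measurableSet_Ioi (a := (0 : ℝ))) le_rfl w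
    have h2 : (fun t => γ * t) '' Set.Ioi (0 : ℝ) = Set.Ioi 0 := by
      rw [Set.image_mul_left_Ioi hγ, mul_zero]
    rw [h2] at h1
    rw [h1, ← mul_assoc, ← ENNReal.ofReal_mul (by positivity), ← Real.mul_rpow (by positivity) hγ.le,
      inv_mul_cancel₀ hγ.ne', Real.one_rpow, ENNReal.ofReal_one, one_mul]
  -- the truncated moments
  have main : ∀ N : ℕ, ∫⁻ t in Set.Ioc (0 : ℝ) N, ENNReal.ofReal (t ^ (s - 1)) * a t ≤ 2 * X := by
    intro N
    set J := ∫⁻ t in Set.Ioc (0 : ℝ) N, ENNReal.ofReal (t ^ (s - 1)) * a t with hJ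
    have hJfin : J ≠ ∞ := by
      have h1 : J ≤ ∫⁻ t in Set.Ioc (0 : ℝ) N, ENNReal.ofReal (t ^ (s - 2)) * A := by
        refine setLIntegral_mono' measurableSet_Ioc fun t ht => ?_
        have : ENNReal.ofReal (t ^ (s - 1)) = ENNReal.ofReal (t ^ (s - 2)) * ENNReal.ofReal t := by
          rw [← ENNReal.ofReal_mul (Real.rpow_nonneg ht.1.le _), ← Real.rpow_add_one ht.1.ne']
          congr 2; ring
        rw [this, mul_assoc]
        gcongr
        exact haA t ht.1
      have h2 : ∫⁻ t in Set.Ioc (0 : ℝ) N, ENNReal.ofReal (t ^ (s - 2)) < ∞ := by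
        have := intervalIntegral.intervalIntegrable_rpow' (a := 0) (b := N) (r := s - 2) (by linarith)
        rw [intervalIntegrable_iff_integrableOn_Ioc_of_le (by positivity)] at this
        exact this.lintegral_lt_top
      refine (h1.trans_lt ?_).ne
      rw [lintegral_mul_const' _ _ hA]
      exact ENNReal.mul_lt_top h2 hA.lt_top
    have h3 : J ≤ 1 / 2 * J + X := by
      calc J ≤ ∫⁻ t in (fun t => K * t) '' Set.Ioc (0 : ℝ) N, ENNReal.ofReal (t ^ (s - 1)) * a t := by
            refine lintegral_mono_set ?_
            rw [Set.image_mul_left_Ioc hK0, mul_zero]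
            exact Set.Ioc_subset_Ioc_right (le_mul_of_one_le_left (by positivity) hK.le)
        _ = ENNReal.ofReal (K ^ s) *
            ∫⁻ t in Set.Ioc (0 : ℝ) N, ENNReal.ofReal (t ^ (s - 1)) * a (K * t) :=
            setLIntegral_rpow_image_mul hK0 measurableSet_Ioc Set.Ioc_subset_Ioi_self a
        _ ≤ ENNReal.ofReal (K ^ s) * ∫⁻ t in Set.Ioc (0 : ℝ) N,
            (η * (ENNReal.ofReal (t ^ (s - 1)) * a t) + ENNReal.ofReal (t ^ (s - 1)) * w (γ * t)) := by
            refine mul_le_mul' le_rfl ?_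
            refine setLIntegral_mono' measurableSet_Ioc fun t ht => ?_
            calc _ ≤ ENNReal.ofReal (t ^ (s - 1)) * (η * a t + w (γ * t)) := by
                  gcongr; exact hgood t ht.1
              _ = _ := by ring
        _ = ENNReal.ofReal (K ^ s) * (η * J +
            ∫⁻ t in Set.Ioc (0 : ℝ) N, ENNReal.ofReal (t ^ (s - 1)) * w (γ * t)) := by
            rw [lintegral_add_left (by fun_prop), lintegral_const_mul _ (by fun_prop)]
        _ ≤ ENNReal.ofReal (K ^ s) * (η * J +
            ∫⁻ t in Set.Ioi (0 : ℝ), ENNReal.ofReal (t ^ (s - 1)) * w (γ * t)) := by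
            gcongr
            exact (Set.Ioc_subset_Ioi_self : Set.Ioc (0 : ℝ) N ⊆ Set.Ioi 0)
        _ = (ENNReal.ofReal (K ^ s) * η) * J + X := by rw [hwscale, hX]; ring
        _ ≤ 1 / 2 * J + X := by gcongr
    have h4 : 1 / 2 * J ≠ ∞ := ENNReal.mul_ne_top (by simp) hJfin
    have h5 : 1 / 2 * J + 1 / 2 * J = J := by
      rw [← add_mul, ENNReal.add_halves, one_mul]
    have h6 := (ENNReal.add_le_add_iff_left h4).1 (h5.le.trans h3)
    calc J = 2 * (1 / 2 * J) := by rw [two_mul, h5]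
      _ ≤ 2 * X := by gcongr
  have hun : Set.Ioi (0 : ℝ) = ⋃ N : ℕ, Set.Ioc (0 : ℝ) N := by
    ext t
    simp only [Set.mem_Ioi, Set.mem_iUnion, Set.mem_Ioc, exists_and_left]
    exact ⟨fun h => ⟨h, exists_nat_ge t⟩, fun h => h.1⟩
  rw [hun, setLIntegral_iUnion_of_directed]
  · exact iSup_le main
  · refine Monotone.directed_le fun m n hmn => ?_
    exact Set.Ioc_subset_Ioc_right (by exact_mod_cast hmn)

end Bukhgeim

namespace Bukhgeim

lemma ofReal_norm_sq (z : ℂ) : ENNReal.ofReal (‖z‖ ^ 2) = ‖z‖ₑ ^ 2 := by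
  rw [ENNReal.ofReal_pow (norm_nonneg z), ofReal_norm]

lemma ofReal_norm_sq_rpow (z : ℂ) {s : ℝ} (hs : 0 ≤ s) :
    ENNReal.ofReal ((‖z‖ ^ 2) ^ s) = ‖z‖ₑ ^ (2 * s) := by
  rw [← ENNReal.ofReal_rpow_of_nonneg (by positivity) hs, ofReal_norm_sq, ENNReal.rpow_mul,
    ENNReal.rpow_two]

lemma measurable_volume_maxSet (h : ℂ → ℝ≥0∞) :
    Measurable fun t : ℝ => volume (maxSet h (ENNReal.ofReal t)) := by
  refine Antitone.measurable fun s t hst => measure_mono (maxSet_anti h ?_)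
  exact ENNReal.ofReal_le_ofReal hst

/-- The moments of the maximal function of `|f|²` are bounded by those of `|f|²`. -/
lemma lintegral_volume_maxSet_le {f : ℂ → ℂ} (hf : MemLp f 2) {s : ℝ} (hs : 1 < s) :
    ∫⁻ t in Set.Ioi (0 : ℝ), ENNReal.ofReal (t ^ (s - 1)) *
      volume (maxSet (fun w => ‖f w‖ₑ ^ 2) (ENNReal.ofReal t)) ≤
      (50 * (ENNReal.ofReal (s - 1))⁻¹ * ENNReal.ofReal (2 ^ (s - 1))) *
        ∫⁻ w, ‖f w‖ₑ ^ (2 * s) := by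
  have hs1 : 0 < s - 1 := by linarith
  set h : ℂ → ℝ≥0∞ := fun w => ‖f w‖ₑ ^ 2 with hh
  have hm : AEMeasurable h := hf.aestronglyMeasurable.enorm.pow_const 2
  set ν : Measure ℂ := volume.withDensity h with hν
  have hνac : ν ≪ volume := withDensity_absolutelyContinuous _ _
  -- the layer-cake formula for the measure with density `h`
  have lc := lintegral_rpow_eq_lintegral_meas_lt_mul ν (f := fun w => 2 * ‖f w‖ ^ 2)
    (ae_of_all _ fun w => by positivity)
    (((hf.aestronglyMeasurable.norm.aemeasurable.pow_const 2).const_mul 2).mono_ac hνac) hs1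
  have hpt : ∀ t ∈ Set.Ioi (0 : ℝ), ENNReal.ofReal (t ^ (s - 1)) *
      volume (maxSet h (ENNReal.ofReal t)) ≤
      50 * (ν {w | t < 2 * ‖f w‖ ^ 2} * ENNReal.ofReal (t ^ (s - 1 - 1))) := by
    intro t ht
    have ht0 : (0 : ℝ) < t := ht
    have h1 := mul_volume_maxSet_two_mul_le hm (t := ENNReal.ofReal (t / 2))
    have e1 : 2 * ENNReal.ofReal (t / 2) = ENNReal.ofReal t := by
      rw [show (2 : ℝ≥0∞) = ENNReal.ofReal 2 by simp, ← ENNReal.ofReal_mul (by norm_num)]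
      congr 1; ring
    rw [e1] at h1
    have hset : {w | ENNReal.ofReal (t / 2) < h w} = {w | t < 2 * ‖f w‖ ^ 2} := by
      ext w
      simp only [Set.mem_ofPred_eq, hh, ← ofReal_norm_sq]
      rw [ENNReal.ofReal_lt_ofReal_iff_of_nonneg (by positivity)]
      constructor <;> intro h <;> linarith
    have hns : NullMeasurableSet {w | t < 2 * ‖f w‖ ^ 2} volume := by
      rw [← hset]; exact nullMeasurableSet_lt aemeasurable_const hm
    have e2 : ∫⁻ w in {w | ENNReal.ofReal (t / 2) < h w}, h w = ν {w | t < 2 * ‖f w‖ ^ 2} := by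
      rw [hset, hν, withDensity_apply₀ _ hns]
    rw [e2] at h1
    have e3 : ENNReal.ofReal (t ^ (s - 1)) =
        2 * ENNReal.ofReal (t ^ (s - 1 - 1)) * ENNReal.ofReal (t / 2) := by
      rw [mul_comm 2, mul_assoc, e1, ← ENNReal.ofReal_mul (by positivity), ← Real.rpow_add_one ht0.ne']
      congr 2; ring
    calc _ = 2 * ENNReal.ofReal (t ^ (s - 1 - 1)) *
          (ENNReal.ofReal (t / 2) * volume (maxSet h (ENNReal.ofReal t))) := by rw [e3]; ring
      _ ≤ 2 * ENNReal.ofReal (t ^ (s - 1 - 1)) * (25 * ν {w | t < 2 * ‖f w‖ ^ 2}) := by gcongr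
      _ = _ := by ring
  have hν2 : ∫⁻ w, ENNReal.ofReal ((2 * ‖f w‖ ^ 2) ^ (s - 1)) ∂ν =
      ENNReal.ofReal (2 ^ (s - 1)) * ∫⁻ w, ‖f w‖ₑ ^ (2 * s) := by
    rw [hν, lintegral_withDensity_eq_lintegral_mul₀ hm]
    · rw [← lintegral_const_mul' _ _ ENNReal.ofReal_ne_top]
      refine lintegral_congr fun w => ?_
      simp only [Pi.mul_apply, hh]
      rw [Real.mul_rpow (by norm_num) (by positivity), ENNReal.ofReal_mul (by positivity),
        ofReal_norm_sq_rpow _ hs1.le, mul_left_comm]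
      congr 1
      rw [← ENNReal.rpow_two, ← ENNReal.rpow_add_of_nonneg _ _ (by norm_num) (by linarith)]
      congr 1; ring
    · have := hf.aestronglyMeasurable.norm.aemeasurable
      fun_prop
  have hsne : ENNReal.ofReal (s - 1) ≠ 0 := by simpa using hs1
  calc _ ≤ ∫⁻ t in Set.Ioi (0 : ℝ),
        50 * (ν {w | t < 2 * ‖f w‖ ^ 2} * ENNReal.ofReal (t ^ (s - 1 - 1))) :=
        setLIntegral_mono' measurableSet_Ioi hpt
    _ = 50 * ((ENNReal.ofReal (s - 1))⁻¹ * (ENNReal.ofReal (s - 1) *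
        ∫⁻ t in Set.Ioi (0 : ℝ), ν {w | t < 2 * ‖f w‖ ^ 2} * ENNReal.ofReal (t ^ (s - 1 - 1)))) := by
        rw [lintegral_const_mul' _ _ (by simp), ← mul_assoc (ENNReal.ofReal (s - 1))⁻¹,
          ENNReal.inv_mul_cancel hsne ENNReal.ofReal_ne_top, one_mul]
    _ = _ := by rw [← lc, hν2]; ring

/-- The Beurling transform is bounded on `L^{2s}`, `s > 1`. -/
theorem exists_lintegral_rpow_beurling_le {s : ℝ} (hs : 1 < s) : ∃ C : ℝ≥0, ∀ f F : ℂ → ℂ,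
    MemLp f 2 → MemLp F 2 → IsBeurlingPair f F →
      ∫⁻ w, ‖F w‖ₑ ^ (2 * s) ≤ C * ∫⁻ w, ‖f w‖ₑ ^ (2 * s) := by
  -- chosen so that `400 ^ s * (400 γ) = 1 / 2`
  set γ : ℝ := 1 / (800 * 400 ^ s) with hγ
  have h400 : (1 : ℝ) ≤ 400 ^ s := Real.one_le_rpow (by norm_num) (by linarith)
  have hγ0 : 0 < γ := by positivity
  have hγ1 : γ ≤ 1 := by
    rw [hγ, div_le_one (by positivity)]; linarith
  set D : ℝ≥0∞ := ENNReal.ofReal s * (2 * (ENNReal.ofReal (400 ^ s) * ENNReal.ofReal ((γ⁻¹) ^ s) *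
    (50 * (ENNReal.ofReal (s - 1))⁻¹ * ENNReal.ofReal (2 ^ (s - 1))))) with hD
  have hsne : ENNReal.ofReal (s - 1) ≠ 0 := by simpa using hs
  have hDtop : D ≠ ∞ := by
    have : (ENNReal.ofReal (s - 1))⁻¹ ≠ ∞ := ENNReal.inv_ne_top.2 hsne
    rw [hD]
    finiteness
  refine ⟨D.toNNReal, fun f F hf hF h => ?_⟩
  rw [ENNReal.coe_toNNReal hDtop]
  set hF' : ℂ → ℝ≥0∞ := fun w => ‖F w‖ₑ ^ 2 with hhF
  set a : ℝ → ℝ≥0∞ := fun t => volume (maxSet hF' (ENNReal.ofReal t)) with ha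
  set b : ℝ → ℝ≥0∞ := fun t => volume (maxSet (fun w => ‖f w‖ₑ ^ 2) (ENNReal.ofReal t)) with hb
  have hFint : ∫⁻ w, hF' w ≠ ∞ := by
    rw [hhF, lintegral_sq_eq]; exact ENNReal.pow_ne_top hF.eLpNorm_ne_top
  have good : ∫⁻ t in Set.Ioi (0 : ℝ), ENNReal.ofReal (t ^ (s - 1)) * a t ≤
      2 * (ENNReal.ofReal (400 ^ s) * ENNReal.ofReal ((γ⁻¹) ^ s) *
        ∫⁻ t in Set.Ioi (0 : ℝ), ENNReal.ofReal (t ^ (s - 1)) * b t) := by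
    refine lintegral_le_of_goodLambda (η := 400 * ENNReal.ofReal γ) (A := 25 * ∫⁻ w, hF' w)
      (by norm_num) hγ0 hs (measurable_volume_maxSet _) ?_ (ENNReal.mul_ne_top (by norm_num) hFint)
      (fun t _ => mul_volume_maxSet_le _ _) fun t ht => ?_
    · rw [show (400 : ℝ≥0∞) = ENNReal.ofReal 400 by simp, ← ENNReal.ofReal_mul (by norm_num),
        ← ENNReal.ofReal_mul (by positivity)]
      rw [show (1 / 2 : ℝ≥0∞) = ENNReal.ofReal (1 / 2) by
        rw [ENNReal.ofReal_div_of_pos (by norm_num)]; simp]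
      apply ENNReal.ofReal_le_ofReal
      rw [hγ]
      apply le_of_eq
      field_simp
      norm_num
    · have h1 := volume_maxSet_diff_le hf hF h (t := ENNReal.ofReal t) (γ := ENNReal.ofReal γ)
        (by simpa using ht) ENNReal.ofReal_ne_top (by simpa using hγ1)
      have e1 : 400 * ENNReal.ofReal t = ENNReal.ofReal (400 * t) := by
        rw [ENNReal.ofReal_mul (by norm_num)]; simp
      have e2 : ENNReal.ofReal γ * ENNReal.ofReal t = ENNReal.ofReal (γ * t) := by
        rw [ENNReal.ofReal_mul hγ0.le]
      rw [e1, e2] at h1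
      calc a (400 * t) ≤ volume ((maxSet hF' (ENNReal.ofReal (400 * t)) \
            maxSet (fun w => ‖f w‖ₑ ^ 2) (ENNReal.ofReal (γ * t))) ∪
            maxSet (fun w => ‖f w‖ₑ ^ 2) (ENNReal.ofReal (γ * t))) :=
            measure_mono (by rw [Set.sdiff_union_self]; exact Set.subset_union_left)
        _ ≤ _ := (measure_union_le _ _).trans (by gcongr)
  have hFm : AEMeasurable hF' := hF.aestronglyMeasurable.enorm.pow_const 2
  have lc := lintegral_rpow_eq_lintegral_meas_lt_mul volume (f := fun w => ‖F w‖ ^ 2)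
    (ae_of_all _ fun w => by positivity)
    (hF.aestronglyMeasurable.norm.aemeasurable.pow_const 2) (p := s) (by linarith)
  calc ∫⁻ w, ‖F w‖ₑ ^ (2 * s) = ∫⁻ w, ENNReal.ofReal ((‖F w‖ ^ 2) ^ s) :=
        lintegral_congr fun w => (ofReal_norm_sq_rpow _ (by linarith)).symm
    _ = _ := lc
    _ ≤ ENNReal.ofReal s * ∫⁻ t in Set.Ioi (0 : ℝ), ENNReal.ofReal (t ^ (s - 1)) * a t := by
        refine mul_le_mul' le_rfl (setLIntegral_mono' measurableSet_Ioi fun t ht => ?_)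
        rw [mul_comm]
        refine mul_le_mul' le_rfl (measure_mono_ae ?_)
        filter_upwards [ae_mem_maxSet hFm hFint] with w hw hwt
        apply hw
        rw [hhF]
        simp only
        rw [← ofReal_norm_sq]
        exact (ENNReal.ofReal_lt_ofReal_iff_of_nonneg (le_of_lt ht)).2 hwt
    _ ≤ ENNReal.ofReal s * (2 * (ENNReal.ofReal (400 ^ s) * ENNReal.ofReal ((γ⁻¹) ^ s) *
        ((50 * (ENNReal.ofReal (s - 1))⁻¹ * ENNReal.ofReal (2 ^ (s - 1))) *
        ∫⁻ w, ‖f w‖ₑ ^ (2 * s)))) := by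
        refine mul_le_mul' le_rfl (good.trans ?_)
        refine mul_le_mul' le_rfl (mul_le_mul' le_rfl ?_)
        exact lintegral_volume_maxSet_le hf hs
    _ = _ := by rw [hD]; ring

end Bukhgeim

/-! ### The Beurling operators on the disc -/

namespace Bukhgeim

lemma measurableSet_disc : MeasurableSet disc := measurableSet_ball

instance : IsFiniteMeasure discMeasure :=
  ⟨by rw [discMeasure, Measure.restrict_apply_univ]; exact measure_ball_lt_top⟩

lemma discMeasure_ac : discMeasure ≪ volume := Measure.absolutelyContinuous_of_le Measure.restrict_le_self

lemma ofReal_p_ne_zero {p : ℝ} (hp : 2 < p) : ENNReal.ofReal p ≠ 0 := by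
  simp; linarith

lemma two_le_ofReal_p {p : ℝ} (hp : 2 < p) : 2 ≤ ENNReal.ofReal p := by
  rw [show (2 : ℝ≥0∞) = ENNReal.ofReal 2 by simp]
  exact ENNReal.ofReal_le_ofReal hp.le

lemma one_le_ofReal_p {p : ℝ} (hp : 2 < p) : 1 ≤ ENNReal.ofReal p :=
  le_trans (by norm_num) (two_le_ofReal_p hp)

lemma MemLpDisc.conj {p : ℝ} {f : ℂ → ℂ} (hf : MemLpDisc p f) : MemLpDisc p fun z => conj (f z) :=
  hf.of_le (Complex.continuous_conj.comp_aestronglyMeasurable hf.aestronglyMeasurable)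
    (ae_of_all _ fun z => by simp)

lemma lpDisc_conj (p : ℝ) (f : ℂ → ℂ) : lpDisc p (fun z => conj (f z)) = lpDisc p f :=
  eLpNorm_congr_norm_ae (ae_of_all _ fun z => by simp)

lemma memLp_two_indicator_disc {p : ℝ} (hp : 2 < p) {f : ℂ → ℂ} (hf : MemLpDisc p f) :
    MemLp (disc.indicator f) 2 := by
  rw [memLp_indicator_iff_restrict measurableSet_disc]
  have : MemLp f 2 discMeasure := MemLp.mono_exponent hf (two_le_ofReal_p hp)
  exact this

lemma beurlingTrunc_eq (f : ℂ → ℂ) (z : ℂ) (ε : ℝ) :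
    beurlingTrunc f z ε = truncInt (disc.indicator f) z ε := by
  unfold beurlingTrunc truncInt
  congr 1
  rw [← integral_indicator (measurableSet_disc.diff measurableSet_ball),
    ← integral_indicator measurableSet_ball.compl]
  congr 1; ext w
  by_cases h1 : w ∈ Metric.ball z ε <;> by_cases h2 : w ∈ disc <;>
    simp [Set.indicator, h1, h2, sub_sq_comm z w]

lemma beurlingBarTrunc_eq (f : ℂ → ℂ) (z : ℂ) (ε : ℝ) :
    beurlingBarTrunc f z ε = conj (beurlingTrunc (fun w => conj (f w)) z ε) := by
  unfold beurlingBarTrunc beurlingTrunc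
  rw [map_mul, ← integral_conj]
  simp

lemma exists_beurling {p : ℝ} (hp : 2 < p) {f : ℂ → ℂ} (hf : MemLpDisc p f) :
    ∃ F, MemLp F 2 ∧ IsBeurlingPair (disc.indicator f) F ∧
      ∀ᵐ z, Tendsto (beurlingTrunc f z) (𝓝[>] 0) (𝓝 (F z)) := by
  obtain ⟨F, hF, -, hpair⟩ := exists_isBeurlingPair (memLp_two_indicator_disc hp hf)
  refine ⟨F, hF, hpair, ?_⟩
  filter_upwards [hpair.ae_tendsto (locallyIntegrable_of_memLp_two hF)] with z hz
  have : beurlingTrunc f z = truncInt (disc.indicator f) z := funext fun ε => beurlingTrunc_eq f z ε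
  rwa [this]

lemma tendsto_beurlingBarTrunc {f : ℂ → ℂ} {z l : ℂ}
    (h : Tendsto (beurlingTrunc (fun w => conj (f w)) z) (𝓝[>] 0) (𝓝 l)) :
    Tendsto (beurlingBarTrunc f z) (𝓝[>] 0) (𝓝 (conj l)) :=
  ((Complex.continuous_conj.tendsto l).comp h).congr fun ε => (beurlingBarTrunc_eq f z ε).symm

theorem ae_beurlingConverges {p : ℝ} (hp : 2 < p) {f : ℂ → ℂ} (hf : MemLpDisc p f) :
    ∀ᵐ z ∂discMeasure, BeurlingConverges f z := by
  obtain ⟨F, -, -, h1⟩ := exists_beurling hp hf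
  obtain ⟨G, -, -, h2⟩ := exists_beurling hp hf.conj
  filter_upwards [discMeasure_ac h1, discMeasure_ac h2] with z hz1 hz2
  exact ⟨⟨_, hz1⟩, ⟨_, tendsto_beurlingBarTrunc hz2⟩⟩

/-- The Beurling operators are bounded on `L^p(Ω)`. -/
theorem exists_isBeurlingConst {p : ℝ} (hp : 2 < p) : ∃ B, IsBeurlingConst p B := by
  obtain ⟨C, hC⟩ := exists_lintegral_rpow_beurling_le (s := p / 2) (by linarith)
  have h2 : 2 * (p / 2) = p := by ring
  rw [h2] at hC
  have hp0 : 0 < p := by linarith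
  have hpR : (ENNReal.ofReal p).toReal = p := ENNReal.toReal_ofReal hp0.le
  have main : ∀ f, MemLpDisc p f → lpDisc p (beurling f) ≤ (C ^ (1 / p) : ℝ≥0) * lpDisc p f := by
    intro f hf
    obtain ⟨F, hF, hpair, hlim⟩ := exists_beurling hp hf
    have h1 := hC _ F (memLp_two_indicator_disc hp hf) hF hpair
    have h3 : lpDisc p (beurling f) = eLpNorm F (ENNReal.ofReal p) discMeasure := by
      refine eLpNorm_congr_ae ?_
      filter_upwards [discMeasure_ac hlim] with z hz using hz.limUnder_eq
    have h4 : lpDisc p f = eLpNorm (disc.indicator f) (ENNReal.ofReal p) volume :=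
      (eLpNorm_indicator_eq_eLpNorm_restrict measurableSet_disc).symm
    rw [h3, h4]
    refine (eLpNorm_mono_measure F Measure.restrict_le_self).trans ?_
    rw [eLpNorm_eq_lintegral_rpow_enorm_toReal (ofReal_p_ne_zero hp) ENNReal.ofReal_ne_top,
      eLpNorm_eq_lintegral_rpow_enorm_toReal (ofReal_p_ne_zero hp) ENNReal.ofReal_ne_top, hpR,
      ENNReal.coe_rpow_of_nonneg _ (by positivity), ← ENNReal.mul_rpow_of_nonneg _ _ (by positivity)]
    gcongr
  refine ⟨C ^ (1 / p), fun f hf => ⟨main f hf, ?_⟩⟩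
  obtain ⟨G, -, -, hlim⟩ := exists_beurling hp hf.conj
  have h1 : lpDisc p (beurlingBar f) = lpDisc p (beurling fun w => conj (f w)) := by
    refine eLpNorm_congr_norm_ae ?_
    filter_upwards [discMeasure_ac hlim] with z hz
    have e1 : beurlingBar f z = conj (G z) := (tendsto_beurlingBarTrunc hz).limUnder_eq
    have e2 : beurling (fun w => conj (f w)) z = G z := hz.limUnder_eq
    rw [e1, e2, RCLike.norm_conj]
  rw [h1, ← lpDisc_conj p f]
  exact main _ hf.conj

end Bukhgeim

/-! ### The Cauchy operators on the disc -/

namespace Bukhgeim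

lemma cauchyBar_eq (f : ℂ → ℂ) (z : ℂ) : cauchyBar f z = conj (cauchy (fun w => conj (f w)) z) := by
  unfold cauchyBar cauchy
  rw [map_mul, ← integral_conj]
  simp

lemma holderNorm_le {α : ℝ} {f : ℂ → ℂ} {M₁ M₂ : ℝ≥0∞} (h1 : ∀ z ∈ closedDisc, ‖f z‖ₑ ≤ M₁)
    (h2 : ∀ z ∈ closedDisc, ∀ w ∈ closedDisc, z ≠ w →
      ‖f z - f w‖ₑ ≤ M₂ * ENNReal.ofReal (‖z - w‖ ^ α)) :
    holderNorm α f ≤ M₁ + M₂ := by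
  unfold holderNorm
  gcongr
  · exact iSup₂_le h1
  · refine iSup₂_le fun z hz => iSup₂_le fun w hw => iSup_le fun hzw => ?_
    have : 0 < ‖z - w‖ ^ α := Real.rpow_pos_of_pos (norm_pos_iff.2 (sub_ne_zero.2 hzw)) _
    rw [ENNReal.div_le_iff (by simpa using this) ENNReal.ofReal_ne_top]
    exact h2 z hz w hw hzw

lemma enorm_le_holderNorm {α : ℝ} {f : ℂ → ℂ} {z : ℂ} (hz : z ∈ closedDisc) :
    ‖f z‖ₑ ≤ holderNorm α f :=
  (le_iSup₂ (f := fun z (_ : z ∈ closedDisc) => ‖f z‖ₑ) z hz).trans le_self_add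

lemma enorm_sub_le_holderNorm {α : ℝ} {f : ℂ → ℂ} {z w : ℂ} (hz : z ∈ closedDisc)
    (hw : w ∈ closedDisc) (hzw : z ≠ w) :
    ‖f z - f w‖ₑ ≤ holderNorm α f * ENNReal.ofReal (‖z - w‖ ^ α) := by
  have : 0 < ‖z - w‖ ^ α := Real.rpow_pos_of_pos (norm_pos_iff.2 (sub_ne_zero.2 hzw)) _
  rw [← ENNReal.div_le_iff (by simpa using this) ENNReal.ofReal_ne_top]
  refine le_trans ?_ (le_add_self : _ ≤ holderNorm α f)
  refine le_iSup₂_of_le z hz ?_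
  refine le_iSup₂_of_le w hw ?_
  exact le_iSup_of_le hzw le_rfl

lemma holderNorm_conj (α : ℝ) (f : ℂ → ℂ) : holderNorm α (fun z => conj (f z)) = holderNorm α f := by
  have e1 : ∀ z : ℂ, ‖conj z‖ₑ = ‖z‖ₑ := fun z => by
    rw [← ofReal_norm, ← ofReal_norm, RCLike.norm_conj]
  unfold holderNorm
  simp only [← map_sub, e1]

lemma holderNorm_add_le (α : ℝ) (f g : ℂ → ℂ) :
    holderNorm α (fun z => f z + g z) ≤ holderNorm α f + holderNorm α g := by
  have key : holderNorm α (fun z => f z + g z) ≤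
      ((⨆ z ∈ closedDisc, ‖f z‖ₑ) + ⨆ z ∈ closedDisc, ‖g z‖ₑ) +
      ((⨆ z ∈ closedDisc, ⨆ w ∈ closedDisc, ⨆ _ : z ≠ w,
        ‖f z - f w‖ₑ / ENNReal.ofReal (‖z - w‖ ^ α)) +
      ⨆ z ∈ closedDisc, ⨆ w ∈ closedDisc, ⨆ _ : z ≠ w,
        ‖g z - g w‖ₑ / ENNReal.ofReal (‖z - w‖ ^ α)) := by
    unfold holderNorm
    gcongr
    · refine iSup₂_le fun z hz => (enorm_add_le _ _).trans (add_le_add ?_ ?_)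
      · exact le_iSup₂ (f := fun z (_ : z ∈ closedDisc) => ‖f z‖ₑ) z hz
      · exact le_iSup₂ (f := fun z (_ : z ∈ closedDisc) => ‖g z‖ₑ) z hz
    · refine iSup₂_le fun z hz => iSup₂_le fun w hw => iSup_le fun hzw => ?_
      have e : f z + g z - (f w + g w) = (f z - f w) + (g z - g w) := by ring
      rw [e]
      refine (ENNReal.div_le_div_right (enorm_add_le _ _) _).trans ?_
      rw [ENNReal.add_div]
      gcongr
      · exact le_iSup₂_of_le z hz (le_iSup₂_of_le w hw (le_iSup_of_le hzw le_rfl))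
      · exact le_iSup₂_of_le z hz (le_iSup₂_of_le w hw (le_iSup_of_le hzw le_rfl))
  refine key.trans_eq ?_
  unfold holderNorm
  ring

lemma holderNorm_const_mul_le (α : ℝ) (c : ℂ) (f : ℂ → ℂ) :
    holderNorm α (fun z => c * f z) ≤ ‖c‖ₑ * holderNorm α f := by
  have key : holderNorm α (fun z => c * f z) ≤ ‖c‖ₑ * (⨆ z ∈ closedDisc, ‖f z‖ₑ) + ‖c‖ₑ *
      ⨆ z ∈ closedDisc, ⨆ w ∈ closedDisc, ⨆ _ : z ≠ w,
        ‖f z - f w‖ₑ / ENNReal.ofReal (‖z - w‖ ^ α) := by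
    unfold holderNorm
    gcongr
    · refine iSup₂_le fun z hz => ?_
      rw [enorm_mul]
      gcongr
      exact le_iSup₂ (f := fun z (_ : z ∈ closedDisc) => ‖f z‖ₑ) z hz
    · refine iSup₂_le fun z hz => iSup₂_le fun w hw => iSup_le fun hzw => ?_
      rw [← mul_sub, enorm_mul, mul_div_assoc]
      gcongr
      exact le_iSup₂_of_le z hz (le_iSup₂_of_le w hw (le_iSup_of_le hzw le_rfl))
  refine key.trans_eq ?_
  rw [← mul_add]; rfl

lemma continuousOn_of_holderNorm {α : ℝ} (hα : 0 < α) {f : ℂ → ℂ} (hf : holderNorm α f < ∞) :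
    ContinuousOn f closedDisc := by
  have : HolderOnWith (holderNorm α f).toNNReal (Real.toNNReal α) f closedDisc := by
    intro z hz w hw
    rw [ENNReal.coe_toNNReal hf.ne, Real.coe_toNNReal _ hα.le, edist_eq_enorm_sub, edist_eq_enorm_sub]
    rcases eq_or_ne z w with rfl | hzw
    · simp
    · have := enorm_sub_le_holderNorm (α := α) (f := f) hz hw hzw
      rwa [← ENNReal.ofReal_rpow_of_nonneg (norm_nonneg _) hα.le, ofReal_norm] at this
  exact this.continuousOn (by simpa using hα)

lemma disc_subset_closedDisc : disc ⊆ closedDisc := Metric.ball_subset_closedBall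

lemma norm_le_one_of_mem {z : ℂ} (hz : z ∈ closedDisc) : ‖z‖ ≤ 1 := by
  simpa [closedDisc] using hz

/-- Hölder's inequality against a kernel. -/
lemma lintegral_enorm_mul_le {p q : ℝ} (hpq : p.HolderConjugate q) {f : ℂ → ℂ} (hf : MemLpDisc p f)
    {k : ℂ → ℝ≥0∞} (hk : Measurable k) :
    ∫⁻ ξ, ‖f ξ‖ₑ * k ξ ∂discMeasure ≤ lpDisc p f * (∫⁻ ξ, k ξ ^ q ∂discMeasure) ^ (1 / q) := by
  have h := ENNReal.lintegral_mul_le_Lp_mul_Lq discMeasure hpq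
    hf.aestronglyMeasurable.enorm hk.aemeasurable
  have e : lpDisc p f = (∫⁻ ξ, ‖f ξ‖ₑ ^ p ∂discMeasure) ^ (1 / p) := by
    have hp0 : 0 < p := hpq.pos
    rw [lpDisc, eLpNorm_eq_lintegral_rpow_enorm_toReal (by simpa using hp0) ENNReal.ofReal_ne_top,
      ENNReal.toReal_ofReal hp0.le]
  rw [e]
  exact h

/-- Translation: for `z` in the closed disc, `z - ξ` stays in the disc of radius `2`. -/
lemma lintegral_disc_comp_sub_le {z : ℂ} (hz : z ∈ closedDisc) (g : ℂ → ℝ≥0∞) :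
    ∫⁻ ξ, g (z - ξ) ∂discMeasure ≤ ∫⁻ w in Metric.ball (0 : ℂ) 2, g w := by
  have h1 : ∫⁻ ξ, g (z - ξ) ∂discMeasure ≤ ∫⁻ ξ, (Metric.ball (0 : ℂ) 2).indicator g (z - ξ) := by
    rw [discMeasure, ← lintegral_indicator measurableSet_disc]
    refine lintegral_mono fun ξ => ?_
    by_cases hξ : ξ ∈ disc
    · have hm : z - ξ ∈ Metric.ball (0 : ℂ) 2 := by
        rw [mem_ball_zero_iff]
        have h1 := norm_le_one_of_mem hz
        have h2 : ‖ξ‖ < 1 := by simpa [disc] using hξ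
        linarith [norm_sub_le z ξ]
      rw [Set.indicator_of_mem hξ, Set.indicator_of_mem hm]
    · rw [Set.indicator_of_notMem hξ]; exact zero_le
  refine h1.trans_eq ?_
  rw [lintegral_sub_left_eq_self (μ := (volume : Measure ℂ))
    (fun w => (Metric.ball (0 : ℂ) 2).indicator g w) z, lintegral_indicator measurableSet_ball]

lemma enorm_rpow_eq (w : ℂ) {q : ℝ} (hq : 0 ≤ q) :
    ‖w⁻¹‖ₑ ^ q = ENNReal.ofReal (‖w‖ ^ (-q)) := by
  rw [← ofReal_norm, ENNReal.ofReal_rpow_of_nonneg (norm_nonneg _) hq, norm_inv,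
    Real.inv_rpow (norm_nonneg _), Real.rpow_neg (norm_nonneg _)]

/-- The `L^q` norm (to the power `q`) of the Cauchy kernel on the disc of radius `2`. -/
def kernelConst (q : ℝ) : ℝ≥0∞ := ∫⁻ w in Metric.ball (0 : ℂ) 2, ‖w⁻¹‖ₑ ^ q

lemma kernelConst_lt_top {q : ℝ} (hq0 : 0 ≤ q) (hq : q < 2) : kernelConst q < ∞ := by
  unfold kernelConst
  simp only [enorm_rpow_eq _ hq0]
  exact (integrableOn_ball_rpow_norm hq 2).lintegral_lt_top

lemma holderConjugate_of_two_lt {p : ℝ} (hp : 2 < p) : p.HolderConjugate (p / (p - 1)) :=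
  Real.HolderConjugate.conjExponent (by linarith)

lemma conjExponent_bounds {p : ℝ} (hp : 2 < p) : 1 < p / (p - 1) ∧ p / (p - 1) < 2 := by
  have : 0 < p - 1 := by linarith
  constructor
  · rw [lt_div_iff₀ this]; linarith
  · rw [div_lt_iff₀ this]; linarith

lemma measurable_kernel (z : ℂ) : Measurable fun ξ : ℂ => ‖(z - ξ)⁻¹‖ₑ := by fun_prop

lemma lintegral_enorm_cauchy_le {p : ℝ} (hp : 2 < p) {f : ℂ → ℂ} (hf : MemLpDisc p f) {z : ℂ}
    (hz : z ∈ closedDisc) :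
    ∫⁻ ξ, ‖f ξ‖ₑ * ‖(z - ξ)⁻¹‖ₑ ∂discMeasure ≤
      lpDisc p f * kernelConst (p / (p - 1)) ^ (1 / (p / (p - 1))) := by
  refine (lintegral_enorm_mul_le (holderConjugate_of_two_lt hp) hf (measurable_kernel z)).trans ?_
  have := (conjExponent_bounds hp).1
  gcongr
  exact lintegral_disc_comp_sub_le hz fun w => ‖w⁻¹‖ₑ ^ (p / (p - 1))

lemma integrable_cauchy {p : ℝ} (hp : 2 < p) {f : ℂ → ℂ} (hf : MemLpDisc p f) {z : ℂ}
    (hz : z ∈ closedDisc) : Integrable (fun ξ => f ξ / (z - ξ)) discMeasure := by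
  refine ⟨?_, ?_⟩
  · simp only [div_eq_mul_inv]
    exact hf.aestronglyMeasurable.mul (by fun_prop)
  · rw [hasFiniteIntegral_iff_enorm]
    simp only [div_eq_mul_inv, enorm_mul]
    refine (lintegral_enorm_cauchy_le hp hf hz).trans_lt ?_
    have hq := conjExponent_bounds hp
    have := kernelConst_lt_top (by linarith) hq.2
    exact ENNReal.mul_lt_top hf.eLpNorm_lt_top
      (ENNReal.rpow_lt_top_of_nonneg (by have := hq.1; positivity) this.ne)

theorem cauchyConverges {p : ℝ} (hp : 2 < p) {f : ℂ → ℂ} (hf : MemLpDisc p f) {z : ℂ}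
    (hz : z ∈ closedDisc) : CauchyConverges f z := by
  refine ⟨integrable_cauchy hp hf hz, ?_⟩
  have h := integrable_cauchy hp hf.conj hz
  have h2 := (Complex.conjCLE : ℂ →L[ℝ] ℂ).integrable_comp h
  refine h2.congr (ae_of_all _ fun ξ => ?_)
  simp

lemma cauchy_add {p : ℝ} (hp : 2 < p) {f g : ℂ → ℂ} (hf : MemLpDisc p f) (hg : MemLpDisc p g) {z : ℂ}
    (hz : z ∈ closedDisc) : cauchy (fun w => f w + g w) z = cauchy f z + cauchy g z := by
  unfold cauchy
  simp only [add_div]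
  rw [integral_add (integrable_cauchy hp hf hz) (integrable_cauchy hp hg hz)]
  ring

lemma cauchy_const_mul (c : ℂ) (f : ℂ → ℂ) (z : ℂ) : cauchy (fun w => c * f w) z = c * cauchy f z := by
  unfold cauchy
  simp only [mul_div_assoc]
  rw [integral_const_mul]
  ring

lemma enorm_one_div_pi_le : ‖(1 / (Real.pi : ℂ))‖ₑ ≤ 1 := by
  rw [← ofReal_norm, ← ENNReal.ofReal_one]
  apply ENNReal.ofReal_le_ofReal
  rw [norm_div, norm_one, Complex.norm_real, Real.norm_of_nonneg Real.pi_pos.le,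
    div_le_one Real.pi_pos]
  linarith [Real.pi_gt_three]

/-- A majorant, depending only on the distance `y = ‖ξ - z‖`, for the kernel of the difference of two
Cauchy integrals at points at distance `D`. -/
def diffKernel (q D y : ℝ) : ℝ := y ^ (-q) * (max y (D / 2)) ^ (-q)

lemma diffKernel_nonneg (q D : ℝ) {y : ℝ} (hy : 0 ≤ y) : 0 ≤ diffKernel q D y :=
  mul_nonneg (Real.rpow_nonneg hy _) (Real.rpow_nonneg (hy.trans (le_max_left _ _)) _)

lemma diffKernel_le {q : ℝ} (hq : 0 < q) {a b D : ℝ} (ha : 0 < a) (hb : 0 < b) (hD : D ≤ a + b) :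
    (a * b) ^ (-q) ≤ diffKernel q D a + diffKernel q D b := by
  have key : ∀ a b : ℝ, 0 < a → 0 < b → D ≤ a + b → a ≤ b → (a * b) ^ (-q) ≤ diffKernel q D a := by
    intro a b ha hb hD hab
    rw [Real.mul_rpow ha.le hb.le, diffKernel]
    refine mul_le_mul_of_nonneg_left ?_ (Real.rpow_nonneg ha.le _)
    apply Real.rpow_le_rpow_of_nonpos (lt_max_of_lt_left ha) _ (by linarith)
    exact max_le hab (by linarith)
  rcases le_total a b with h | h
  · exact (key a b ha hb hD h).trans (le_add_of_nonneg_right (diffKernel_nonneg q D hb.le))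
  · rw [mul_comm]
    exact (key b a hb ha (by linarith) h).trans
      (le_add_of_nonneg_left (diffKernel_nonneg q D ha.le))

lemma measurable_diffKernel (q D : ℝ) : Measurable (diffKernel q D) := by
  unfold diffKernel; fun_prop

lemma integrable_diffKernel_one {q : ℝ} (hq1 : 1 < q) (hq : q < 2) :
    Integrable fun w : ℂ => diffKernel q 1 ‖w‖ := by
  have hm : AEStronglyMeasurable (fun w : ℂ => diffKernel q 1 ‖w‖) :=
    ((measurable_diffKernel q 1).comp measurable_norm).aestronglyMeasurable
  have h1 : IntegrableOn (fun w : ℂ => diffKernel q 1 ‖w‖) (Metric.ball 0 1) := by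
    refine ((integrableOn_ball_rpow_norm hq 1).const_mul ((1 / 2 : ℝ) ^ (-q))).mono' hm.restrict
      (ae_of_all _ fun w => ?_)
    rw [Real.norm_of_nonneg (diffKernel_nonneg q 1 (norm_nonneg w)), diffKernel, mul_comm]
    refine mul_le_mul_of_nonneg_right ?_ (Real.rpow_nonneg (norm_nonneg w) _)
    exact Real.rpow_le_rpow_of_nonpos (by norm_num) (le_max_right _ _) (by linarith)
  have h2 : IntegrableOn (fun w : ℂ => diffKernel q 1 ‖w‖) (Metric.ball 0 1)ᶜ := by
    have hb : Integrable (fun w : ℂ => (1 + ‖w‖) ^ (-(2 * q))) :=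
      integrable_one_add_norm (by simp; linarith)
    refine ((hb.const_mul ((2 : ℝ) ^ (2 * q))).integrableOn).mono' hm.restrict ?_
    filter_upwards [ae_restrict_mem measurableSet_ball.compl] with w hw
    have hw1 : 1 ≤ ‖w‖ := by simpa using hw
    rw [Real.norm_of_nonneg (diffKernel_nonneg q 1 (norm_nonneg w)), diffKernel,
      max_eq_left (by linarith), ← Real.rpow_add (by linarith)]
    have e : (2 : ℝ) ^ (2 * q) * (1 + ‖w‖) ^ (-(2 * q)) = ((1 + ‖w‖) / 2) ^ (-(2 * q)) := by
      rw [Real.div_rpow (by positivity) (by norm_num), Real.rpow_neg (by norm_num : (0 : ℝ) ≤ 2),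
        div_inv_eq_mul, mul_comm]
    rw [e, show -q + -q = -(2 * q) by ring]
    exact Real.rpow_le_rpow_of_nonpos (by positivity) (by linarith) (by linarith)
  have := h1.union h2
  rwa [Set.union_compl_self, integrableOn_univ] at this

lemma lintegral_diffKernel {q : ℝ} (hq1 : 1 < q) (hq : q < 2) {D : ℝ} (hD : 0 < D) (z : ℂ) :
    ∫⁻ ξ, ENNReal.ofReal (diffKernel q D ‖ξ - z‖) =
      ENNReal.ofReal (D ^ (2 - 2 * q) * ∫ w : ℂ, diffKernel q 1 ‖w‖) := by
  rw [lintegral_sub_right_eq_self (μ := (volume : Measure ℂ))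
    (fun w => ENNReal.ofReal (diffKernel q D ‖w‖)) z]
  have hscale : ∀ w : ℂ, diffKernel q D ‖w‖ = D ^ (-(2 * q)) * diffKernel q 1 ‖D⁻¹ • w‖ := by
    intro w
    have h1 : ‖w‖ = D * ‖D⁻¹ • w‖ := by
      rw [norm_smul, norm_inv, Real.norm_of_nonneg hD.le, mul_inv_cancel_left₀ hD.ne']
    have h2 : D / 2 = D * (1 / 2) := by ring
    unfold diffKernel
    rw [h1, h2, ← mul_max_of_nonneg _ _ hD.le, Real.mul_rpow hD.le (norm_nonneg _),
      Real.mul_rpow hD.le (le_max_of_le_left (norm_nonneg _)), show -(2 * q) = -q + -q by ring,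
      Real.rpow_add hD]
    simp only [norm_smul]
    ring
  have hint : Integrable fun w : ℂ => diffKernel q 1 ‖D⁻¹ • w‖ :=
    (integrable_diffKernel_one hq1 hq).comp_smul (inv_ne_zero hD.ne')
  simp only [hscale]
  rw [← ofReal_integral_eq_lintegral_ofReal (hint.const_mul _) (ae_of_all _ fun w =>
    mul_nonneg (Real.rpow_nonneg hD.le _) (diffKernel_nonneg q 1 (norm_nonneg _)))]
  congr 1
  rw [integral_const_mul, Measure.integral_comp_smul volume (fun w : ℂ => diffKernel q 1 ‖w‖) D⁻¹]
  rw [← smul_eq_mul (a := D ^ (-(2 * q))), ← smul_eq_mul (a := D ^ (2 - 2 * q)), smul_smul]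
  congr 1
  rw [Complex.finrank_real_complex, inv_pow, inv_inv, abs_of_pos (by positivity),
    ← Real.rpow_natCast, ← Real.rpow_add hD]
  congr 1; push_cast; ring

/-- The Cauchy operators map `L^p(Ω)` boundedly to `C^{1 - 2/p}`. -/
theorem exists_isCauchyConst {p : ℝ} (hp : 2 < p) : ∃ A, IsCauchyConst p A := by
  set q := p / (p - 1) with hq
  obtain ⟨hq1, hq2⟩ := conjExponent_bounds hp
  rw [← hq] at hq1 hq2
  have hpq := holderConjugate_of_two_lt hp
  rw [← hq] at hpq
  have hq0 : 0 < q := by linarith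
  set M₁ := kernelConst q ^ (1 / q) with hM₁
  set K := ∫ w : ℂ, diffKernel q 1 ‖w‖
  have hK : 0 ≤ K := integral_nonneg fun w => diffKernel_nonneg q 1 (norm_nonneg w)
  set M₂ := ENNReal.ofReal ((2 * K) ^ (1 / q)) with hM₂
  have hMtop : M₁ + M₂ ≠ ∞ := by
    refine ENNReal.add_ne_top.2 ⟨?_, ENNReal.ofReal_ne_top⟩
    exact ENNReal.rpow_ne_top_of_nonneg (by positivity) (kernelConst_lt_top hq0.le hq2).ne
  have main : ∀ f, MemLpDisc p f → holderNorm (1 - 2 / p) (cauchy f) ≤ (M₁ + M₂) * lpDisc p f := by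
    intro f hf
    rw [add_mul]
    refine holderNorm_le (fun z hz => ?_) fun z hz w hw hzw => ?_
    · unfold cauchy
      rw [enorm_mul]
      calc _ ≤ 1 * ∫⁻ ξ, ‖f ξ / (z - ξ)‖ₑ ∂discMeasure := by
            gcongr
            · exact enorm_one_div_pi_le
            · exact enorm_integral_le_lintegral_enorm _
        _ = ∫⁻ ξ, ‖f ξ‖ₑ * ‖(z - ξ)⁻¹‖ₑ ∂discMeasure := by
            rw [one_mul]; simp only [div_eq_mul_inv, enorm_mul]
        _ ≤ lpDisc p f * M₁ := lintegral_enorm_cauchy_le hp hf hz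
        _ = _ := mul_comm _ _
    · set D := ‖z - w‖ with hDdef
      have hD : 0 < D := norm_pos_iff.2 (sub_ne_zero.2 hzw)
      set k : ℂ → ℝ≥0∞ := fun ξ => ‖((z - ξ) * (w - ξ))⁻¹‖ₑ with hk
      have hkm : Measurable k := by rw [hk]; fun_prop
      have hae : ∀ᵐ ξ ∂discMeasure, ξ ≠ z ∧ ξ ≠ w := by
        apply discMeasure_ac
        have h1 : ∀ᵐ ξ : ℂ, ξ ≠ z := by simp [ae_iff, measure_singleton]
        have h2 : ∀ᵐ ξ : ℂ, ξ ≠ w := by simp [ae_iff, measure_singleton]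
        filter_upwards [h1, h2] with ξ a b using ⟨a, b⟩
      -- `1 / (z - ξ) - 1 / (w - ξ) = (w - z) / ((z - ξ) (w - ξ))`
      have hdiff : cauchy f z - cauchy f w =
          (1 / (Real.pi : ℂ)) * ∫ ξ, f ξ * ((w - z) * ((z - ξ) * (w - ξ))⁻¹) ∂discMeasure := by
        unfold cauchy
        rw [← mul_sub, ← integral_sub (integrable_cauchy hp hf hz) (integrable_cauchy hp hf hw)]
        congr 1
        refine integral_congr_ae ?_
        filter_upwards [hae] with ξ hξ
        have h1 : z - ξ ≠ 0 := sub_ne_zero.2 hξ.1.symm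
        have h2 : w - ξ ≠ 0 := sub_ne_zero.2 hξ.2.symm
        field_simp
        ring
      have hkq : ∫⁻ ξ, k ξ ^ q ∂discMeasure ≤ ENNReal.ofReal (2 * K * D ^ (2 - 2 * q)) := by
        calc _ ≤ ∫⁻ ξ, (ENNReal.ofReal (diffKernel q D ‖ξ - z‖) +
              ENNReal.ofReal (diffKernel q D ‖ξ - w‖)) ∂discMeasure := by
              refine lintegral_mono_ae ?_
              filter_upwards [hae] with ξ hξ
              have h1 : 0 < ‖ξ - z‖ := norm_pos_iff.2 (sub_ne_zero.2 hξ.1)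
              have h2 : 0 < ‖ξ - w‖ := norm_pos_iff.2 (sub_ne_zero.2 hξ.2)
              simp only [hk]
              rw [enorm_rpow_eq _ hq0.le, norm_mul, norm_sub_rev z ξ, norm_sub_rev w ξ,
                ← ENNReal.ofReal_add (diffKernel_nonneg _ _ h1.le) (diffKernel_nonneg _ _ h2.le)]
              apply ENNReal.ofReal_le_ofReal
              apply diffKernel_le hq0 h1 h2
              rw [hDdef]
              have := norm_sub_le (ξ - w) (ξ - z)
              rw [sub_sub_sub_cancel_left] at this
              linarith
          _ ≤ ∫⁻ ξ, (ENNReal.ofReal (diffKernel q D ‖ξ - z‖) +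
              ENNReal.ofReal (diffKernel q D ‖ξ - w‖)) :=
              lintegral_mono' Measure.restrict_le_self le_rfl
          _ = _ := by
              have hm : Measurable fun ξ : ℂ => ENNReal.ofReal (diffKernel q D ‖ξ - z‖) :=
                ((measurable_diffKernel q D).comp (by fun_prop)).ennreal_ofReal
              rw [lintegral_add_left hm, lintegral_diffKernel hq1 hq2 hD,
                lintegral_diffKernel hq1 hq2 hD, ← ENNReal.ofReal_add (by positivity) (by positivity)]
              congr 1; ring
      rw [hdiff, enorm_mul]
      calc _ ≤ 1 * ∫⁻ ξ, ‖f ξ * ((w - z) * ((z - ξ) * (w - ξ))⁻¹)‖ₑ ∂discMeasure := by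
            gcongr
            · exact enorm_one_div_pi_le
            · exact enorm_integral_le_lintegral_enorm _
        _ = ‖w - z‖ₑ * ∫⁻ ξ, ‖f ξ‖ₑ * k ξ ∂discMeasure := by
            rw [one_mul, ← lintegral_const_mul' _ _ (by simp)]
            refine lintegral_congr fun ξ => ?_
            rw [enorm_mul, enorm_mul, hk]; ring
        _ ≤ ENNReal.ofReal D * (lpDisc p f * (ENNReal.ofReal (2 * K * D ^ (2 - 2 * q))) ^ (1 / q)) := by
            rw [← ofReal_norm, norm_sub_rev]
            gcongr
            exact (lintegral_enorm_mul_le hpq hf hkm).trans (by gcongr)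
        _ = M₂ * lpDisc p f * ENNReal.ofReal (D ^ (1 - 2 / p)) := by
            rw [ENNReal.ofReal_rpow_of_nonneg (by positivity) (by positivity),
              Real.mul_rpow (by positivity) (by positivity),
              ENNReal.ofReal_mul (by positivity), ← hM₂]
            have e1 : D ^ (1 - 2 / p) = D * (D ^ (2 - 2 * q)) ^ (1 / q) := by
              rw [← Real.rpow_mul hD.le]
              nth_rewrite 2 [← Real.rpow_one D]
              rw [← Real.rpow_add hD]
              congr 1
              rw [hq]
              have : p ≠ 0 := by linarith
              have : p - 1 ≠ 0 := by linarith
              field_simp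
              ring
            rw [e1, ENNReal.ofReal_mul hD.le]
            ring
  refine ⟨(M₁ + M₂).toNNReal, fun f hf => ?_⟩
  rw [ENNReal.coe_toNNReal hMtop]
  refine ⟨main f hf, ?_⟩
  have h1 : cauchyBar f = fun z => conj (cauchy (fun w => conj (f w)) z) :=
    funext fun z => cauchyBar_eq f z
  rw [h1, holderNorm_conj, ← lpDisc_conj p f]
  exact main _ hf.conj

end Bukhgeim

/-! ### The regularized kernel and the cutoff function -/

namespace Bukhgeim

/-- The smooth regularization `w / (|w|² + δ²)` of `1 / w̄`. -/
def regKernel (δ : ℝ) (w : ℂ) : ℂ := w / ((‖w‖ ^ 2 + δ ^ 2 : ℝ) : ℂ)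

/-- The derivative `∂` of `regKernel`. -/
def regKernelD (δ : ℝ) (w : ℂ) : ℂ := ((δ ^ 2 / (‖w‖ ^ 2 + δ ^ 2) ^ 2 : ℝ) : ℂ)

/-- The derivative `∂̄` of `regKernel`. -/
def regKernelDbar (δ : ℝ) (w : ℂ) : ℂ := -w ^ 2 / ((‖w‖ ^ 2 + δ ^ 2 : ℝ) : ℂ) ^ 2

section regKernel

variable {δ : ℝ}

lemma sq_add_sq_pos (hδ : 0 < δ) (w : ℂ) : 0 < ‖w‖ ^ 2 + δ ^ 2 := by positivity

lemma mul_conj_add_eq (δ : ℝ) (w : ℂ) :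
    w * conj w + (δ : ℂ) ^ 2 = ((‖w‖ ^ 2 + δ ^ 2 : ℝ) : ℂ) := by
  rw [Complex.mul_conj, Complex.normSq_eq_norm_sq]; push_cast; ring

lemma hasFDerivAt_regKernel (hδ : 0 < δ) (w : ℂ) :
    HasFDerivAt (regKernel δ) (wirt (regKernelD δ w) (regKernelDbar δ w)) w := by
  have hne : w * conj w + (δ : ℂ) ^ 2 ≠ 0 := by
    rw [mul_conj_add_eq]; exact_mod_cast (sq_add_sq_pos hδ w).ne'
  have h1 := hasFDerivAt_wirt_add (hasFDerivAt_wirt_mul (hasFDerivAt_wirt_id w)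
    (hasFDerivAt_wirt_conj w)) (hasFDerivAt_wirt_const ((δ : ℂ) ^ 2) w)
  have h2 := hasFDerivAt_wirt_mul (hasFDerivAt_wirt_id w)
    (hasFDerivAt_wirt_comp (u := fun w => w * conj w + (δ : ℂ) ^ 2) (hasDerivAt_inv hne) h1)
  have e0 : regKernel δ = fun w => w * (w * conj w + (δ : ℂ) ^ 2)⁻¹ := by
    funext w
    rw [mul_conj_add_eq, regKernel, div_eq_mul_inv]
  rw [e0]
  convert h2 using 2
  · rw [regKernelD]
    push_cast
    have := mul_conj_add_eq δ w
    push_cast at this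
    rw [← this]
    field_simp
    ring
  · rw [regKernelDbar, ← mul_conj_add_eq]
    field_simp
    ring

lemma continuous_regKernel (hδ : 0 < δ) : Continuous (regKernel δ) :=
  continuous_iff_continuousAt.2 fun w => (hasFDerivAt_regKernel hδ w).continuousAt

lemma continuous_regKernelD (hδ : 0 < δ) : Continuous (regKernelD δ) := by
  unfold regKernelD
  refine Complex.continuous_ofReal.comp (Continuous.div (by fun_prop) (by fun_prop) fun w => ?_)
  have := sq_add_sq_pos hδ w
  positivity

lemma continuous_regKernelDbar (hδ : 0 < δ) : Continuous (regKernelDbar δ) := by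
  unfold regKernelDbar
  refine Continuous.div (by fun_prop) (by fun_prop) fun w => ?_
  have := (sq_add_sq_pos hδ w).ne'
  exact pow_ne_zero 2 (by exact_mod_cast this)

lemma norm_regKernel (hδ : 0 < δ) (w : ℂ) : ‖regKernel δ w‖ = ‖w‖ / (‖w‖ ^ 2 + δ ^ 2) := by
  rw [regKernel, norm_div, Complex.norm_real, Real.norm_of_nonneg (sq_add_sq_pos hδ w).le]

lemma norm_regKernel_le_inv (hδ : 0 < δ) (w : ℂ) : ‖regKernel δ w‖ ≤ ‖w⁻¹‖ := by
  rw [norm_regKernel hδ]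
  rcases eq_or_ne w 0 with rfl | hw
  · simp
  have : 0 < ‖w‖ := norm_pos_iff.2 hw
  rw [norm_inv, div_le_iff₀ (sq_add_sq_pos hδ w), inv_mul_eq_div, le_div_iff₀ this]
  nlinarith [sq_nonneg δ]

lemma norm_regKernel_le (hδ : 0 < δ) (w : ℂ) : ‖regKernel δ w‖ ≤ 1 / (2 * δ) := by
  rw [norm_regKernel hδ, div_le_div_iff₀ (sq_add_sq_pos hδ w) (by positivity)]
  nlinarith [sq_nonneg (‖w‖ - δ)]

lemma norm_mul_regKernel_le (hδ : 0 < δ) (w : ℂ) : ‖w‖ * ‖regKernel δ w‖ ≤ 1 := by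
  rw [norm_regKernel hδ, ← mul_div_assoc, div_le_one (sq_add_sq_pos hδ w)]
  nlinarith [sq_nonneg δ]

lemma norm_regKernelD_le_aux (hδ : 0 < δ) (w : ℂ) :
    ‖regKernelD δ w‖ ≤ 1 / (‖w‖ ^ 2 + δ ^ 2) ∧ ‖regKernelDbar δ w‖ ≤ 1 / (‖w‖ ^ 2 + δ ^ 2) := by
  have h := sq_add_sq_pos hδ w
  constructor
  · rw [regKernelD, Complex.norm_real, Real.norm_of_nonneg (by positivity),
      div_le_div_iff₀ (by positivity) h]
    nlinarith [mul_nonneg (sq_nonneg ‖w‖) h.le]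
  · rw [regKernelDbar, norm_div, norm_neg, norm_pow, norm_pow, Complex.norm_real,
      Real.norm_of_nonneg h.le, div_le_div_iff₀ (by positivity) h]
    nlinarith [mul_nonneg (sq_nonneg δ) h.le]

lemma norm_regKernelD_le (hδ : 0 < δ) (w : ℂ) :
    ‖regKernelD δ w‖ ≤ 1 / δ ^ 2 ∧ ‖regKernelDbar δ w‖ ≤ 1 / δ ^ 2 := by
  have h : 1 / (‖w‖ ^ 2 + δ ^ 2) ≤ 1 / δ ^ 2 :=
    one_div_le_one_div_of_le (by positivity) (by nlinarith [sq_nonneg ‖w‖])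
  exact ⟨(norm_regKernelD_le_aux hδ w).1.trans h, (norm_regKernelD_le_aux hδ w).2.trans h⟩

lemma norm_regKernelD_le_inv (hδ : 0 < δ) {w : ℂ} (hw : w ≠ 0) :
    ‖regKernelD δ w‖ ≤ 1 / (2 * δ) * ‖w⁻¹‖ ∧ ‖regKernelDbar δ w‖ ≤ 1 / (2 * δ) * ‖w⁻¹‖ := by
  have hw' : 0 < ‖w‖ := norm_pos_iff.2 hw
  have h : 1 / (‖w‖ ^ 2 + δ ^ 2) ≤ 1 / (2 * δ) * ‖w⁻¹‖ := by
    rw [norm_inv, one_div_mul_eq_div, ← one_div, div_div]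
    exact one_div_le_one_div_of_le (by positivity) (by nlinarith [sq_nonneg (‖w‖ - δ)])
  exact ⟨(norm_regKernelD_le_aux hδ w).1.trans h, (norm_regKernelD_le_aux hδ w).2.trans h⟩

/-- The difference between `1 / w̄` and its regularization. -/
lemma norm_inv_conj_sub_regKernel (hδ : 0 < δ) {w : ℂ} (hw : w ≠ 0) :
    ‖(conj w)⁻¹ - regKernel δ w‖ = δ ^ 2 / (‖w‖ * (‖w‖ ^ 2 + δ ^ 2)) := by
  have hc : conj w ≠ 0 := by simpa using hw
  have h := sq_add_sq_pos hδ w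
  have hd : ((‖w‖ ^ 2 + δ ^ 2 : ℝ) : ℂ) ≠ 0 := by exact_mod_cast h.ne'
  have e : (conj w)⁻¹ - regKernel δ w = (δ : ℂ) ^ 2 / (conj w * ((‖w‖ ^ 2 + δ ^ 2 : ℝ) : ℂ)) := by
    rw [regKernel]
    field_simp
    rw [← mul_conj_add_eq]; ring
  rw [e, norm_div, norm_mul, RCLike.norm_conj, Complex.norm_real, Real.norm_of_nonneg h.le, norm_pow,
    Complex.norm_real, Real.norm_of_nonneg hδ.le]

/-- `w̄` times the regularization of `1 / w̄` is close to `1`. -/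
lemma conj_mul_regKernel (hδ : 0 < δ) (w : ℂ) :
    conj w * regKernel δ w = ((1 - δ ^ 2 / (‖w‖ ^ 2 + δ ^ 2) : ℝ) : ℂ) := by
  have h := (sq_add_sq_pos hδ w).ne'
  have hd : ((‖w‖ ^ 2 + δ ^ 2 : ℝ) : ℂ) ≠ 0 := by exact_mod_cast h
  have e1 : 1 - δ ^ 2 / (‖w‖ ^ 2 + δ ^ 2) = ‖w‖ ^ 2 / (‖w‖ ^ 2 + δ ^ 2) := by
    field_simp; ring
  have e2 : w * conj w = ((‖w‖ ^ 2 : ℝ) : ℂ) := by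
    rw [Complex.mul_conj, Complex.normSq_eq_norm_sq]
  rw [regKernel, ← mul_div_assoc, mul_comm (conj w), e1, e2, ← Complex.ofReal_div]

end regKernel

/-- A profile vanishing for `t ≤ 0` and close to `1` for `t` much larger than `δ`. -/
def cut (δ t : ℝ) : ℝ := (max t 0) ^ 2 / ((max t 0) ^ 2 + δ ^ 2)

/-- The derivative of `cut`. -/
def cutDeriv (δ t : ℝ) : ℝ := 2 * max t 0 * δ ^ 2 / ((max t 0) ^ 2 + δ ^ 2) ^ 2

lemma hasDerivAt_max_sq (t : ℝ) : HasDerivAt (fun t : ℝ => (max t 0) ^ 2) (2 * max t 0) t := by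
  rcases lt_trichotomy t 0 with h | rfl | h
  · rw [max_eq_right h.le, mul_zero]
    refine (hasDerivAt_const t (0 : ℝ)).congr_of_eventuallyEq ?_
    filter_upwards [Iio_mem_nhds h] with x hx
    rw [max_eq_right (le_of_lt hx)]; simp
  · rw [max_self, mul_zero, hasDerivAt_iff_isLittleO]
    simp only [max_self, sub_zero, smul_zero, ne_eq, OfNat.ofNat_ne_zero, not_false_eq_true,
      zero_pow]
    refine Asymptotics.IsBigO.trans_isLittleO (g := fun x : ℝ => x ^ 2) ?_ ?_
    · refine Asymptotics.isBigO_of_le _ fun x => ?_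
      rw [norm_pow, norm_pow]
      gcongr
      rw [Real.norm_of_nonneg (le_max_right _ _), Real.norm_eq_abs]
      exact max_le (le_abs_self x) (abs_nonneg x)
    · exact Asymptotics.isLittleO_pow_id (by norm_num)
  · rw [max_eq_left h.le]
    have := hasDerivAt_pow 2 t
    simp only [Nat.cast_ofNat, Nat.add_one_sub_one, pow_one] at this
    refine this.congr_of_eventuallyEq ?_
    filter_upwards [Ioi_mem_nhds h] with x hx
    rw [max_eq_left (le_of_lt hx)]

lemma hasDerivAt_cut {δ : ℝ} (hδ : 0 < δ) (t : ℝ) : HasDerivAt (cut δ) (cutDeriv δ t) t := by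
  have h := hasDerivAt_max_sq t
  have := h.div (h.add_const (δ ^ 2)) (by positivity)
  refine this.congr_deriv ?_
  rw [cutDeriv]; congr 1; ring

lemma cut_nonneg (δ t : ℝ) : 0 ≤ cut δ t := by unfold cut; positivity

lemma cut_le_one {δ : ℝ} (hδ : 0 < δ) (t : ℝ) : cut δ t ≤ 1 := by
  unfold cut
  rw [div_le_one (by positivity)]
  nlinarith [sq_nonneg δ]

lemma one_sub_cut {δ : ℝ} (hδ : 0 < δ) {t : ℝ} (ht : 0 ≤ t) :
    1 - cut δ t = δ ^ 2 / (t ^ 2 + δ ^ 2) := by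
  unfold cut
  rw [max_eq_left ht]
  field_simp
  ring

lemma cutDeriv_nonneg (δ t : ℝ) : 0 ≤ cutDeriv δ t := by unfold cutDeriv; positivity

lemma cutDeriv_le {δ : ℝ} (hδ : 0 < δ) (t : ℝ) : cutDeriv δ t ≤ 1 / δ := by
  unfold cutDeriv
  set s := max t 0
  have hs : 0 ≤ s := le_max_right _ _
  rw [div_le_div_iff₀ (by positivity) hδ]
  have h1 : 2 * s * δ ≤ s ^ 2 + δ ^ 2 := by nlinarith [sq_nonneg (s - δ)]
  have h2 : δ ^ 2 ≤ s ^ 2 + δ ^ 2 := by nlinarith [sq_nonneg s]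
  calc 2 * s * δ ^ 2 * δ = (2 * s * δ) * δ ^ 2 := by ring
    _ ≤ (s ^ 2 + δ ^ 2) * (s ^ 2 + δ ^ 2) := by gcongr
    _ = _ := by ring

lemma cut_of_nonpos (δ : ℝ) {t : ℝ} (ht : t ≤ 0) : cut δ t = 0 := by simp [cut, max_eq_right ht]

lemma cutDeriv_of_nonpos (δ : ℝ) {t : ℝ} (ht : t ≤ 0) : cutDeriv δ t = 0 := by
  simp [cutDeriv, max_eq_right ht]

/-- The cutoff function of the disc: it vanishes outside, and is close to `1` at distance much larger
than `δ` from the boundary. -/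
def discCut (δ : ℝ) (z : ℂ) : ℂ := (cut δ (1 - ‖z‖ ^ 2) : ℂ)

lemma hasFDerivAt_discCut {δ : ℝ} (hδ : 0 < δ) (z : ℂ) :
    HasFDerivAt (discCut δ) (wirt (-(cutDeriv δ (1 - ‖z‖ ^ 2) : ℂ) * conj z)
      (-(cutDeriv δ (1 - ‖z‖ ^ 2) : ℂ) * z)) z := by
  have h1 : HasFDerivAt (fun z : ℂ => 1 - ‖z‖ ^ 2) (-(2 • (innerSL ℝ z))) z := by
    have := (hasStrictFDerivAt_norm_sq z).hasFDerivAt.const_sub 1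
    exact this
  have h2 := (hasDerivAt_cut hδ (1 - ‖z‖ ^ 2)).comp_hasFDerivAt z h1
  have h3 := (Complex.ofRealCLM.hasFDerivAt (x := cut δ (1 - ‖z‖ ^ 2))).comp z h2
  refine (h3.congr_fderiv ?_)
  ext w
  simp only [ContinuousLinearMap.comp_apply, wirt_apply, smul_apply,
    neg_apply, innerSL_apply_apply, Complex.ofRealCLM_apply, smul_eq_mul,
    Complex.inner, nsmul_eq_mul]
  apply Complex.ext <;> simp <;> ring

lemma norm_discCut_le {δ : ℝ} (hδ : 0 < δ) (z : ℂ) : ‖discCut δ z‖ ≤ 1 := by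
  rw [discCut, Complex.norm_real, Real.norm_of_nonneg (cut_nonneg _ _)]
  exact cut_le_one hδ _

/-! ### The phase factor -/

lemma phase_eq (z₀ z : ℂ) : phase z₀ z = ((2 * ((z - z₀) ^ 2).re : ℝ) : ℂ) := by
  unfold phase
  rw [← map_sub, ← map_pow, Complex.add_conj]

lemma norm_osc (n : ℝ) (z₀ z : ℂ) : ‖osc n z₀ z‖ = 1 := by
  rw [osc, phase_eq]
  have : Complex.I * n * ((2 * ((z - z₀) ^ 2).re : ℝ) : ℂ) =
      ((n * (2 * ((z - z₀) ^ 2).re) : ℝ) : ℂ) * Complex.I := by push_cast; ring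
  rw [this, Complex.norm_exp_ofReal_mul_I]

lemma conj_osc (n : ℝ) (z₀ z : ℂ) : conj (osc n z₀ z) = osc (-n) z₀ z := by
  rw [osc, osc, ← Complex.exp_conj, phase_eq]
  congr 1
  simp only [map_mul, Complex.conj_I, Complex.conj_ofReal]
  push_cast
  ring

lemma hasFDerivAt_osc (n : ℝ) (z₀ z : ℂ) :
    HasFDerivAt (osc n z₀) (wirt (2 * Complex.I * n * (z - z₀) * osc n z₀ z)
      (2 * Complex.I * n * conj (z - z₀) * osc n z₀ z)) z := by
  have h1 := hasFDerivAt_wirt_sub (hasFDerivAt_wirt_id z) (hasFDerivAt_wirt_const z₀ z)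
  have h2 := hasFDerivAt_wirt_sub (hasFDerivAt_wirt_conj z) (hasFDerivAt_wirt_const (conj z₀) z)
  have h3 := hasFDerivAt_wirt_mul (hasFDerivAt_wirt_const (Complex.I * n) z)
    (hasFDerivAt_wirt_add (hasFDerivAt_wirt_mul h1 h1) (hasFDerivAt_wirt_mul h2 h2))
  have h4 := hasFDerivAt_wirt_comp (Complex.hasDerivAt_exp _) h3
  have e : osc n z₀ = fun w => Complex.exp (Complex.I * n * ((w - z₀) * (w - z₀) +
      (conj w - conj z₀) * (conj w - conj z₀))) := by
    funext w
    rw [osc, phase]; ring_nf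
  rw [e]
  convert h4 using 2
  · ring
  · rw [map_sub]; ring

lemma continuous_osc (n : ℝ) (z₀ : ℂ) : Continuous (osc n z₀) :=
  continuous_iff_continuousAt.2 fun w => (hasFDerivAt_osc n z₀ w).continuousAt

end Bukhgeim

/-! ### Integrals over the disc -/

namespace Bukhgeim

/-- Polar coordinates: the integral of a nonnegative radial function, given a primitive of
`y ↦ y f(y)`. -/
lemma lintegral_ball_radial_le {f G : ℝ → ℝ} {R M : ℝ} (hR : 0 < R)
    (h0 : ∀ y ∈ Set.Ioo 0 R, 0 ≤ f y) (hG : ContinuousOn G (Set.Icc 0 R))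
    (hd : ∀ y ∈ Set.Ioo 0 R, HasDerivAt G (y * f y) y) (hM : G R - G 0 ≤ M) :
    ∫⁻ w in Metric.ball (0 : ℂ) R, ENNReal.ofReal (f ‖w‖) ≤ ENNReal.ofReal (2 * Real.pi * M) := by
  have hI : IntegrableOn (fun y => y * f y) (Set.Ioc 0 R) :=
    intervalIntegral.integrableOn_deriv_of_nonneg hG hd fun y hy => mul_nonneg hy.1.le (h0 y hy)
  have hI' : IntegrableOn (fun w : ℂ => f ‖w‖) (Metric.ball 0 R) := by
    rw [integrableOn_fun_norm_addHaar (μ := (volume : Measure ℂ)) (f := f)]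
    simp only [Complex.finrank_real_complex, smul_eq_mul, Nat.add_one_sub_one, pow_one]
    exact hI.mono_set Set.Ioo_subset_Ioc_self
  have hval : ∫ w in Metric.ball (0 : ℂ) R, f ‖w‖ = 2 * Real.pi * (G R - G 0) := by
    have h1 : ∀ w : ℂ, (Metric.ball (0 : ℂ) R).indicator (fun w => f ‖w‖) w =
        (Set.Iio R).indicator f ‖w‖ := by
      intro w
      by_cases hw : ‖w‖ ∈ Set.Iio R
      · rw [Set.indicator_of_mem (by simpa using hw), Set.indicator_of_mem hw]
      · rw [Set.indicator_of_notMem (by simpa using hw), Set.indicator_of_notMem hw]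
    rw [← integral_indicator measurableSet_ball]
    simp only [h1]
    rw [integral_fun_norm_addHaar (μ := (volume : Measure ℂ)) ((Set.Iio R).indicator f)]
    have h2 : (volume : Measure ℂ).real (Metric.ball 0 1) = Real.pi := by
      rw [volume_real_ball _ zero_le_one]; simp
    have h3 : ∫ y in Set.Ioi (0 : ℝ), y ^ (Module.finrank ℝ ℂ - 1) • (Set.Iio R).indicator f y =
        G R - G 0 := by
      have e : ∀ y, y ^ (Module.finrank ℝ ℂ - 1) • (Set.Iio R).indicator f y =
          (Set.Iio R).indicator (fun y => y * f y) y := by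
        intro y
        by_cases hy : y ∈ Set.Iio R
        · simp [Set.indicator_of_mem hy]
        · simp [Set.indicator_of_notMem hy]
      simp only [e]
      rw [setIntegral_indicator measurableSet_Iio, Set.Ioi_inter_Iio, ← integral_Ioc_eq_integral_Ioo,
        ← intervalIntegral.integral_of_le hR.le]
      exact intervalIntegral.integral_eq_sub_of_hasDerivAt_of_le hR.le hG hd
        ((intervalIntegrable_iff_integrableOn_Ioc_of_le hR.le).2 hI)
    rw [h3, h2, Complex.finrank_real_complex]
    simp
    ring
  have hnn : 0 ≤ᵐ[volume.restrict (Metric.ball (0 : ℂ) R)] fun w : ℂ => f ‖w‖ := by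
    have hne : ∀ᵐ w : ℂ ∂(volume.restrict (Metric.ball (0 : ℂ) R)), w ≠ 0 := by
      refine ae_restrict_of_ae ?_
      simp [ae_iff, measure_singleton]
    filter_upwards [ae_restrict_mem measurableSet_ball, hne] with w hw hw0
    exact h0 _ ⟨norm_pos_iff.2 hw0, by simpa using hw⟩
  rw [← ofReal_integral_eq_lintegral_ofReal hI' hnn, hval]
  have := Real.pi_pos
  gcongr

/-- The `L¹` norm of the difference between `1 / w̄` and its regularization. -/
lemma lintegral_kernel_error_le {δ : ℝ} (hδ : 0 < δ) :
    ∫⁻ w in Metric.ball (0 : ℂ) 2, ENNReal.ofReal (δ ^ 2 / (‖w‖ * (‖w‖ ^ 2 + δ ^ 2))) ≤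
      ENNReal.ofReal (Real.pi * (Real.pi * δ)) := by
  have h := lintegral_ball_radial_le (f := fun y => δ ^ 2 / (y * (y ^ 2 + δ ^ 2)))
    (G := fun y => δ * Real.arctan (y / δ)) (R := 2) (M := δ * (Real.pi / 2)) (by norm_num)
    (fun y hy => by have := hy.1; positivity)
    (by fun_prop) (fun y hy => ?_) ?_
  · refine h.trans_eq ?_
    congr 1; ring
  · have h1 := ((hasDerivAt_id y).div_const δ).arctan.const_mul δ
    refine h1.congr_deriv ?_
    have := hy.1.ne'
    simp only [id]
    field_simp
    ring
  · simp only [zero_div, Real.arctan_zero, mul_zero, sub_zero]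
    exact mul_le_mul_of_nonneg_left (Real.arctan_lt_pi_div_two _).le hδ.le

lemma lintegral_one_sub_cut_le {δ : ℝ} (hδ : 0 < δ) :
    ∫⁻ z, ENNReal.ofReal (1 - cut δ (1 - ‖z‖ ^ 2)) ∂discMeasure ≤
      ENNReal.ofReal (Real.pi * (Real.pi * δ) / 2) := by
  have h := lintegral_ball_radial_le (f := fun y => 1 - cut δ (1 - y ^ 2))
    (G := fun y => -(δ / 2) * Real.arctan ((1 - y ^ 2) / δ)) (R := 1) (M := δ / 2 * (Real.pi / 2))
    (by norm_num)
    (fun y _ => sub_nonneg.2 (cut_le_one hδ _)) (by fun_prop) (fun y hy => ?_) ?_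
  · refine h.trans_eq ?_
    congr 1; ring
  · have h1 := ((((hasDerivAt_pow 2 y).const_sub 1).div_const δ).arctan).const_mul (-(δ / 2))
    refine h1.congr_deriv ?_
    have : 0 ≤ 1 - y ^ 2 := by nlinarith [hy.1, hy.2]
    rw [one_sub_cut hδ this]
    simp only [Nat.cast_ofNat, Nat.add_one_sub_one, pow_one]
    field_simp
    ring
  · simp only [one_pow, sub_self, zero_div, Real.arctan_zero, mul_zero, ne_eq, OfNat.ofNat_ne_zero,
      not_false_eq_true, zero_pow, sub_zero, zero_sub, neg_mul, neg_neg]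
    exact mul_le_mul_of_nonneg_left (Real.arctan_lt_pi_div_two _).le (by positivity)

lemma lintegral_bump_le {δ : ℝ} (hδ : 0 < δ) {z₀ : ℂ} (hz₀ : z₀ ∈ closedDisc) :
    ∫⁻ ξ, ENNReal.ofReal (δ ^ 2 / (‖ξ - z₀‖ ^ 2 + δ ^ 2)) ∂discMeasure ≤
      ENNReal.ofReal (2 * Real.pi * δ) := by
  have h := lintegral_ball_radial_le (f := fun y => δ / 2 * y⁻¹)
    (G := fun y => δ / 2 * y) (R := 2) (M := δ) (by norm_num)
    (fun y hy => by have := hy.1; positivity)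
    (by fun_prop) (fun y hy => ?_) (by simp)
  · refine le_trans ?_ h
    refine le_trans ?_ (lintegral_disc_comp_sub_le hz₀ fun w => ENNReal.ofReal (δ / 2 * ‖w‖⁻¹))
    have hne : ∀ᵐ ξ ∂discMeasure, ξ ≠ z₀ := by
      apply discMeasure_ac
      simp [measure_singleton]
    refine lintegral_mono_ae ?_
    filter_upwards [hne] with ξ hξ
    have : 0 < ‖ξ - z₀‖ := norm_pos_iff.2 (sub_ne_zero.2 hξ)
    rw [norm_sub_rev z₀ ξ]
    apply ENNReal.ofReal_le_ofReal
    rw [← div_eq_mul_inv, div_div, div_le_div_iff₀ (by positivity) (by positivity)]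
    nlinarith [mul_nonneg hδ.le (sq_nonneg (‖ξ - z₀‖ - δ))]
  · have := hy.1.ne'
    refine ((hasDerivAt_id y).const_mul (δ / 2)).congr_deriv ?_
    field_simp

/-- **Young's inequality** on the disc: convolution with an even kernel `k` is bounded on `L^p` by
the integral of `k`. -/
lemma lintegral_rpow_convolution_le {p : ℝ} (hp : 1 < p) {k φ : ℂ → ℝ≥0∞} (hk : Measurable k)
    (hφ : AEMeasurable φ discMeasure) (heven : ∀ w, k (-w) = k w) :
    ∫⁻ z, (∫⁻ ξ, φ ξ * k (z - ξ) ∂discMeasure) ^ p ∂discMeasure ≤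
      (∫⁻ w in Metric.ball (0 : ℂ) 2, k w) ^ p * ∫⁻ ξ, φ ξ ^ p ∂discMeasure := by
  set q := p / (p - 1) with hq
  have hpq : p.HolderConjugate q := Real.HolderConjugate.conjExponent hp
  set K := ∫⁻ w in Metric.ball (0 : ℂ) 2, k w
  have hp0 : 0 < p := by linarith
  have hq0 : 0 < q := hpq.symm.pos
  have hdisc : ∀ᵐ z ∂discMeasure, z ∈ closedDisc := by
    filter_upwards [ae_restrict_mem measurableSet_disc] with z hz using disc_subset_closedDisc hz
  have hkz : ∀ z, Measurable fun ξ => k (z - ξ) := fun z => hk.comp (by fun_prop)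
  have step1 : ∀ z ∈ closedDisc, (∫⁻ ξ, φ ξ * k (z - ξ) ∂discMeasure) ^ p ≤
      K ^ (p - 1) * ∫⁻ ξ, φ ξ ^ p * k (z - ξ) ∂discMeasure := by
    intro z hz
    have h1 := ENNReal.lintegral_mul_le_Lp_mul_Lq discMeasure hpq
      (f := fun ξ => φ ξ * k (z - ξ) ^ (1 / p)) (g := fun ξ => k (z - ξ) ^ (1 / q))
      (hφ.mul ((hkz z).pow_const _).aemeasurable) ((hkz z).pow_const _).aemeasurable
    have e1 : ∀ ξ, (fun ξ => φ ξ * k (z - ξ) ^ (1 / p)) ξ * (fun ξ => k (z - ξ) ^ (1 / q)) ξ =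
        φ ξ * k (z - ξ) := by
      intro ξ
      simp only
      rw [mul_assoc, ← ENNReal.rpow_add_of_nonneg _ _ (by positivity) (by positivity)]
      have : 1 / p + 1 / q = 1 := by simpa using hpq.inv_add_inv_eq_one
      rw [this, ENNReal.rpow_one]
    have e2 : ∀ ξ, (φ ξ * k (z - ξ) ^ (1 / p)) ^ p = φ ξ ^ p * k (z - ξ) := by
      intro ξ
      rw [ENNReal.mul_rpow_of_nonneg _ _ hp0.le, ← ENNReal.rpow_mul, one_div_mul_cancel hp0.ne',
        ENNReal.rpow_one]
    have e3 : ∀ ξ, (k (z - ξ) ^ (1 / q)) ^ q = k (z - ξ) := by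
      intro ξ
      rw [← ENNReal.rpow_mul, one_div_mul_cancel hq0.ne', ENNReal.rpow_one]
    simp only [Pi.mul_apply, e1, e2, e3] at h1
    calc (∫⁻ ξ, φ ξ * k (z - ξ) ∂discMeasure) ^ p
        ≤ ((∫⁻ ξ, φ ξ ^ p * k (z - ξ) ∂discMeasure) ^ (1 / p) *
          (∫⁻ ξ, k (z - ξ) ∂discMeasure) ^ (1 / q)) ^ p := by gcongr
      _ = (∫⁻ ξ, φ ξ ^ p * k (z - ξ) ∂discMeasure) *
          (∫⁻ ξ, k (z - ξ) ∂discMeasure) ^ (p - 1) := by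
          rw [ENNReal.mul_rpow_of_nonneg _ _ hp0.le, ← ENNReal.rpow_mul, ← ENNReal.rpow_mul,
            one_div_mul_cancel hp0.ne', ENNReal.rpow_one]
          congr 2
          rw [hq]
          have : p - 1 ≠ 0 := by linarith
          field_simp
      _ ≤ _ := by
          rw [mul_comm]
          gcongr ?_ ^ _ * _
          exact lintegral_disc_comp_sub_le hz k
  calc _ ≤ ∫⁻ z, K ^ (p - 1) * ∫⁻ ξ, φ ξ ^ p * k (z - ξ) ∂discMeasure ∂discMeasure := by
        refine lintegral_mono_ae ?_
        filter_upwards [hdisc] with z hz using step1 z hz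
    _ = K ^ (p - 1) * ∫⁻ ξ, φ ξ ^ p * (∫⁻ z, k (z - ξ) ∂discMeasure) ∂discMeasure := by
        have hj : AEMeasurable (Function.uncurry fun z ξ => φ ξ ^ p * k (z - ξ))
            (discMeasure.prod discMeasure) := by
          have h1 : AEMeasurable (fun x : ℂ × ℂ => φ x.2) (discMeasure.prod discMeasure) :=
            hφ.comp_snd
          exact (h1.pow_const p).mul (hk.comp (by fun_prop)).aemeasurable
        have hj' : AEMeasurable (fun z => ∫⁻ ξ, φ ξ ^ p * k (z - ξ) ∂discMeasure) discMeasure :=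
          hj.lintegral_prod_right'
        rw [lintegral_const_mul'' _ hj', lintegral_lintegral_swap hj]
        congr 1
        refine lintegral_congr fun ξ => ?_
        have hm : Measurable fun z => k (z - ξ) := hk.comp (by fun_prop)
        rw [lintegral_const_mul _ hm]
    _ ≤ K ^ (p - 1) * ∫⁻ ξ, φ ξ ^ p * K ∂discMeasure := by
        refine mul_le_mul_right (lintegral_mono_ae ?_) _
        filter_upwards [hdisc] with ξ hξ
        gcongr
        refine le_trans (le_of_eq ?_) (lintegral_disc_comp_sub_le hξ k)
        refine lintegral_congr fun z => ?_
        rw [← heven, neg_sub]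
    _ = _ := by
        rw [lintegral_mul_const'' _ (hφ.pow_const p), mul_comm _ K, ← mul_assoc]
        congr 1
        nth_rewrite 2 [← ENNReal.rpow_one K]
        rw [← ENNReal.rpow_add_of_nonneg _ _ (by linarith) zero_le_one]
        congr 1; ring

lemma lpDisc_eq {p : ℝ} (hp : 0 < p) (f : ℂ → ℂ) :
    lpDisc p f = (∫⁻ ξ, ‖f ξ‖ₑ ^ p ∂discMeasure) ^ (1 / p) := by
  rw [lpDisc, eLpNorm_eq_lintegral_rpow_enorm_toReal (by simpa using hp) ENNReal.ofReal_ne_top,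
    ENNReal.toReal_ofReal hp.le]

/-- A function bounded by `M θ` with `0 ≤ θ ≤ 1` has `L^p` norm at most `M (∫ θ)^{1/p}`. -/
lemma lpDisc_le_of_le_weight {p : ℝ} (hp : 1 ≤ p) {f : ℂ → ℂ} {θ : ℂ → ℝ} {M c : ℝ} (hM : 0 ≤ M)
    (hc : 0 ≤ c)
    (h : ∀ z ∈ disc, ‖f z‖ ≤ M * θ z) (h0 : ∀ z ∈ disc, 0 ≤ θ z) (h1 : ∀ z ∈ disc, θ z ≤ 1)
    (hθ : ∫⁻ z, ENNReal.ofReal (θ z) ∂discMeasure ≤ ENNReal.ofReal c) :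
    lpDisc p f ≤ ENNReal.ofReal (M * c ^ (1 / p)) := by
  have hp0 : 0 < p := by linarith
  rw [lpDisc_eq hp0, ENNReal.ofReal_mul hM, ← ENNReal.ofReal_rpow_of_nonneg hc (by positivity)]
  have : ENNReal.ofReal M = (ENNReal.ofReal M ^ p) ^ (1 / p) := by
    rw [← ENNReal.rpow_mul, mul_one_div_cancel hp0.ne', ENNReal.rpow_one]
  rw [this, ← ENNReal.mul_rpow_of_nonneg _ _ (by positivity)]
  gcongr
  refine le_trans ?_ (mul_le_mul_right hθ _)
  rw [← lintegral_const_mul' _ _ (by simp [hp0.le])]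
  refine lintegral_mono_ae ?_
  filter_upwards [ae_restrict_mem measurableSet_disc] with z hz
  rw [← ofReal_norm, ENNReal.ofReal_rpow_of_nonneg (norm_nonneg _) hp0.le,
    ENNReal.ofReal_rpow_of_nonneg hM hp0.le, ← ENNReal.ofReal_mul (by positivity)]
  apply ENNReal.ofReal_le_ofReal
  calc ‖f z‖ ^ p ≤ (M * θ z) ^ p := by gcongr; exact h z hz
    _ = M ^ p * θ z ^ p := Real.mul_rpow hM (h0 z hz)
    _ ≤ M ^ p * θ z := by
        gcongr
        calc θ z ^ p ≤ θ z ^ (1 : ℝ) :=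
              Real.rpow_le_rpow_of_exponent_ge' (h0 z hz) (h1 z hz) zero_le_one hp
          _ = θ z := Real.rpow_one _

lemma volume_disc_le : discMeasure Set.univ ≤ 4 := by
  rw [discMeasure, Measure.restrict_apply_univ, disc, Complex.volume_ball]
  have : (NNReal.pi : ℝ≥0∞) ≤ 4 := by
    have : NNReal.pi ≤ 4 := by
      rw [← NNReal.coe_le_coe]; exact Real.pi_le_four
    exact_mod_cast this
  simpa using this

lemma lpDisc_le_of_bound {p : ℝ} (hp : 1 ≤ p) {f : ℂ → ℂ} {M : ℝ} (hM : 0 ≤ M)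
    (h : ∀ z ∈ disc, ‖f z‖ ≤ M) : lpDisc p f ≤ ENNReal.ofReal (4 * M) := by
  have h4 : ∫⁻ _, ENNReal.ofReal 1 ∂discMeasure ≤ ENNReal.ofReal 4 := by
    simpa using volume_disc_le
  refine (lpDisc_le_of_le_weight hp (θ := fun _ => 1) hM (by norm_num) (by simpa using h)
    (fun _ _ => zero_le_one) (fun _ _ => le_rfl) h4).trans ?_
  apply ENNReal.ofReal_le_ofReal
  rw [mul_comm]
  gcongr
  calc (4 : ℝ) ^ (1 / p) ≤ 4 ^ (1 : ℝ) := by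
        gcongr
        · norm_num
        · rw [div_le_one (by linarith)]; exact hp
    _ = 4 := Real.rpow_one _

end Bukhgeim

/-! ### The regularized Cauchy transform -/

namespace Bukhgeim

/-- Testing an admissible constant on `ξ ↦ |h(ξ)| (z - ξ) / |z - ξ|` bounds the Cauchy integral of
`|h|` with the absolute value of the kernel. -/
lemma integral_norm_mul_kernel_le {p : ℝ} (hp : 2 < p) {A : ℝ≥0} (hA : IsCauchyConst p A) {h : ℂ → ℂ}
    (hh : MemLpDisc p h) {z : ℂ} (hz : z ∈ closedDisc) :
    Integrable (fun ξ => ‖h ξ‖ * ‖(z - ξ)⁻¹‖) discMeasure ∧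
      ∫ ξ, ‖h ξ‖ * ‖(z - ξ)⁻¹‖ ∂discMeasure ≤ Real.pi * (A * (lpDisc p h).toReal) := by
  have hI : Integrable (fun ξ => ‖h ξ‖ * ‖(z - ξ)⁻¹‖) discMeasure := by
    have := (integrable_cauchy hp hh hz).norm
    simpa only [div_eq_mul_inv, norm_mul] using this
  refine ⟨hI, ?_⟩
  -- at `ξ = z` the quotient is `0 / 0 = 0`, in agreement with the junk value of `(z - ξ)⁻¹`
  set f : ℂ → ℂ := fun ξ => (‖h ξ‖ : ℂ) * ((z - ξ) / (‖z - ξ‖ : ℂ)) with hf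
  have hfm : AEStronglyMeasurable f discMeasure := by
    have h1 : AEStronglyMeasurable (fun ξ => (‖h ξ‖ : ℂ)) discMeasure :=
      Complex.continuous_ofReal.comp_aestronglyMeasurable hh.aestronglyMeasurable.norm
    have h2 : Measurable fun ξ : ℂ => (z - ξ) / (‖z - ξ‖ : ℂ) := by fun_prop
    exact h1.mul h2.aestronglyMeasurable
  have hfh : ∀ ξ, ‖f ξ‖ ≤ ‖h ξ‖ := by
    intro ξ
    simp only [hf, norm_mul, norm_div, Complex.norm_real, norm_norm]
    exact mul_le_of_le_one_right (norm_nonneg _) (div_self_le_one _)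
  have hfL : MemLpDisc p f := hh.of_le hfm (ae_of_all _ hfh)
  have hle : lpDisc p f ≤ lpDisc p h := eLpNorm_mono hfh
  have h1 : cauchy f z = ((1 / Real.pi * ∫ ξ, ‖h ξ‖ * ‖(z - ξ)⁻¹‖ ∂discMeasure : ℝ) : ℂ) := by
    unfold cauchy
    rw [Complex.ofReal_mul, ← integral_complex_ofReal]
    congr 1
    · simp
    · refine integral_congr_ae (ae_of_all _ fun ξ => ?_)
      simp only [hf]
      rcases eq_or_ne (z - ξ) 0 with h0 | h0
      · simp [h0]
      · have : (‖z - ξ‖ : ℂ) ≠ 0 := by simpa using h0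
        rw [norm_inv]
        push_cast
        field_simp
  have h2 := (enorm_le_holderNorm (α := 1 - 2 / p) (f := cauchy f) hz).trans (hA f hfL).1
  have h3 : ‖cauchy f z‖ₑ ≤ A * lpDisc p h := h2.trans (by gcongr)
  rw [h1, ← ofReal_norm, Complex.norm_real, Real.norm_of_nonneg (by positivity)] at h3
  have h4 := (ENNReal.ofReal_le_iff_le_toReal
    (ENNReal.mul_ne_top ENNReal.coe_ne_top hh.eLpNorm_ne_top)).1 h3
  rw [ENNReal.toReal_mul, ENNReal.coe_toReal, one_div, inv_mul_le_iff₀ Real.pi_pos] at h4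
  exact h4

/-- The conjugate Cauchy operator with the kernel replaced by its regularization. -/
def regCauchy (δ : ℝ) (h : ℂ → ℂ) (z : ℂ) : ℂ :=
  (1 / (Real.pi : ℂ)) * ∫ ξ, h ξ * regKernel δ (z - ξ) ∂discMeasure

/-- The derivative `∂` of `regCauchy`. -/
def regCauchyD (δ : ℝ) (h : ℂ → ℂ) (z : ℂ) : ℂ :=
  (1 / (Real.pi : ℂ)) * ∫ ξ, h ξ * regKernelD δ (z - ξ) ∂discMeasure

/-- The derivative `∂̄` of `regCauchy`. -/
def regCauchyDbar (δ : ℝ) (h : ℂ → ℂ) (z : ℂ) : ℂ :=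
  (1 / (Real.pi : ℂ)) * ∫ ξ, h ξ * regKernelDbar δ (z - ξ) ∂discMeasure

lemma MemLpDisc.integrable {p : ℝ} (hp : 2 < p) {h : ℂ → ℂ} (hh : MemLpDisc p h) :
    Integrable h discMeasure := MemLp.integrable (one_le_ofReal_p hp) hh

lemma hasFDerivAt_regCauchy {δ : ℝ} (hδ : 0 < δ) {h : ℂ → ℂ} (hh : Integrable h discMeasure) (z : ℂ) :
    HasFDerivAt (regCauchy δ h) (wirt (regCauchyD δ h z) (regCauchyDbar δ h z)) z := by
  have hb : ∀ {k : ℂ → ℂ} {M : ℝ}, Continuous k → (∀ w, ‖k w‖ ≤ M) → ∀ z,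
      Integrable (fun ξ => h ξ * k (z - ξ)) discMeasure := fun hk hM z =>
    hh.mul_bdd (hk.comp (by fun_prop)).aestronglyMeasurable (ae_of_all _ fun ξ => hM _)
  have i0 := hb (continuous_regKernel hδ) (norm_regKernel_le hδ)
  have i1 := hb (continuous_regKernelD hδ) (fun w => (norm_regKernelD_le hδ w).1)
  have i2 := hb (continuous_regKernelDbar hδ) (fun w => (norm_regKernelD_le hδ w).2)
  have hW : ∀ z, (fun ξ => wirt (h ξ * regKernelD δ (z - ξ)) (h ξ * regKernelDbar δ (z - ξ))) =
      fun ξ => (h ξ * regKernelD δ (z - ξ)) • ContinuousLinearMap.id ℝ ℂ +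
        (h ξ * regKernelDbar δ (z - ξ)) • (Complex.conjCLE : ℂ →L[ℝ] ℂ) := fun z => rfl
  have iW : Integrable (fun ξ => wirt (h ξ * regKernelD δ (z - ξ)) (h ξ * regKernelDbar δ (z - ξ)))
      discMeasure := by
    rw [hW]
    have j1 := (i1 z).smul_const (ContinuousLinearMap.id ℝ ℂ)
    have j2 := (i2 z).smul_const (Complex.conjCLE : ℂ →L[ℝ] ℂ)
    exact j1.add j2
  have key := hasFDerivAt_integral_of_dominated_of_fderiv_le (𝕜 := ℝ) (μ := discMeasure)
    (F := fun z ξ => h ξ * regKernel δ (z - ξ))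
    (F' := fun z ξ => wirt (h ξ * regKernelD δ (z - ξ)) (h ξ * regKernelDbar δ (z - ξ)))
    (bound := fun ξ => ‖h ξ‖ * (2 / δ ^ 2)) (x₀ := z) (s := Set.univ) Filter.univ_mem
    (Eventually.of_forall fun z => (i0 z).aestronglyMeasurable) (i0 z) iW.aestronglyMeasurable
    (ae_of_all _ fun ξ w _ => ?_) (hh.norm.mul_const _) (ae_of_all _ fun ξ w _ => ?_)
  · have h2 := hasFDerivAt_wirt_mul (hasFDerivAt_wirt_const (1 / (Real.pi : ℂ)) z)
      (key.congr_fderiv (f' := _) (g' := wirt (∫ ξ, h ξ * regKernelD δ (z - ξ) ∂discMeasure)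
        (∫ ξ, h ξ * regKernelDbar δ (z - ξ) ∂discMeasure)) ?_)
    · simp only [mul_zero, add_zero] at h2
      exact h2
    · ext v
      rw [ContinuousLinearMap.integral_apply iW, wirt_apply]
      simp only [wirt_apply]
      rw [integral_add ((i1 z).mul_const _) ((i2 z).mul_const _), integral_mul_const,
        integral_mul_const]
  · refine (norm_wirt_le _ _).trans ?_
    rw [norm_mul, norm_mul, ← mul_add]
    gcongr
    have := norm_regKernelD_le hδ (w - ξ)
    calc _ ≤ 1 / δ ^ 2 + 1 / δ ^ 2 := add_le_add this.1 this.2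
      _ = _ := by ring
  · have h1 := hasFDerivAt_comp_sub_const (hasFDerivAt_regKernel hδ (w - ξ))
    have h2 := hasFDerivAt_wirt_mul (hasFDerivAt_wirt_const (h ξ) w) h1
    simpa using h2

/-- Bounds for the regularized Cauchy transform and its derivatives. -/
lemma norm_regCauchy_le {p : ℝ} (hp : 2 < p) {A : ℝ≥0} (hA : IsCauchyConst p A) {h : ℂ → ℂ}
    (hh : MemLpDisc p h) {δ : ℝ} (hδ : 0 < δ) {z : ℂ} (hz : z ∈ closedDisc) :
    ‖regCauchy δ h z‖ ≤ A * (lpDisc p h).toReal ∧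
      ‖regCauchyD δ h z‖ ≤ 1 / (2 * δ) * (A * (lpDisc p h).toReal) ∧
      ‖regCauchyDbar δ h z‖ ≤ 1 / (2 * δ) * (A * (lpDisc p h).toReal) := by
  obtain ⟨hI, hle⟩ := integral_norm_mul_kernel_le hp hA hh hz
  have hne : ∀ᵐ ξ ∂discMeasure, z - ξ ≠ 0 := by
    have : ∀ᵐ ξ : ℂ, ξ ≠ z := by simp [ae_iff, measure_singleton]
    filter_upwards [discMeasure_ac this] with ξ hξ using sub_ne_zero.2 hξ.symm
  have key : ∀ (k : ℂ → ℂ) (c : ℝ), 0 ≤ c → (∀ w, w ≠ 0 → ‖k w‖ ≤ c * ‖w⁻¹‖) →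
      ‖(1 / (Real.pi : ℂ)) * ∫ ξ, h ξ * k (z - ξ) ∂discMeasure‖ ≤ c * (A * (lpDisc p h).toReal) := by
    intro k c hc hk
    have h1 : ‖∫ ξ, h ξ * k (z - ξ) ∂discMeasure‖ ≤
        ∫ ξ, c * (‖h ξ‖ * ‖(z - ξ)⁻¹‖) ∂discMeasure := by
      refine norm_integral_le_of_norm_le (hI.const_mul c) ?_
      filter_upwards [hne] with ξ hξ
      rw [norm_mul, mul_left_comm]
      gcongr
      exact hk _ hξ
    rw [integral_const_mul] at h1
    rw [norm_mul, norm_div, norm_one, Complex.norm_real, Real.norm_of_nonneg Real.pi_pos.le,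
      one_div, inv_mul_le_iff₀ Real.pi_pos]
    refine h1.trans ?_
    rw [mul_left_comm]
    gcongr
  refine ⟨?_, ?_, ?_⟩
  · have := key (regKernel δ) 1 zero_le_one fun w _ => by
      rw [one_mul]; exact norm_regKernel_le_inv hδ w
    rwa [one_mul] at this
  · exact key _ _ (by positivity) fun w hw => (norm_regKernelD_le_inv hδ hw).1
  · exact key _ _ (by positivity) fun w hw => (norm_regKernelD_le_inv hδ hw).2

/-- Regularizing the kernel costs `O(δ)` in `L^p`. -/
lemma lpDisc_cauchyBar_sub_regCauchy_le {p : ℝ} (hp : 2 < p) {h : ℂ → ℂ} (hh : MemLpDisc p h) {δ : ℝ}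
    (hδ : 0 < δ) :
    lpDisc p (fun z => cauchyBar h z - regCauchy δ h z) ≤ ENNReal.ofReal (4 * δ) * lpDisc p h := by
  have hp0 : 0 < p := by linarith
  set k : ℂ → ℝ≥0∞ := fun w => ENNReal.ofReal (δ ^ 2 / (‖w‖ * (‖w‖ ^ 2 + δ ^ 2))) with hk
  have hkm : Measurable k := by rw [hk]; fun_prop
  set c : ℝ≥0∞ := ENNReal.ofReal (1 / Real.pi) with hc
  have hpt : ∀ z ∈ closedDisc, ‖cauchyBar h z - regCauchy δ h z‖ₑ ≤
      c * ∫⁻ ξ, ‖h ξ‖ₑ * k (z - ξ) ∂discMeasure := by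
    intro z hz
    have hne : ∀ᵐ ξ ∂discMeasure, z - ξ ≠ 0 := by
      have : ∀ᵐ ξ : ℂ, ξ ≠ z := by simp [ae_iff, measure_singleton]
      filter_upwards [discMeasure_ac this] with ξ hξ using sub_ne_zero.2 hξ.symm
    have i0 : Integrable (fun ξ => h ξ * regKernel δ (z - ξ)) discMeasure :=
      (hh.integrable hp).mul_bdd ((continuous_regKernel hδ).comp (by fun_prop)).aestronglyMeasurable
        (ae_of_all _ fun ξ => norm_regKernel_le hδ _)
    unfold cauchyBar regCauchy
    rw [← mul_sub, ← integral_sub (cauchyConverges hp hh hz).2 i0, enorm_mul]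
    have e1 : ‖(1 / (Real.pi : ℂ))‖ₑ = c := by
      rw [← ofReal_norm, norm_div, norm_one, Complex.norm_real, Real.norm_of_nonneg Real.pi_pos.le]
    rw [e1]
    gcongr
    refine (enorm_integral_le_lintegral_enorm _).trans (lintegral_mono_ae ?_)
    filter_upwards [hne] with ξ hξ
    rw [← map_sub, div_eq_mul_inv, ← mul_sub, enorm_mul, ← ofReal_norm (_ - _),
      norm_inv_conj_sub_regKernel hδ hξ]
  rw [lpDisc_eq hp0, lpDisc_eq hp0]
  have hY := lintegral_rpow_convolution_le (p := p) (by linarith) hkm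
    hh.aestronglyMeasurable.enorm (fun w => by simp [hk])
  have hK : c * ∫⁻ w in Metric.ball (0 : ℂ) 2, k w ≤ ENNReal.ofReal (4 * δ) := by
    calc _ ≤ c * ENNReal.ofReal (Real.pi * (Real.pi * δ)) := by
          gcongr; exact lintegral_kernel_error_le hδ
      _ = ENNReal.ofReal (Real.pi * δ) := by
          rw [hc, ← ENNReal.ofReal_mul (by positivity)]
          congr 1
          field_simp
      _ ≤ _ := by gcongr; exact Real.pi_le_four
  calc _ ≤ (∫⁻ z, c ^ p * (∫⁻ ξ, ‖h ξ‖ₑ * k (z - ξ) ∂discMeasure) ^ p ∂discMeasure) ^ (1 / p) := by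
        refine ENNReal.rpow_le_rpow (lintegral_mono_ae ?_) (by positivity)
        filter_upwards [ae_restrict_mem measurableSet_disc] with z hz
        rw [← ENNReal.mul_rpow_of_nonneg _ _ hp0.le]
        gcongr
        exact hpt z (disc_subset_closedDisc hz)
    _ ≤ ((c * ∫⁻ w in Metric.ball (0 : ℂ) 2, k w) ^ p * ∫⁻ ξ, ‖h ξ‖ₑ ^ p ∂discMeasure) ^ (1 / p) := by
        rw [lintegral_const_mul' _ _ (by simp [hc, hp0.le]), ENNReal.mul_rpow_of_nonneg _ _ hp0.le,
          mul_assoc]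
        gcongr
    _ = (c * ∫⁻ w in Metric.ball (0 : ℂ) 2, k w) * (∫⁻ ξ, ‖h ξ‖ₑ ^ p ∂discMeasure) ^ (1 / p) := by
        rw [ENNReal.mul_rpow_of_nonneg _ _ (by positivity), ← ENNReal.rpow_mul,
          mul_one_div_cancel hp0.ne', ENNReal.rpow_one]
    _ ≤ _ := by gcongr

end Bukhgeim

/-! ### The function inverted by the Cauchy–Pompeiu formula -/

namespace Bukhgeim

/-- Division of `regCauchy δ h` by the (regularized) `∂̄`-derivative of the phase, with a cutoff. -/
def corrector (δ : ℝ) (z₀ : ℂ) (h : ℂ → ℂ) (z : ℂ) : ℂ :=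
  discCut δ z * regKernel δ (z - z₀) * regCauchy δ h z

/-- The derivative `∂` of `corrector`. -/
def correctorD (δ : ℝ) (z₀ : ℂ) (h : ℂ → ℂ) (z : ℂ) : ℂ :=
  discCut δ z * regKernel δ (z - z₀) * regCauchyD δ h z +
    regCauchy δ h z * (discCut δ z * regKernelD δ (z - z₀) +
      regKernel δ (z - z₀) * (-(cutDeriv δ (1 - ‖z‖ ^ 2) : ℂ) * conj z))

/-- The derivative `∂̄` of `corrector`. -/
def correctorDbar (δ : ℝ) (z₀ : ℂ) (h : ℂ → ℂ) (z : ℂ) : ℂ :=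
  discCut δ z * regKernel δ (z - z₀) * regCauchyDbar δ h z +
    regCauchy δ h z * (discCut δ z * regKernelDbar δ (z - z₀) +
      regKernel δ (z - z₀) * (-(cutDeriv δ (1 - ‖z‖ ^ 2) : ℂ) * z))

/-- The product of `corrector` with the oscillating factor. -/
def oscCorrector (n δ : ℝ) (z₀ : ℂ) (h : ℂ → ℂ) (z : ℂ) : ℂ := osc n z₀ z * corrector δ z₀ h z

/-- The derivative `∂` of `oscCorrector`. -/
def oscCorrectorD (n δ : ℝ) (z₀ : ℂ) (h : ℂ → ℂ) (z : ℂ) : ℂ :=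
  osc n z₀ z * correctorD δ z₀ h z +
    corrector δ z₀ h z * (2 * Complex.I * n * (z - z₀) * osc n z₀ z)

/-- The derivative `∂̄` of `oscCorrector`. -/
def oscCorrectorDbar (n δ : ℝ) (z₀ : ℂ) (h : ℂ → ℂ) (z : ℂ) : ℂ :=
  osc n z₀ z * correctorDbar δ z₀ h z +
    corrector δ z₀ h z * (2 * Complex.I * n * conj (z - z₀) * osc n z₀ z)

lemma hasFDerivAt_corrector {δ : ℝ} (hδ : 0 < δ) (z₀ : ℂ) {h : ℂ → ℂ} (hh : Integrable h discMeasure)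
    (z : ℂ) : HasFDerivAt (corrector δ z₀ h)
      (wirt (correctorD δ z₀ h z) (correctorDbar δ z₀ h z)) z :=
  hasFDerivAt_wirt_mul (hasFDerivAt_wirt_mul (hasFDerivAt_discCut hδ z)
    (hasFDerivAt_comp_sub_const (hasFDerivAt_regKernel hδ (z - z₀)))) (hasFDerivAt_regCauchy hδ hh z)

lemma hasFDerivAt_oscCorrector (n : ℝ) {δ : ℝ} (hδ : 0 < δ) (z₀ : ℂ) {h : ℂ → ℂ}
    (hh : Integrable h discMeasure) (z : ℂ) : HasFDerivAt (oscCorrector n δ z₀ h)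
      (wirt (oscCorrectorD n δ z₀ h z) (oscCorrectorDbar n δ z₀ h z)) z :=
  hasFDerivAt_wirt_mul (hasFDerivAt_osc n z₀ z) (hasFDerivAt_corrector hδ z₀ hh z)

lemma one_sub_sq_nonpos_of_notMem {z : ℂ} (hz : z ∉ disc) : 1 - ‖z‖ ^ 2 ≤ 0 := by
  have : 1 ≤ ‖z‖ := by simpa [disc] using hz
  nlinarith

/-- Outside the open disc the function and its derivatives vanish. -/
lemma oscCorrector_eq_zero (n δ : ℝ) (z₀ : ℂ) (h : ℂ → ℂ) {z : ℂ} (hz : z ∉ disc) :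
    oscCorrector n δ z₀ h z = 0 ∧ oscCorrectorD n δ z₀ h z = 0 ∧ oscCorrectorDbar n δ z₀ h z = 0 := by
  have h0 := one_sub_sq_nonpos_of_notMem hz
  have h1 : discCut δ z = 0 := by simp [discCut, cut_of_nonpos δ h0]
  have h2 := cutDeriv_of_nonpos δ h0
  simp [oscCorrector, oscCorrectorD, oscCorrectorDbar, corrector, correctorD, correctorDbar, h1, h2]

section bounds

variable {p : ℝ} {A : ℝ≥0} {h : ℂ → ℂ} {δ : ℝ}

lemma norm_corrector_le (hp : 2 < p) (hA : IsCauchyConst p A) (hh : MemLpDisc p h) (hδ : 0 < δ)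
    (z₀ : ℂ) {z : ℂ} (hz : z ∈ closedDisc) :
    ‖corrector δ z₀ h z‖ ≤ A * (lpDisc p h).toReal / (2 * δ) ∧
      ‖z - z₀‖ * ‖corrector δ z₀ h z‖ ≤ A * (lpDisc p h).toReal := by
  have h1 := norm_discCut_le hδ z
  have h2 := norm_regKernel_le hδ (z - z₀)
  have h3 := (norm_regCauchy_le hp hA hh hδ hz).1
  have h4 := norm_mul_regKernel_le hδ (z - z₀)
  set S := A * (lpDisc p h).toReal
  unfold corrector
  rw [norm_mul, norm_mul]
  constructor
  · calc _ ≤ 1 * (1 / (2 * δ)) * S := by gcongr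
      _ = _ := by ring
  · calc _ = ‖discCut δ z‖ * (‖z - z₀‖ * ‖regKernel δ (z - z₀)‖) * ‖regCauchy δ h z‖ := by ring
      _ ≤ 1 * 1 * S := by gcongr
      _ = _ := by ring

lemma norm_correctorD_le (hp : 2 < p) (hA : IsCauchyConst p A) (hh : MemLpDisc p h) (hδ : 0 < δ)
    (z₀ : ℂ) {z : ℂ} (hz : z ∈ closedDisc) :
    ‖correctorD δ z₀ h z‖ ≤ 7 / 4 * (A * (lpDisc p h).toReal) / δ ^ 2 ∧
      ‖correctorDbar δ z₀ h z‖ ≤ 7 / 4 * (A * (lpDisc p h).toReal) / δ ^ 2 := by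
  have h1 := norm_discCut_le hδ z
  have h2 := norm_regKernel_le hδ (z - z₀)
  obtain ⟨h3, h4, h5⟩ := norm_regCauchy_le hp hA hh hδ hz
  obtain ⟨h6, h7⟩ := norm_regKernelD_le hδ (z - z₀)
  have h8 := cutDeriv_le hδ (1 - ‖z‖ ^ 2)
  have h9 := cutDeriv_nonneg δ (1 - ‖z‖ ^ 2)
  have h10 := norm_le_one_of_mem hz
  set S := A * (lpDisc p h).toReal
  have hS : 0 ≤ S := by positivity
  have e : 1 * (1 / (2 * δ)) * (1 / (2 * δ) * S) + S * (1 * (1 / δ ^ 2) + 1 / (2 * δ) * (1 / δ * 1)) =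
      7 / 4 * S / δ ^ 2 := by field_simp; ring
  rw [← e]
  constructor
  · unfold correctorD
    refine (norm_add_le _ _).trans ?_
    rw [norm_mul, norm_mul, norm_mul (regCauchy δ h z)]
    gcongr
    refine (norm_add_le _ _).trans ?_
    rw [norm_mul, norm_mul, norm_mul, norm_neg, Complex.norm_real, Real.norm_of_nonneg h9,
      RCLike.norm_conj]
    gcongr
  · unfold correctorDbar
    refine (norm_add_le _ _).trans ?_
    rw [norm_mul, norm_mul, norm_mul (regCauchy δ h z)]
    gcongr
    refine (norm_add_le _ _).trans ?_
    rw [norm_mul, norm_mul, norm_mul, norm_neg, Complex.norm_real, Real.norm_of_nonneg h9]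
    gcongr

lemma norm_oscCorrectorD_le (hp : 2 < p) (hA : IsCauchyConst p A) (hh : MemLpDisc p h) (hδ : 0 < δ)
    (n : ℝ) (z₀ : ℂ) {z : ℂ} (hz : z ∈ closedDisc) :
    ‖oscCorrectorD n δ z₀ h z‖ ≤ A * (lpDisc p h).toReal * (7 / 4 / δ ^ 2 + 2 * |n|) ∧
      ‖oscCorrectorDbar n δ z₀ h z‖ ≤ A * (lpDisc p h).toReal * (7 / 4 / δ ^ 2 + 2 * |n|) := by
  obtain ⟨h1, h2⟩ := norm_correctorD_le hp hA hh hδ z₀ hz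
  have h3 := (norm_corrector_le hp hA hh hδ z₀ hz).2
  set S := A * (lpDisc p h).toReal
  have e : S * (7 / 4 / δ ^ 2 + 2 * |n|) = 7 / 4 * S / δ ^ 2 + 2 * |n| * S := by ring
  rw [e]
  have hI : ‖(2 * Complex.I * n : ℂ)‖ = 2 * |n| := by simp
  constructor
  · unfold oscCorrectorD
    refine (norm_add_le _ _).trans ?_
    rw [norm_mul, norm_osc, one_mul, norm_mul, norm_mul, norm_osc, mul_one, norm_mul, hI,
      mul_comm ‖corrector _ _ _ _‖, mul_assoc (2 * |n|)]
    gcongr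
  · unfold oscCorrectorDbar
    refine (norm_add_le _ _).trans ?_
    rw [norm_mul, norm_osc, one_mul, norm_mul, norm_mul, norm_osc, mul_one, norm_mul, hI,
      RCLike.norm_conj, mul_comm ‖corrector _ _ _ _‖, mul_assoc (2 * |n|)]
    gcongr

/-- The global Lipschitz bound. -/
lemma lipschitzWith_oscCorrector (hp : 2 < p) (hA : IsCauchyConst p A) (hh : MemLpDisc p h)
    (hδ : 0 < δ) (n : ℝ) (z₀ : ℂ) :
    LipschitzWith (Real.toNNReal (A * (lpDisc p h).toReal * (7 / 2 / δ ^ 2 + 4 * |n|)))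
      (oscCorrector n δ z₀ h) := by
  have hd := hasFDerivAt_oscCorrector n hδ z₀ (hh.integrable hp)
  refine lipschitzWith_of_nnnorm_fderiv_le (𝕜 := ℝ) (fun z => (hd z).differentiableAt) fun z => ?_
  rw [(hd z).fderiv, ← NNReal.coe_le_coe, coe_nnnorm, Real.coe_toNNReal _ (by positivity)]
  refine (norm_wirt_le _ _).trans ?_
  by_cases hz : z ∈ disc
  · obtain ⟨h1, h2⟩ := norm_oscCorrectorD_le hp hA hh hδ n z₀ (disc_subset_closedDisc hz)
    refine (add_le_add h1 h2).trans_eq ?_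
    ring
  · obtain ⟨-, h1, h2⟩ := oscCorrector_eq_zero n δ z₀ h hz
    rw [h1, h2]
    simp only [norm_zero, add_zero]
    positivity

/-- The Cauchy operator inverts `∂̄` on `oscCorrector`, which vanishes on the boundary. -/
lemma cauchy_oscCorrectorDbar (hp : 2 < p) (hA : IsCauchyConst p A) (hh : MemLpDisc p h)
    (hδ : 0 < δ) (n : ℝ) (z₀ z : ℂ) :
    cauchy (oscCorrectorDbar n δ z₀ h) z = oscCorrector n δ z₀ h z := by
  have hL := lipschitzWith_oscCorrector hp hA hh hδ n z₀
  have hc : HasCompactSupport (oscCorrector n δ z₀ h) := by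
    refine HasCompactSupport.intro (isCompact_closedBall (0 : ℂ) 1) fun w hw => ?_
    exact (oscCorrector_eq_zero n δ z₀ h fun hd => hw (disc_subset_closedDisc hd)).1
  have hP := (integral_dbar_div_sub hL hc
    (hasFDerivAt_oscCorrector n hδ z₀ (hh.integrable hp)) z).2
  have h1 : ∫ w, oscCorrectorDbar n δ z₀ h w / (z - w) ∂discMeasure =
      ∫ w, oscCorrectorDbar n δ z₀ h w / (z - w) := by
    refine setIntegral_eq_integral_of_forall_compl_eq_zero fun w hw => ?_
    rw [(oscCorrector_eq_zero n δ z₀ h hw).2.2, zero_div]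
  have hpi : (Real.pi : ℂ) ≠ 0 := by exact_mod_cast Real.pi_ne_zero
  rw [cauchy, h1, hP]
  field_simp

/-- The defect of dividing by, and multiplying back with, the `∂̄`-derivative of the phase. -/
def defect (δ : ℝ) (z₀ z : ℂ) : ℝ :=
  1 - cut δ (1 - ‖z‖ ^ 2) * (1 - δ ^ 2 / (‖z - z₀‖ ^ 2 + δ ^ 2))

lemma defect_bounds (hδ : 0 < δ) (z₀ z : ℂ) :
    0 ≤ defect δ z₀ z ∧ defect δ z₀ z ≤ 1 ∧
      defect δ z₀ z ≤ (1 - cut δ (1 - ‖z‖ ^ 2)) + δ ^ 2 / (‖z - z₀‖ ^ 2 + δ ^ 2) := by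
  unfold defect
  have h1 := cut_nonneg δ (1 - ‖z‖ ^ 2)
  have h2 := cut_le_one hδ (1 - ‖z‖ ^ 2)
  have h3 : 0 ≤ δ ^ 2 / (‖z - z₀‖ ^ 2 + δ ^ 2) := by positivity
  have h4 : δ ^ 2 / (‖z - z₀‖ ^ 2 + δ ^ 2) ≤ 1 := by
    rw [div_le_one (by positivity)]
    nlinarith [sq_nonneg ‖z - z₀‖]
  refine ⟨?_, ?_, ?_⟩ <;> nlinarith [mul_nonneg h1 h3]

lemma lintegral_defect_le (hδ : 0 < δ) {z₀ : ℂ} (hz₀ : z₀ ∈ closedDisc) :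
    ∫⁻ z, ENNReal.ofReal (defect δ z₀ z) ∂discMeasure ≤ ENNReal.ofReal (12 * δ) := by
  have hpi := Real.pi_lt_d2
  have hpi0 := Real.pi_pos
  calc _ ≤ ∫⁻ z, (ENNReal.ofReal (1 - cut δ (1 - ‖z‖ ^ 2)) +
        ENNReal.ofReal (δ ^ 2 / (‖z - z₀‖ ^ 2 + δ ^ 2))) ∂discMeasure := by
        refine lintegral_mono fun z => ?_
        rw [← ENNReal.ofReal_add (sub_nonneg.2 (cut_le_one hδ _)) (by positivity)]
        exact ENNReal.ofReal_le_ofReal (defect_bounds hδ z₀ z).2.2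
    _ ≤ ENNReal.ofReal (Real.pi * (Real.pi * δ) / 2) + ENNReal.ofReal (2 * Real.pi * δ) := by
        rw [lintegral_add_right _ (by fun_prop)]
        exact add_le_add (lintegral_one_sub_cut_le hδ) (lintegral_bump_le hδ hz₀)
    _ ≤ _ := by
        rw [← ENNReal.ofReal_add (by positivity) (by positivity)]
        apply ENNReal.ofReal_le_ofReal
        have : Real.pi ^ 2 / 2 + 2 * Real.pi ≤ 12 := by nlinarith
        nlinarith

/-- The decomposition on which the main estimate rests. -/
lemma osc_mul_regCauchy_eq {n : ℝ} (hn : n ≠ 0) (hδ : 0 < δ) (z₀ : ℂ) (h : ℂ → ℂ) (z : ℂ) :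
    osc n z₀ z * regCauchy δ h z = osc n z₀ z * regCauchy δ h z * (defect δ z₀ z : ℂ) -
      1 / (2 * Complex.I * n) * (osc n z₀ z * correctorDbar δ z₀ h z) +
      1 / (2 * Complex.I * n) * oscCorrectorDbar n δ z₀ h z := by
  have hn' : (n : ℂ) ≠ 0 := by exact_mod_cast hn
  have hI := Complex.I_ne_zero
  have h1 := conj_mul_regKernel hδ (z - z₀)
  have h2 : (defect δ z₀ z : ℂ) = 1 - discCut δ z * (conj (z - z₀) * regKernel δ (z - z₀)) := by
    rw [h1, defect, discCut]
    push_cast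
    ring
  -- the derivative of the phase cancels `regKernel` up to the defect
  rw [h2, oscCorrectorDbar, corrector]
  field_simp
  ring

end bounds

end Bukhgeim

/-! ### The decay estimate -/

namespace Bukhgeim

/-- The scale `δ = N^{-2/(2p+1)}` balances all error terms. -/
lemma scale_bounds {p N : ℝ} (hp : 2 < p) (hN : 1 < N) :
    ∃ δ : ℝ, 0 < δ ∧ δ ^ (1 / p) = N ^ (-(2 / (p * (2 * p + 1)))) ∧
      δ ≤ N ^ (-(2 / (p * (2 * p + 1)))) ∧ N⁻¹ / δ ^ 2 ≤ N ^ (-(2 / (p * (2 * p + 1)))) ∧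
      1 / δ ^ 2 ≤ N ∧ 1 ≤ N * δ ∧ (N * δ) ^ (-(2 / p)) ≤ N ^ (-(2 / (p * (2 * p + 1)))) := by
  have hN0 : 0 < N := by linarith
  have hp0 : 0 < p := by linarith
  have h2p : 0 < 2 * p + 1 := by linarith
  have hle : ∀ {a b : ℝ}, a ≤ b → N ^ a ≤ N ^ b := fun h => Real.rpow_le_rpow_of_exponent_le hN.le h
  have e2 : 1 / (N ^ (-(2 / (2 * p + 1)))) ^ 2 = N ^ (4 / (2 * p + 1)) := by
    rw [← Real.rpow_natCast, ← Real.rpow_mul hN0.le, one_div, ← Real.rpow_neg hN0.le]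
    congr 1; push_cast; ring
  have e3 : N * N ^ (-(2 / (2 * p + 1))) = N ^ ((2 * p - 1) / (2 * p + 1)) := by
    nth_rewrite 1 [← Real.rpow_one N]
    rw [← Real.rpow_add hN0]
    congr 1; field_simp; ring
  refine ⟨N ^ (-(2 / (2 * p + 1))), by positivity, ?_, ?_, ?_, ?_, ?_, ?_⟩
  · rw [← Real.rpow_mul hN0.le]
    congr 1; field_simp
  · apply hle
    rw [neg_le_neg_iff, div_le_div_iff₀ (by positivity) h2p]
    nlinarith
  · rw [div_eq_mul_one_div, e2, ← Real.rpow_neg_one, ← Real.rpow_add hN0]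
    apply hle
    rw [neg_add_le_iff_le_add, ← sub_eq_add_neg, le_sub_iff_add_le, ← sub_nonneg]
    have : 1 - (4 / (2 * p + 1) + 2 / (p * (2 * p + 1))) = (p - 2) / p := by field_simp; ring
    rw [this]
    exact div_nonneg (by linarith) hp0.le
  · rw [e2]
    nth_rewrite 2 [← Real.rpow_one N]
    apply hle
    rw [div_le_one h2p]; linarith
  · rw [e3]
    exact Real.one_le_rpow hN.le (div_nonneg (by linarith) h2p.le)
  · rw [e3, ← Real.rpow_mul hN0.le]
    apply hle
    rw [mul_neg, neg_le_neg_iff, div_mul_div_comm, div_le_div_iff₀ (by positivity) (by positivity)]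
    nlinarith [mul_pos hp0 h2p]

lemma holderNorm_congr {α : ℝ} {f g : ℂ → ℂ} (h : ∀ z ∈ closedDisc, f z = g z) :
    holderNorm α f ≤ holderNorm α g := by
  refine holderNorm_le (fun z hz => ?_) fun z hz w hw hzw => ?_
  · rw [h z hz]
    exact le_iSup₂ (f := fun z (_ : z ∈ closedDisc) => ‖g z‖ₑ) z hz
  · have : 0 < ‖z - w‖ ^ α := Real.rpow_pos_of_pos (norm_pos_iff.2 (sub_ne_zero.2 hzw)) _
    rw [← ENNReal.div_le_iff (by simpa using this) ENNReal.ofReal_ne_top, h z hz, h w hw]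
    exact le_iSup₂_of_le z hz (le_iSup₂_of_le w hw (le_iSup_of_le hzw le_rfl))

/-- Interpolation: a function bounded by `S / (2 K)` and `4 S`-Lipschitz has `C^{1-θ}` norm
`O(S K^{-θ})`. -/
lemma holderNorm_le_of_bounded_lipschitz {f : ℂ → ℂ} {S K θ : ℝ} (hS : 0 ≤ S) (hK : 1 ≤ K)
    (hθ0 : 0 ≤ θ) (hθ1 : θ ≤ 1) (h1 : ∀ z ∈ closedDisc, ‖f z‖ ≤ S / (2 * K))
    (h2 : ∀ z ∈ closedDisc, ∀ w ∈ closedDisc, ‖f z - f w‖ ≤ 4 * S * ‖z - w‖) :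
    holderNorm (1 - θ) f ≤ ENNReal.ofReal (5 * S * K ^ (-θ)) := by
  have hK0 : 0 < K := by linarith
  have hKθ : K⁻¹ ≤ K ^ (-θ) := by
    rw [← Real.rpow_neg_one]
    exact Real.rpow_le_rpow_of_exponent_le hK (by linarith)
  have hb : ∀ z ∈ closedDisc, ‖f z‖ₑ ≤ ENNReal.ofReal (S * K ^ (-θ)) := by
    intro z hz
    rw [← ofReal_norm]
    apply ENNReal.ofReal_le_ofReal
    calc _ ≤ S / (2 * K) := h1 z hz
      _ = S * (K⁻¹ / 2) := by field_simp
      _ ≤ S * K ^ (-θ) := by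
        have := inv_nonneg.2 hK0.le
        gcongr
        linarith
  have hd : ∀ z ∈ closedDisc, ∀ w ∈ closedDisc, z ≠ w → ‖f z - f w‖ₑ ≤
      ENNReal.ofReal (4 * S * K ^ (-θ)) * ENNReal.ofReal (‖z - w‖ ^ (1 - θ)) := by
    intro z hz w hw hzw
    have hD : 0 < ‖z - w‖ := norm_pos_iff.2 (sub_ne_zero.2 hzw)
    rw [← ofReal_norm, ← ENNReal.ofReal_mul (by positivity)]
    apply ENNReal.ofReal_le_ofReal
    set D := ‖z - w‖
    -- the Lipschitz bound is used for `D ≤ K⁻¹`, the bound by the supremum beyond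
    rcases le_total D K⁻¹ with hDK | hDK
    · calc _ ≤ 4 * S * D := h2 z hz w hw
        _ = 4 * S * (D ^ θ * D ^ (1 - θ)) := by
          rw [← Real.rpow_add hD, add_sub_cancel, Real.rpow_one]
        _ ≤ 4 * S * (K⁻¹ ^ θ * D ^ (1 - θ)) := by gcongr
        _ = _ := by rw [Real.inv_rpow hK0.le, ← Real.rpow_neg hK0.le]; ring
    · have hS' : S / (2 * K) + S / (2 * K) = S * K⁻¹ := by field_simp; ring
      calc _ ≤ ‖f z‖ + ‖f w‖ := norm_sub_le _ _
        _ ≤ S * K⁻¹ := (add_le_add (h1 z hz) (h1 w hw)).trans_eq hS'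
        _ = S * (K⁻¹ ^ θ * K⁻¹ ^ (1 - θ)) := by
          rw [← Real.rpow_add (by positivity), add_sub_cancel, Real.rpow_one]
        _ ≤ S * (K⁻¹ ^ θ * D ^ (1 - θ)) := by
          have : 0 ≤ 1 - θ := by linarith
          gcongr
        _ = 1 * S * K ^ (-θ) * D ^ (1 - θ) := by
          rw [Real.inv_rpow hK0.le, ← Real.rpow_neg hK0.le]; ring
        _ ≤ _ := by gcongr; norm_num
  refine (holderNorm_le hb hd).trans_eq ?_
  rw [← ENNReal.ofReal_add (by positivity) (by positivity)]
  congr 1; ring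

lemma aestronglyMeasurable_of_holderNorm {α : ℝ} (hα : 0 < α) {f : ℂ → ℂ} (hf : holderNorm α f < ∞) :
    AEStronglyMeasurable f discMeasure :=
  ((continuousOn_of_holderNorm hα hf).mono disc_subset_closedDisc).aestronglyMeasurable
    measurableSet_disc

lemma holderExponent_pos {p : ℝ} (hp : 2 < p) : 0 < 1 - 2 / p := by
  rw [sub_pos, div_lt_one (by linarith)]; exact hp

/-- The remainder, small in `L^p`, in the decomposition of `e^{inR} 𝒞̄h` into a small term and a
`∂̄`-derivative. -/
def remainder (n δ : ℝ) (z₀ : ℂ) (h : ℂ → ℂ) (z : ℂ) : ℂ :=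
  osc n z₀ z * (cauchyBar h z - regCauchy δ h z) +
    (osc n z₀ z * regCauchy δ h z * (defect δ z₀ z : ℂ) +
      -(1 / (2 * Complex.I * n)) * (osc n z₀ z * correctorDbar δ z₀ h z))

lemma lpDisc_add_le {p : ℝ} (hp : 2 < p) {f g : ℂ → ℂ} (hf : AEStronglyMeasurable f discMeasure)
    (hg : AEStronglyMeasurable g discMeasure) :
    lpDisc p (fun z => f z + g z) ≤ lpDisc p f + lpDisc p g :=
  eLpNorm_add_le hf hg (one_le_ofReal_p hp)

lemma lpDisc_remainder_le {p : ℝ} (hp : 2 < p) {A : ℝ≥0} (hA : IsCauchyConst p A) {h : ℂ → ℂ}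
    (hh : MemLpDisc p h) {n δ : ℝ} (hδ : 0 < δ) {z₀ : ℂ} (hz₀ : z₀ ∈ closedDisc) :
    AEStronglyMeasurable (remainder n δ z₀ h) discMeasure ∧
    lpDisc p (remainder n δ z₀ h) ≤ ENNReal.ofReal (4 * δ) * lpDisc p h +
      (ENNReal.ofReal (A * (lpDisc p h).toReal * (12 * δ ^ (1 / p))) +
        ENNReal.ofReal (4 * (A * (lpDisc p h).toReal * (|n|⁻¹ / δ ^ 2)))) := by
  have hp1 : 1 ≤ p := by linarith
  set S := A * (lpDisc p h).toReal with hSdef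
  have hS : 0 ≤ S := by positivity
  have hI := hh.integrable hp
  have mosc : Measurable (osc n z₀) := (continuous_osc n z₀).measurable
  have mreg : Measurable (regCauchy δ h) :=
    (continuous_iff_continuousAt.2 fun z => (hasFDerivAt_regCauchy hδ hI z).continuousAt).measurable
  have mdef : Measurable fun z => (defect δ z₀ z : ℂ) := by
    unfold defect cut; fun_prop
  have mcor : Measurable (correctorDbar δ z₀ h) :=
    (measurable_wirt (hasFDerivAt_corrector hδ z₀ hI)).2
  have mg : AEStronglyMeasurable (cauchyBar h) discMeasure :=
    aestronglyMeasurable_of_holderNorm (holderExponent_pos hp)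
      ((hA h hh).2.trans_lt (ENNReal.mul_lt_top ENNReal.coe_lt_top hh.eLpNorm_lt_top))
  have m1 : AEStronglyMeasurable (fun z => osc n z₀ z * (cauchyBar h z - regCauchy δ h z))
      discMeasure := mosc.aestronglyMeasurable.mul (mg.sub mreg.aestronglyMeasurable)
  have m2 : AEStronglyMeasurable (fun z => osc n z₀ z * regCauchy δ h z * (defect δ z₀ z : ℂ))
      discMeasure := ((mosc.mul mreg).mul mdef).aestronglyMeasurable
  have m3 : AEStronglyMeasurable
      (fun z => -(1 / (2 * Complex.I * n)) * (osc n z₀ z * correctorDbar δ z₀ h z)) discMeasure :=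
    ((mosc.mul mcor).const_mul _).aestronglyMeasurable
  refine ⟨m1.add (m2.add m3), ?_⟩
  refine (lpDisc_add_le hp m1 (m2.add m3)).trans ?_
  gcongr ?_ + ?_
  · refine le_trans (eLpNorm_mono fun z => ?_) (lpDisc_cauchyBar_sub_regCauchy_le hp hh hδ)
    rw [norm_mul, norm_osc, one_mul]
  refine (lpDisc_add_le hp m2 m3).trans ?_
  gcongr ?_ + ?_
  · refine (lpDisc_le_of_le_weight hp1 (M := S) (c := 12 * δ) (θ := defect δ z₀) hS (by positivity)
      (fun z hz => ?_) (fun z _ => (defect_bounds hδ z₀ z).1)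
      (fun z _ => (defect_bounds hδ z₀ z).2.1) (lintegral_defect_le hδ hz₀)).trans ?_
    · rw [norm_mul, norm_mul, norm_osc, one_mul, Complex.norm_real,
        Real.norm_of_nonneg (defect_bounds hδ z₀ z).1]
      gcongr
      · exact (defect_bounds hδ z₀ z).1
      · exact (norm_regCauchy_le hp hA hh hδ (disc_subset_closedDisc hz)).1
    · rw [Real.mul_rpow (by norm_num) hδ.le]
      apply ENNReal.ofReal_le_ofReal
      gcongr
      calc (12 : ℝ) ^ (1 / p) ≤ 12 ^ (1 : ℝ) := by
            gcongr
            · norm_num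
            · rw [div_le_one (by linarith)]; exact hp1
        _ = 12 := Real.rpow_one _
  · refine lpDisc_le_of_bound hp1 (by positivity) fun z hz => ?_
    rw [norm_mul, norm_mul, norm_osc, one_mul, norm_neg]
    have hc : ‖(1 / (2 * Complex.I * n) : ℂ)‖ = |n|⁻¹ / 2 := by
      simp; ring
    rw [hc]
    calc _ ≤ |n|⁻¹ / 2 * (7 / 4 * S / δ ^ 2) := by
          gcongr
          exact (norm_correctorD_le hp hA hh hδ z₀ (disc_subset_closedDisc hz)).2
      _ = 7 / 8 * (S * (|n|⁻¹ / δ ^ 2)) := by ring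
      _ ≤ 1 * (S * (|n|⁻¹ / δ ^ 2)) := by gcongr; norm_num
      _ = _ := one_mul _

lemma holderNorm_oscCorrector_le {p : ℝ} (hp : 2 < p) {A : ℝ≥0} (hA : IsCauchyConst p A) {h : ℂ → ℂ}
    (hh : MemLpDisc p h) {n δ : ℝ} (hδ : 0 < δ) (z₀ : ℂ) (hn : 1 < |n|) (h1 : 1 / δ ^ 2 ≤ |n|)
    (h2 : 1 ≤ |n| * δ) :
    holderNorm (1 - 2 / p) (fun z => 1 / (2 * Complex.I * n) * oscCorrector n δ z₀ h z) ≤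
      ENNReal.ofReal (5 * (A * (lpDisc p h).toReal) * (|n| * δ) ^ (-(2 / p))) := by
  set S := A * (lpDisc p h).toReal with hSdef
  have hS : 0 ≤ S := by positivity
  have hn0 : 0 < |n| := by linarith
  have hp0 : 0 < p := by linarith
  have hc : ‖(1 / (2 * Complex.I * n) : ℂ)‖ = |n|⁻¹ / 2 := by
    simp; ring
  refine holderNorm_le_of_bounded_lipschitz hS h2 (by positivity)
    (by rw [div_le_one hp0]; exact hp.le) (fun z hz => ?_) fun z _ w _ => ?_
  · rw [norm_mul, oscCorrector, norm_mul, norm_osc, one_mul, hc]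
    calc _ ≤ |n|⁻¹ / 2 * (S / (2 * δ)) := by
          gcongr
          exact (norm_corrector_le hp hA hh hδ z₀ hz).1
      _ = 1 / 2 * (S / (2 * (|n| * δ))) := by field_simp
      _ ≤ 1 * (S / (2 * (|n| * δ))) := by gcongr; norm_num
      _ = _ := one_mul _
  · rw [← mul_sub, norm_mul, hc]
    have hL := (lipschitzWith_oscCorrector hp hA hh hδ n z₀).norm_sub_le z w
    rw [Real.coe_toNNReal _ (by positivity)] at hL
    calc _ ≤ |n|⁻¹ / 2 * (S * (7 / 2 / δ ^ 2 + 4 * |n|) * ‖z - w‖) := by gcongr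
      _ ≤ |n|⁻¹ / 2 * (S * (8 * |n|) * ‖z - w‖) := by
          gcongr
          have : 7 / 2 / δ ^ 2 = 7 / 2 * (1 / δ ^ 2) := by ring
          linarith
      _ = _ := by field_simp; ring

/-- The decay of `𝒞(e^{inR} 𝒞̄h)` as `|n| → ∞`. -/
theorem holderNorm_cauchy_osc_cauchyBar_le {p : ℝ} (hp : 2 < p) {A : ℝ≥0} (hA : IsCauchyConst p A)
    {h : ℂ → ℂ} (hh : MemLpDisc p h) {n : ℝ} (hn : 1 < |n|) {z₀ : ℂ} (hz₀ : z₀ ∈ closedDisc) :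
    holderNorm (1 - 2 / p) (cauchy fun z => osc n z₀ z * cauchyBar h z) ≤
      400 * (A + 11) * A * lpDisc p h * ENNReal.ofReal (|n| ^ (-(2 / (p * (2 * p + 1))))) := by
  obtain ⟨δ, hδ, e1, h2, h3, h4, h5, h6⟩ := scale_bounds hp hn
  set τ := |n| ^ (-(2 / (p * (2 * p + 1)))) with hτ
  have hτ0 : 0 ≤ τ := by positivity
  have hI := hh.integrable hp
  have hn0 : n ≠ 0 := by rintro rfl; simp at hn; linarith
  set H := (lpDisc p h).toReal with hH
  have hHtop : lpDisc p h ≠ ∞ := hh.eLpNorm_ne_top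
  have hHe : lpDisc p h = ENNReal.ofReal H := (ENNReal.ofReal_toReal hHtop).symm
  obtain ⟨hRm, hR⟩ := lpDisc_remainder_le hp hA hh (n := n) hδ hz₀
  have hAe : (A : ℝ≥0∞) = ENNReal.ofReal A := (ENNReal.ofReal_coe_nnreal).symm
  have hH0 : 0 ≤ H := ENNReal.toReal_nonneg
  have hR2 : lpDisc p (remainder n δ z₀ h) ≤ ENNReal.ofReal ((4 + 16 * A) * H * τ) := by
    rw [← hH] at hR
    refine hR.trans ?_
    rw [hHe, e1, ← ENNReal.ofReal_mul (by positivity), ← ENNReal.ofReal_add (by positivity)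
      (by positivity), ← ENNReal.ofReal_add (by positivity) (by positivity)]
    apply ENNReal.ofReal_le_ofReal
    calc _ ≤ 4 * τ * H + (A * H * (12 * τ) + 4 * (A * H * τ)) := by gcongr
      _ = _ := by ring
  have hRmem : MemLpDisc p (remainder n δ z₀ h) := ⟨hRm, hR2.trans_lt ENNReal.ofReal_lt_top⟩
  set c : ℂ := 1 / (2 * Complex.I * n) with hc
  have hDmem : MemLpDisc p (fun z => c * oscCorrectorDbar n δ z₀ h z) := by
    have hm := (measurable_wirt (hasFDerivAt_oscCorrector n hδ z₀ hI)).2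
    have : MemLpDisc p (oscCorrectorDbar n δ z₀ h) :=
      ⟨hm.aestronglyMeasurable, (lpDisc_le_of_bound (by linarith) (by positivity) fun z hz =>
        (norm_oscCorrectorD_le hp hA hh hδ n z₀ (disc_subset_closedDisc hz)).2).trans_lt
          ENNReal.ofReal_lt_top⟩
    exact this.const_mul c
  have hdec : (fun z => osc n z₀ z * cauchyBar h z) =
      fun z => remainder n δ z₀ h z + c * oscCorrectorDbar n δ z₀ h z := by
    funext z
    have := osc_mul_regCauchy_eq hn0 hδ z₀ h z
    rw [remainder]
    linear_combination this
  rw [hdec]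
  have hcong : holderNorm (1 - 2 / p)
      (cauchy fun z => remainder n δ z₀ h z + c * oscCorrectorDbar n δ z₀ h z) ≤
      holderNorm (1 - 2 / p) (fun z => cauchy (remainder n δ z₀ h) z + c * oscCorrector n δ z₀ h z) :=
    holderNorm_congr fun z hz => by
      rw [cauchy_add hp hRmem hDmem hz, cauchy_const_mul,
        cauchy_oscCorrectorDbar hp hA hh hδ n z₀ z]
  refine hcong.trans ((holderNorm_add_le _ _ _).trans ?_)
  have t1 : holderNorm (1 - 2 / p) (cauchy (remainder n δ z₀ h)) ≤
      ENNReal.ofReal (A * ((4 + 16 * A) * H * τ)) := by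
    refine ((hA _ hRmem).1).trans ?_
    rw [ENNReal.ofReal_mul A.coe_nonneg, ← hAe]
    gcongr
  have t2 := holderNorm_oscCorrector_le hp hA hh hδ z₀ hn h4 h5
  rw [← hc] at t2
  have t3 : ENNReal.ofReal (5 * (A * H) * (|n| * δ) ^ (-(2 / p))) ≤
      ENNReal.ofReal (5 * (A * H) * τ) := by gcongr
  refine (add_le_add t1 (t2.trans t3)).trans ?_
  have h400 : (400 * (A + 11) * A * lpDisc p h * ENNReal.ofReal τ : ℝ≥0∞) =
      ENNReal.ofReal (400 * (A + 11) * A * H * τ) := by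
    have hA11 : (A : ℝ≥0∞) + 11 = ENNReal.ofReal (A + 11) := by
      rw [ENNReal.ofReal_add A.coe_nonneg (by norm_num), ← hAe]; simp
    rw [hA11, hHe, hAe, show (400 : ℝ≥0∞) = ENNReal.ofReal 400 by simp,
      ← ENNReal.ofReal_mul (by positivity), ← ENNReal.ofReal_mul (by positivity),
      ← ENNReal.ofReal_mul (by positivity), ← ENNReal.ofReal_mul (by positivity)]
  rw [h400, ← ENNReal.ofReal_add (by positivity) (by positivity)]
  apply ENNReal.ofReal_le_ofReal
  have hAHτ : 0 ≤ (A : ℝ) * H * τ := by positivity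
  have hA0 : (0 : ℝ) ≤ A := A.coe_nonneg
  calc A * ((4 + 16 * A) * H * τ) + 5 * (A * H) * τ = (9 + 16 * A) * (A * H * τ) := by ring
    _ ≤ (400 * (A + 11)) * (A * H * τ) := by gcongr ?_ * _; linarith
    _ = _ := by ring

end Bukhgeim

/-! ### The operators of the fixed-point equations -/

namespace Bukhgeim

section

variable {p : ℝ} {A : ℝ≥0} {n : ℝ} {z₀ : ℂ} {q f g : ℂ → ℂ}

lemma MemHolderDisc.aestronglyMeasurable {α : ℝ} (hf : MemHolderDisc α f) :
    AEStronglyMeasurable f discMeasure :=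
  (hf.1.mono disc_subset_closedDisc).aestronglyMeasurable measurableSet_disc

lemma supDisc_le_holderNorm (α : ℝ) (f : ℂ → ℂ) : supDisc f ≤ holderNorm α f := by
  rw [supDisc, eLpNorm_exponent_top]
  refine eLpNormEssSup_le_of_ae_enorm_bound ?_
  filter_upwards [ae_restrict_mem measurableSet_disc] with z hz
  exact enorm_le_holderNorm (disc_subset_closedDisc hz)

lemma MemHolderDisc.conj {α : ℝ} (hf : MemHolderDisc α f) : MemHolderDisc α fun z => conj (f z) :=
  ⟨Complex.continuous_conj.comp_continuousOn hf.1, by rw [holderNorm_conj]; exact hf.2⟩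

lemma supDisc_conj (f : ℂ → ℂ) : supDisc (fun z => conj (f z)) = supDisc f :=
  eLpNorm_congr_norm_ae (ae_of_all _ fun z => by simp)

lemma MemHolderDisc.const_mul {α : ℝ} (hf : MemHolderDisc α f) (c : ℂ) :
    MemHolderDisc α fun z => c * f z :=
  ⟨continuousOn_const.mul hf.1, (holderNorm_const_mul_le α c f).trans_lt
    (ENNReal.mul_lt_top enorm_lt_top hf.2)⟩

lemma MemHolderDisc.sub {α : ℝ} (hf : MemHolderDisc α f) (hg : MemHolderDisc α g) :
    MemHolderDisc α (f - g) := by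
  refine ⟨hf.1.sub hg.1, ?_⟩
  have e : f - g = fun z => f z + (-1) * g z := by
    funext z; simp [sub_eq_add_neg]
  rw [e]
  exact (holderNorm_add_le _ _ _).trans_lt
    (ENNReal.add_lt_top.2 ⟨hf.2, (hg.const_mul (-1)).2⟩)

lemma memLpDisc_osc_mul (hq : MemLpDisc p q) (hf : MemHolderDisc (1 - 2 / p) f) :
    MemLpDisc p (fun w => osc n z₀ w * q w * f w) ∧
      lpDisc p (fun w => osc n z₀ w * q w * f w) ≤ lpDisc p q * supDisc f := by
  have hm : AEStronglyMeasurable (fun w => osc n z₀ w * q w * f w) discMeasure :=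
    ((continuous_osc n z₀).measurable.aestronglyMeasurable.mul hq.aestronglyMeasurable).mul
      hf.aestronglyMeasurable
  have hle : lpDisc p (fun w => osc n z₀ w * q w * f w) ≤ lpDisc p q * supDisc f := by
    have h1 : lpDisc p (fun w => osc n z₀ w * q w * f w) = lpDisc p (q • f) :=
      eLpNorm_congr_norm_ae (ae_of_all _ fun w => by
        rw [norm_mul, norm_mul, norm_osc, one_mul, Pi.smul_apply', smul_eq_mul, norm_mul])
    rw [h1]
    unfold lpDisc supDisc
    exact eLpNorm_smul_le_eLpNorm_mul_eLpNorm_top (ENNReal.ofReal p) f hq.aestronglyMeasurable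
  refine ⟨⟨hm, hle.trans_lt (ENNReal.mul_lt_top hq.eLpNorm_lt_top ?_)⟩, hle⟩
  exact (supDisc_le_holderNorm _ f).trans_lt hf.2

lemma memHolderDisc_opT_and_le (hp : 2 < p) (hA : IsCauchyConst p A) (hn : 1 < |n|)
    (hz₀ : z₀ ∈ disc) (hq : MemLpDisc p q) (hf : MemHolderDisc (1 - 2 / p) f) :
    MemHolderDisc (1 - 2 / p) (opT n z₀ q f) ∧ holderNorm (1 - 2 / p) (opT n z₀ q f) ≤
      400 * (A + 11) * A * lpDisc p q * ENNReal.ofReal (|n| ^ (-(2 / (p * (2 * p + 1))))) *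
        supDisc f := by
  obtain ⟨hm, hle⟩ := memLpDisc_osc_mul (n := n) (z₀ := z₀) hq hf
  have h1 := holderNorm_cauchy_osc_cauchyBar_le hp hA hm (n := -n) (by rwa [abs_neg])
    (disc_subset_closedDisc hz₀)
  rw [abs_neg] at h1
  have hbound : holderNorm (1 - 2 / p) (opT n z₀ q f) ≤
      400 * (A + 11) * A * lpDisc p q * ENNReal.ofReal (|n| ^ (-(2 / (p * (2 * p + 1))))) *
        supDisc f := by
    refine h1.trans ?_
    calc _ ≤ 400 * (A + 11) * A * (lpDisc p q * supDisc f) *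
          ENNReal.ofReal (|n| ^ (-(2 / (p * (2 * p + 1))))) := by gcongr
      _ = _ := by ring
  have hfin : holderNorm (1 - 2 / p) (opT n z₀ q f) < ∞ := by
    refine h1.trans_lt (ENNReal.mul_lt_top (ENNReal.mul_lt_top ?_ hm.eLpNorm_lt_top)
      ENNReal.ofReal_lt_top)
    have : (400 * (A + 11) * A : ℝ≥0∞) = ((400 * (A + 11) * A : ℝ≥0) : ℝ≥0∞) := by push_cast; rfl
    rw [this]
    exact ENNReal.coe_lt_top
  exact ⟨⟨continuousOn_of_holderNorm (holderExponent_pos hp) hfin, hfin⟩, hbound⟩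

/-- Complex conjugation exchanges the two operators. -/
lemma opTBar_eq (n : ℝ) (z₀ : ℂ) (q f : ℂ → ℂ) :
    opTBar n z₀ q f =
      fun z => conj (opT (-n) z₀ (fun w => conj (q w)) (fun w => conj (f w)) z) := by
  funext z
  unfold opTBar opT
  rw [cauchyBar_eq]
  congr 2
  funext w
  rw [map_mul, conj_osc, cauchyBar_eq]
  simp only [map_mul, conj_osc, neg_neg, Complex.conj_conj]

lemma memHolderDisc_opTBar_and_le (hp : 2 < p) (hA : IsCauchyConst p A) (hn : 1 < |n|)
    (hz₀ : z₀ ∈ disc) (hq : MemLpDisc p q) (hf : MemHolderDisc (1 - 2 / p) f) :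
    MemHolderDisc (1 - 2 / p) (opTBar n z₀ q f) ∧ holderNorm (1 - 2 / p) (opTBar n z₀ q f) ≤
      400 * (A + 11) * A * lpDisc p q * ENNReal.ofReal (|n| ^ (-(2 / (p * (2 * p + 1))))) *
        supDisc f := by
  obtain ⟨h1, h2⟩ := memHolderDisc_opT_and_le (n := -n) hp hA (by rwa [abs_neg]) hz₀ hq.conj hf.conj
  rw [lpDisc_conj, supDisc_conj, abs_neg] at h2
  rw [opTBar_eq, holderNorm_conj]
  exact ⟨h1.conj, h2⟩

lemma cauchy_congr (h : ∀ ξ ∈ disc, f ξ = g ξ) (z : ℂ) : cauchy f z = cauchy g z := by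
  unfold cauchy discMeasure
  congr 1
  exact setIntegral_congr_fun measurableSet_disc fun ξ hξ => by simp only [h ξ hξ]

lemma memLpDisc_osc_mul_cauchyBar (hp : 2 < p) (hA : IsCauchyConst p A) (hf : MemLpDisc p f)
    (n : ℝ) (z₀ : ℂ) : MemLpDisc p fun z => osc n z₀ z * cauchyBar f z := by
  have hfin : holderNorm (1 - 2 / p) (cauchyBar f) < ∞ :=
    (hA f hf).2.trans_lt (ENNReal.mul_lt_top ENNReal.coe_lt_top hf.eLpNorm_lt_top)
  refine ⟨(continuous_osc n z₀).measurable.aestronglyMeasurable.mul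
    (aestronglyMeasurable_of_holderNorm (holderExponent_pos hp) hfin), ?_⟩
  refine (lpDisc_le_of_bound (p := p) (by linarith) ENNReal.toReal_nonneg fun z hz => ?_).trans_lt
    (ENNReal.ofReal_lt_top (r := 4 * (holderNorm (1 - 2 / p) (cauchyBar f)).toReal))
  rw [norm_mul, norm_osc, one_mul, ← toReal_enorm]
  exact ENNReal.toReal_mono hfin.ne (enorm_le_holderNorm (disc_subset_closedDisc hz))

lemma opT_sub (hp : 2 < p) (hA : IsCauchyConst p A) (hq : MemLpDisc p q)
    (hf : MemHolderDisc (1 - 2 / p) f) (hg : MemHolderDisc (1 - 2 / p) g) {z : ℂ}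
    (hz : z ∈ closedDisc) : opT n z₀ q f z - opT n z₀ q g z = opT n z₀ q (f - g) z := by
  have mg := (memLpDisc_osc_mul (n := n) (z₀ := z₀) hq hg).1
  have md := (memLpDisc_osc_mul (n := n) (z₀ := z₀) hq (hf.sub hg)).1
  rw [sub_eq_iff_eq_add]
  unfold opT
  rw [← cauchy_add hp (memLpDisc_osc_mul_cauchyBar hp hA md _ _)
    (memLpDisc_osc_mul_cauchyBar hp hA mg _ _) hz]
  refine cauchy_congr (fun w hw => ?_) z
  rw [← mul_add]
  congr 1
  rw [cauchyBar_eq, cauchyBar_eq, cauchyBar_eq, ← map_add,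
    ← cauchy_add hp md.conj mg.conj (disc_subset_closedDisc hw)]
  congr 2
  funext v
  rw [← map_add]
  congr 1
  simp only [Pi.sub_apply]
  ring

lemma opTBar_sub (hp : 2 < p) (hA : IsCauchyConst p A) (hq : MemLpDisc p q)
    (hf : MemHolderDisc (1 - 2 / p) f) (hg : MemHolderDisc (1 - 2 / p) g) {z : ℂ}
    (hz : z ∈ closedDisc) : opTBar n z₀ q f z - opTBar n z₀ q g z = opTBar n z₀ q (f - g) z := by
  rw [opTBar_eq, opTBar_eq, opTBar_eq, ← map_sub, opT_sub hp hA hq.conj hf.conj hg.conj hz]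
  congr 2
  funext w
  simp

/-- An additive operator of norm less than `2` from `L^∞(Ω)` to `C^α` gives a contraction after
multiplication by `-1/4`. -/
lemma isHalfContraction_of_le {α : ℝ} {T : (ℂ → ℂ) → ℂ → ℂ} {K : ℝ≥0∞} (hK : K < 2)
    (hT : ∀ f, MemHolderDisc α f → MemHolderDisc α (T f) ∧ holderNorm α (T f) ≤ K * supDisc f)
    (hsub : ∀ f g, MemHolderDisc α f → MemHolderDisc α g → ∀ z ∈ closedDisc,
      T f z - T g z = T (f - g) z) :
    IsHalfContraction α fun f z => -(1 / 4) * T f z := by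
  have hKtop : K ≠ ∞ := (hK.trans (by simp)).ne
  refine ⟨fun f hf => (hT f hf).1.const_mul _, (K / 4).toNNReal, ?_, fun f g hf hg => ?_⟩
  · have h2 : K.toReal < 2 := by
      have := (ENNReal.toReal_lt_toReal hKtop (by simp)).2 hK
      simpa using this
    rw [← NNReal.coe_lt_coe, ENNReal.coe_toNNReal_eq_toReal, ENNReal.toReal_div,
      ENNReal.toReal_ofNat]
    push_cast
    linarith
  · rw [ENNReal.coe_toNNReal (ENNReal.div_ne_top hKtop (by simp))]
    have h1 : holderNorm α ((fun z => -(1 / 4) * T f z) - fun z => -(1 / 4) * T g z) ≤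
        holderNorm α fun z => -(1 / 4) * T (f - g) z :=
      holderNorm_congr fun z hz => by
        rw [Pi.sub_apply, ← mul_sub, hsub f g hf hg z hz]
    have h4 : ‖(-(1 / 4) : ℂ)‖ₑ = 4⁻¹ := by
      rw [← ofReal_norm, norm_neg, norm_div, norm_one, RCLike.norm_ofNat, one_div,
        ENNReal.ofReal_inv_of_pos (by norm_num)]
      simp
    refine h1.trans ((holderNorm_const_mul_le α _ _).trans ?_)
    rw [h4, ENNReal.div_eq_inv_mul, mul_assoc]
    gcongr
    exact (hT _ (hf.sub hg)).2.trans (by gcongr; exact supDisc_le_holderNorm _ _)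

end

lemma mul_rpow_neg_lt_two {C : ℝ≥0∞} {n e : ℝ} (hn : 1 < n) (he : 0 < e)
    (h : (C / 2) ^ e < ENNReal.ofReal n) : C * ENNReal.ofReal (n ^ (-e⁻¹)) < 2 := by
  have hn0 : 0 < n := by linarith
  have h1 : C / 2 < ENNReal.ofReal (n ^ e⁻¹) := by
    rw [← ENNReal.ofReal_rpow_of_pos hn0]
    exact (ENNReal.lt_rpow_inv_iff he).2 h
  have h2 : C < ENNReal.ofReal (n ^ e⁻¹) * 2 :=
    (ENNReal.div_lt_iff (Or.inl two_ne_zero) (Or.inl (by simp))).1 h1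
  have hpos : 0 < n ^ (-e⁻¹) := Real.rpow_pos_of_pos hn0 _
  calc C * ENNReal.ofReal (n ^ (-e⁻¹)) < ENNReal.ofReal (n ^ e⁻¹) * 2 * ENNReal.ofReal (n ^ (-e⁻¹)) :=
        (ENNReal.mul_lt_mul_iff_left (by simpa using hpos) ENNReal.ofReal_ne_top).2 h2
    _ = ENNReal.ofReal (n ^ e⁻¹ * n ^ (-e⁻¹)) * 2 := by
        rw [ENNReal.ofReal_mul (by positivity)]; ring
    _ = 2 := by
        rw [← Real.rpow_add hn0, add_neg_cancel, Real.rpow_zero, ENNReal.ofReal_one, one_mul]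

end Bukhgeim

end

theorem theorem5p3p9 (p : ℝ) (hp : 2 < p) :
    -- the four operators are defined on `L^p(Ω)`
    (∀ f : ℂ → ℂ, Bukhgeim.MemLpDisc p f →
      (∀ z ∈ Bukhgeim.closedDisc, Bukhgeim.CauchyConverges f z) ∧
        ∀ᵐ z ∂Bukhgeim.discMeasure, Bukhgeim.BeurlingConverges f z) ∧
    -- they are bounded: finite constants `C_α` and `B_p` exist
    (∃ Ca Bp : ℝ≥0, Bukhgeim.IsCauchyConst p Ca ∧ Bukhgeim.IsBeurlingConst p Bp) ∧
    -- the estimates, for any such constants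
    ∀ Ca Bp : ℝ≥0, Bukhgeim.IsCauchyConst p Ca → Bukhgeim.IsBeurlingConst p Bp →
      ∀ q₁ q₂ : ℂ → ℂ, Bukhgeim.MemLpDisc p q₁ → Bukhgeim.MemLpDisc p q₂ →
      ∀ z₀ ∈ Bukhgeim.disc, ∀ n : ℝ, 1 < n →
        (∀ f : ℂ → ℂ, Bukhgeim.MemHolderDisc (1 - 2 / p) f →
          (Bukhgeim.MemHolderDisc (1 - 2 / p) (Bukhgeim.opT n z₀ q₁ f) ∧
            Bukhgeim.holderNorm (1 - 2 / p) (Bukhgeim.opT n z₀ q₁ f) ≤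
              Bukhgeim.boundConst p Ca Bp q₁ q₂ *
                ENNReal.ofReal (n ^ (-(2 / (p * (2 * p + 1))))) * Bukhgeim.supDisc f) ∧
          (Bukhgeim.MemHolderDisc (1 - 2 / p) (Bukhgeim.opTBar n z₀ q₂ f) ∧
            Bukhgeim.holderNorm (1 - 2 / p) (Bukhgeim.opTBar n z₀ q₂ f) ≤
              Bukhgeim.boundConst p Ca Bp q₁ q₂ *
                ENNReal.ofReal (n ^ (-(2 / (p * (2 * p + 1))))) * Bukhgeim.supDisc f)) ∧
        -- contraction property for large `n`
        ((Bukhgeim.boundConst p Ca Bp q₁ q₂ / 2) ^ (p * (2 * p + 1) / 2) < ENNReal.ofReal n →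
          Bukhgeim.IsHalfContraction (1 - 2 / p) (Bukhgeim.opS n z₀ q₁) ∧
            Bukhgeim.IsHalfContraction (1 - 2 / p) (Bukhgeim.opSBar n z₀ q₂)) := by
  obtain ⟨Ca₀, hCa₀⟩ := Bukhgeim.exists_isCauchyConst hp
  obtain ⟨Bp₀, hBp₀⟩ := Bukhgeim.exists_isBeurlingConst hp
  refine ⟨fun f hf => ⟨fun z hz => Bukhgeim.cauchyConverges hp hf hz,
    Bukhgeim.ae_beurlingConverges hp hf⟩, ⟨Ca₀, Bp₀, hCa₀, hBp₀⟩, ?_⟩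
  intro Ca Bp hCa _ q₁ q₂ hq₁ hq₂ z₀ hz₀ n hn
  have hn' : 1 < |n| := hn.trans_le (le_abs_self n)
  have habs : |n| = n := abs_of_pos (by linarith)
  have hC : ∀ q : ℂ → ℂ, Bukhgeim.lpDisc p q ≤ max (Bukhgeim.lpDisc p q₁) (Bukhgeim.lpDisc p q₂) →
      400 * (Ca + 11) * Ca * Bukhgeim.lpDisc p q ≤ Bukhgeim.boundConst p Ca Bp q₁ q₂ := by
    intro q hq
    unfold Bukhgeim.boundConst
    gcongr
    exact le_self_add
  have h₁ : ∀ f, Bukhgeim.MemHolderDisc (1 - 2 / p) f →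
      Bukhgeim.MemHolderDisc (1 - 2 / p) (Bukhgeim.opT n z₀ q₁ f) ∧
        Bukhgeim.holderNorm (1 - 2 / p) (Bukhgeim.opT n z₀ q₁ f) ≤
          Bukhgeim.boundConst p Ca Bp q₁ q₂ *
            ENNReal.ofReal (n ^ (-(2 / (p * (2 * p + 1))))) * Bukhgeim.supDisc f := by
    intro f hf
    obtain ⟨a, b⟩ := Bukhgeim.memHolderDisc_opT_and_le hp hCa hn' hz₀ hq₁ hf
    rw [habs] at b
    exact ⟨a, b.trans (by gcongr; exact hC q₁ (le_max_left _ _))⟩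
  have h₂ : ∀ f, Bukhgeim.MemHolderDisc (1 - 2 / p) f →
      Bukhgeim.MemHolderDisc (1 - 2 / p) (Bukhgeim.opTBar n z₀ q₂ f) ∧
        Bukhgeim.holderNorm (1 - 2 / p) (Bukhgeim.opTBar n z₀ q₂ f) ≤
          Bukhgeim.boundConst p Ca Bp q₁ q₂ *
            ENNReal.ofReal (n ^ (-(2 / (p * (2 * p + 1))))) * Bukhgeim.supDisc f := by
    intro f hf
    obtain ⟨a, b⟩ := Bukhgeim.memHolderDisc_opTBar_and_le hp hCa hn' hz₀ hq₂ hf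
    rw [habs] at b
    exact ⟨a, b.trans (by gcongr; exact hC q₂ (le_max_right _ _))⟩
  refine ⟨fun f hf => ⟨h₁ f hf, h₂ f hf⟩, fun hlarge => ?_⟩
  have hK := Bukhgeim.mul_rpow_neg_lt_two hn (by positivity) hlarge
  rw [inv_div] at hK
  exact ⟨Bukhgeim.isHalfContraction_of_le hK h₁ fun f g hf hg z hz =>
      Bukhgeim.opT_sub hp hCa hq₁ hf hg hz,
    Bukhgeim.isHalfContraction_of_le hK h₂ fun f g hf hg z hz =>
      Bukhgeim.opTBar_sub hp hCa hq₂ hf hg hz⟩
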